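/- Let $\mathbb C_q=\mathbb C[q,q^{-1}]$, $p(1)=\dots=p(4)=0$, $p(5)=1$ and $\pi_{ij}=p(i)+p(j)\bmod 2$. Let $\mathcal O(\mathrm{GL}_q(4|1))$ be the $\mathbb C_q$-superalgebra generated by elements $a_{ij}$ ($1\le i,j\le5$) of parity $\pi_{ij}$ and even elements $D_1^{-1},D_2^{-1}$, subject to $a_{ij}^2=0$ for $\pi_{ij}=1$, the Manin relations $$a_{ij}a_{il}=(-1)^{\pi_{ij}\pi_{il}}q^{(-1)^{p(i)+1}}a_{il}a_{ij}\ (j<l),\qquad a_{ij}a_{kj}=(-1)^{\pi_{ij}\pi_{kj}}q^{(-1)^{p(j)+1}}a_{kj}a_{ij}\ (i<k),$$ $$a_{ij}a_{kl}=(-1)^{\pi_{ij}\pi_{kl}}a_{kl}a_{ij}\ (i<k,\ j>l\ \text{ or }\ i>k,\ j<l),$$ $$a_{ij}a_{kl}-(-1)^{\pi_{ij}\pi_{kl}}a_{kl}a_{ij}=(-1)^{\pi_{ij}\pi_{kj}}(q^{-1}-q)a_{kj}a_{il}\ (i<k,\ j<l),$$ and the relations saying that $D_1^{-1}$, $D_2^{-1}$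 are two-sided inverses of $D_1=\det_q(a_{ij})_{i,j\le4}$ and $D_2=a_{55}$, where $\det_q(m_{ij})=\sum_{\sigma\in S_4}(-q)^{-\ell(\sigma)}m_{1\sigma(1)}\cdots m_{4\sigma(4)}$. Let $$\mathrm{Ber}_q=\det{}_q\big(a_{ij}-a_{i5}a_{55}^{-1}a_{5j}\big)_{i,j\le4}\;a_{55}^{-1}$$ be the quantum Berezinian and $\mathcal O(\mathrm{SL}_q(4|1))=\mathcal O(\mathrm{GL}_q(4|1))/\langle \mathrm{Ber}_q-1\rangle$. Write $g_{ij}$ for the even and $\gamma_{ij}$ for the odd generators $a_{ij}$ of $\mathcal O(\mathrm{SL}_q(4|1))$. A Hopf superalgebra $A$ is a $\mathbb Z/2$-graded algebra with an even coassociative counital comultiplication $\Delta$ and an even counit $\varepsilon$ that are algebra homomorphisms (for the product $(a\otimes b)(c\otimes d)=(-1)^{|b||c|}ac\otimes bd$ on $A\otimes A$), and an even antipode $S$. A Hopf ideal of $A$ is a homogeneous two-sided ideal $I$ with $\Delta(I)\subseteq I\otimes A+A\otimes I$, $\varepsilon(I)=0$ and $S(I)\subseteq I$. **Proposition.** The superalgebra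 $\mathcal O(\mathrm{SL}_q(4|1))$ has a unique Hopf superalgebra structure with $\Delta(a_{ij})=\sum_k a_{ik}\otimes a_{kj}$ and $\varepsilon(a_{ij})=\delta_{ij}$. For this structure: 1. The two-sided ideal $\mathcal I_q$ of $\mathcal O(\mathrm{SL}_q(4|1))$ generated by $g_{13},g_{14},g_{23},g_{24},\gamma_{15},\gamma_{25}$ is a Hopf ideal. Hence the quotient $\mathcal O(P_{l,q})=\mathcal O(\mathrm{SL}_q(4|1))/\mathcal I_q$ (the quantum lower parabolic supergroup) has a unique Hopf superalgebra structure for which the projection is a homomorphism of Hopf superalgebras. 2. The two-sided ideal of $\mathcal O(P_{l,q})$ generated by the entries of $\xi=(g_{55}^{-1}\gamma_{53},\,g_{55}^{-1}\gamma_{54})$ is a Hopf ideal. Hence the quotient of $\mathcal O(P_{l,q})$ by $\xi=0$ (the quantum super Poincaré group times dilations) has a unique Hopf superalgebra structure for which the projection is a homomorphism of Hopf superalgebras. -/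

import Mathlib

open scoped TensorProduct

/-! ### Superalgebras: gradings by `ZMod 2` -/

/-- For a family `g` of elements of `A` with prescribed parities `p`, the submodule spanned by the
products `g x₁ ⋯ g xₙ` (`n ≥ 0`) of total parity `i`. -/
def parityPart (R : Type*) {X A : Type*} [CommRing R] [Ring A] [Algebra R A]
    (g : X → A) (p : X → ZMod 2) (i : ZMod 2) : Submodule R A :=
  Submodule.span R {x | ∃ w : List X, (w.map p).sum = i ∧ (w.map g).prod = x}

theorem parityPart_one_mem {R X A : Type*} [CommRing R] [Ring A] [Algebra R A]
    (g : X → A) (p : X → ZMod 2) : (1 : A) ∈ parityPart R g p 0 :=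
  Submodule.subset_span ⟨[], by simp, by simp⟩

theorem parityPart_gen_mem {R X A : Type*} [CommRing R] [Ring A] [Algebra R A]
    (g : X → A) (p : X → ZMod 2) (x : X) : g x ∈ parityPart R g p (p x) :=
  Submodule.subset_span ⟨[x], by simp, by simp⟩

theorem parityPart_mul_mem {R X A : Type*} [CommRing R] [Ring A] [Algebra R A]
    (g : X → A) (p : X → ZMod 2) {i j : ZMod 2} {x y : A}
    (hx : x ∈ parityPart R g p i) (hy : y ∈ parityPart R g p j) :
    x * y ∈ parityPart R g p (i + j) := by
  have h : parityPart R g p i * parityPart R g p j ≤ parityPart R g p (i + j) := by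
    unfold parityPart
    rw [Submodule.span_mul_span, Submodule.span_le]
    rintro _ ⟨_, ⟨w, hw, rfl⟩, _, ⟨v, hv, rfl⟩, rfl⟩
    exact Submodule.subset_span ⟨w ++ v, by simp [hw, hv], by simp⟩
  exact h (Submodule.mul_mem_mul hx hy)

/-- If `g` generates `A` and `A` has an algebra endomorphism acting on each `g x` by its parity
sign, then the parity parts are a `ZMod 2`-grading (here `2` is invertible). -/
@[reducible] noncomputable def parityGradedAlgebra {R X A : Type*} [CommRing R] [Invertible (2 : R)] [Ring A]
    [Algebra R A] (g : X → A) (p : X → ZMod 2) (hg : Algebra.adjoin R (Set.range g) = ⊤)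
    (s : A →ₐ[R] A) (hs : ∀ x, s (g x) = if p x = 0 then g x else -g x) :
    GradedAlgebra (parityPart R g p) := by
  have hw : ∀ w : List X, s (w.map g).prod =
      if (w.map p).sum = 0 then (w.map g).prod else -(w.map g).prod := by
    intro w
    induction w with
    | nil => simp
    | cons x w ih =>
      simp only [List.map_cons, List.prod_cons, List.sum_cons, map_mul, ih, hs]
      generalize p x = a
      generalize (w.map p).sum = b
      have ha : a = 0 ∨ a = 1 := by revert a; decide
      have hb : b = 0 ∨ b = 1 := by revert b; decide
      have h11 : (1 : ZMod 2) + 1 = 0 := rfl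
      obtain rfl | rfl := ha <;> obtain rfl | rfl := hb <;> simp [h11]
  have h0 : ∀ x ∈ parityPart R g p 0, s x = x := by
    intro x hx
    induction hx using Submodule.span_induction with
    | mem x hx => obtain ⟨w, h, rfl⟩ := hx; rw [hw, if_pos h]
    | zero => simp
    | add x y _ _ hx hy => rw [map_add, hx, hy]
    | smul c x _ hx => rw [map_smul, hx]
  have h1 : ∀ x ∈ parityPart R g p 1, s x = -x := by
    intro x hx
    induction hx using Submodule.span_induction with
    | mem x hx => obtain ⟨w, h, rfl⟩ := hx; rw [hw, if_neg (by rw [h]; decide)]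
    | zero => simp
    | add x y _ _ hx hy => rw [map_add, hx, hy]; abel
    | smul c x _ hx => rw [map_smul, hx, smul_neg]
  have htop : ∀ x : A, x ∈ Submodule.span R (Set.range fun w : List X => (w.map g).prod) := by
    intro x
    have hx : x ∈ Algebra.adjoin R (Set.range g) := by rw [hg]; trivial
    rw [← Subalgebra.mem_toSubmodule, Algebra.adjoin_eq_span] at hx
    refine Submodule.span_mono ?_ hx
    intro y hy
    induction hy using Submonoid.closure_induction with
    | mem y hy => obtain ⟨x, rfl⟩ := hy; exact ⟨[x], by simp⟩
    | one => exact ⟨[], by simp⟩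
    | mul y z _ _ hy hz =>
      obtain ⟨v, rfl⟩ := hy
      obtain ⟨w, rfl⟩ := hz
      exact ⟨v ++ w, by simp⟩
  have two : ∀ x : A, (⅟(2 : R)) • (x + x) = x := by
    intro x
    rw [← two_smul R x, smul_smul, invOf_mul_self, one_smul]
  have he : ∀ x, (⅟(2 : R)) • (x + s x) ∈ parityPart R g p 0 := by
    intro x
    induction htop x using Submodule.span_induction with
    | mem x hx =>
      obtain ⟨w, rfl⟩ := hx
      simp only [hw]
      split_ifs with h
      · rw [two]; exact Submodule.subset_span ⟨w, h, rfl⟩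
      · simp
    | zero => simp
    | add x y _ _ hx hy =>
      have := add_mem hx hy
      rw [← smul_add] at this
      rw [map_add]
      convert this using 2
      abel
    | smul c x _ hx =>
      rw [map_smul, ← smul_add, smul_comm]
      exact Submodule.smul_mem _ c hx
  have ho : ∀ x, (⅟(2 : R)) • (x - s x) ∈ parityPart R g p 1 := by
    intro x
    induction htop x using Submodule.span_induction with
    | mem x hx =>
      obtain ⟨w, rfl⟩ := hx
      simp only [hw]
      split_ifs with h
      · simp
      · rw [sub_neg_eq_add, two]
        refine Submodule.subset_span ⟨w, ?_, rfl⟩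
        revert h
        generalize (w.map p).sum = b
        revert b
        decide
    | zero => simp
    | add x y _ _ hx hy =>
      have := add_mem hx hy
      rw [← smul_add] at this
      rw [map_add]
      convert this using 2
      abel
    | smul c x _ hx =>
      rw [map_smul, ← smul_sub, smul_comm]
      exact Submodule.smul_mem _ c hx
  let D : A →+ DirectSum (ZMod 2) fun i => parityPart R g p i :=
    { toFun := fun x => DirectSum.of (fun i => parityPart R g p i) 0 ⟨_, he x⟩ +
        DirectSum.of (fun i => parityPart R g p i) 1 ⟨_, ho x⟩
      map_zero' := by
        have e : ∀ h, (⟨(⅟(2 : R)) • ((0 : A) + s 0), h⟩ : parityPart R g p 0) = 0 :=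
          fun h => Subtype.ext (by simp)
        have o : ∀ h, (⟨(⅟(2 : R)) • ((0 : A) - s 0), h⟩ : parityPart R g p 1) = 0 :=
          fun h => Subtype.ext (by simp)
        rw [e, o, map_zero, map_zero, add_zero]
      map_add' := by
        intro x y
        have e : (⟨_, he (x + y)⟩ : parityPart R g p 0) = ⟨_, he x⟩ + ⟨_, he y⟩ :=
          Subtype.ext (by simp only [map_add, Submodule.coe_add, ← smul_add]; congr 1; abel)
        have o : (⟨_, ho (x + y)⟩ : parityPart R g p 1) = ⟨_, ho x⟩ + ⟨_, ho y⟩ :=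
          Subtype.ext (by simp only [map_add, Submodule.coe_add, ← smul_add]; congr 1; abel)
        rw [e, o, map_add, map_add]
        abel }
  have hD : ∀ x, D x = DirectSum.of (fun i => parityPart R g p i) 0 ⟨_, he x⟩ +
      DirectSum.of (fun i => parityPart R g p i) 1 ⟨_, ho x⟩ := fun _ => rfl
  exact
    { one_mem := parityPart_one_mem g p
      mul_mem := fun _ _ _ _ hx hy => parityPart_mul_mem g p hx hy
      decompose' := D
      left_inv := by
        intro x
        rw [hD, map_add, DirectSum.coeAddMonoidHom_of, DirectSum.coeAddMonoidHom_of]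
        change (⅟(2 : R)) • (x + s x) + (⅟(2 : R)) • (x - s x) = x
        rw [← smul_add, add_add_sub_cancel, two]
      right_inv := by
        intro x
        suffices H : D.comp (DirectSum.coeAddMonoidHom fun i => parityPart R g p i) =
            AddMonoidHom.id _ from DFunLike.congr_fun H x
        ext i : 1
        ext x : 1
        simp only [AddMonoidHom.comp_apply, DirectSum.coeAddMonoidHom_of, AddMonoidHom.id_apply]
        rw [hD]
        have hi : i = 0 ∨ i = 1 := by clear x; revert i; decide
        obtain rfl | rfl := hi
        · have e : (⟨_, he x.1⟩ : parityPart R g p 0) = x :=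
            Subtype.ext (by change (⅟(2 : R)) • (x.1 + s x.1) = x.1; rw [h0 _ x.2, two])
          have o : (⟨_, ho x.1⟩ : parityPart R g p 1) = 0 :=
            Subtype.ext (by change (⅟(2 : R)) • (x.1 - s x.1) = 0; rw [h0 _ x.2]; simp)
          rw [e, o, map_zero, add_zero]
        · have e : (⟨_, he x.1⟩ : parityPart R g p 0) = 0 :=
            Subtype.ext (by change (⅟(2 : R)) • (x.1 + s x.1) = 0; rw [h1 _ x.2]; simp)
          have o : (⟨_, ho x.1⟩ : parityPart R g p 1) = x :=
            Subtype.ext (by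
              change (⅟(2 : R)) • (x.1 - s x.1) = x.1
              rw [h1 _ x.2, sub_neg_eq_add, two])
          rw [e, o, map_zero, zero_add] }

/-- The grading of the quotient by a two-sided ideal: `(A ⧸ I)ᵢ` is the image of `Aᵢ`. -/
def quotientGrading {R A : Type*} [CommRing R] [Ring A] [Algebra R A]
    (𝒜 : ZMod 2 → Submodule R A) (I : Ideal A) [I.IsTwoSided] (i : ZMod 2) :
    Submodule R (A ⧸ I) :=
  (𝒜 i).map (Ideal.Quotient.mkₐ R I).toLinearMap

/-- The quotient of a superalgebra by a homogeneous two-sided ideal is a superalgebra. -/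
@[reducible] noncomputable def quotientGradedAlgebra {R A : Type*} [CommRing R] [Ring A] [Algebra R A]
    (𝒜 : ZMod 2 → Submodule R A) [GradedAlgebra 𝒜] (I : Ideal A) [I.IsTwoSided]
    (hI : I.IsHomogeneous 𝒜) : GradedAlgebra (quotientGrading 𝒜 I) := by
  let F : ∀ i, 𝒜 i →+ quotientGrading 𝒜 I i := fun i =>
    { toFun := fun x => ⟨Ideal.Quotient.mk I x, Submodule.mem_map_of_mem x.2⟩
      map_zero' := Subtype.ext (by simp)
      map_add' := fun x y => Subtype.ext (by simp) }
  let D₀ : A →+ DirectSum (ZMod 2) fun i => quotientGrading 𝒜 I i :=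
    (DirectSum.map F).comp (DirectSum.decomposeAddEquiv 𝒜).toAddMonoidHom
  have hD₀ : ∀ x ∈ I, D₀ x = 0 := by
    intro x hx
    refine DFinsupp.ext fun i => ?_
    change DirectSum.map F (DirectSum.decompose 𝒜 x) i = 0
    rw [DirectSum.map_apply]
    exact Subtype.ext (Ideal.Quotient.eq_zero_iff_mem.2 (hI i hx))
  have hcoe : ∀ x : A, D₀ x = ∑ i : ZMod 2, DirectSum.of (fun i => quotientGrading 𝒜 I i) i
      (F i (DirectSum.decompose 𝒜 x i)) := by
    intro x
    refine DFinsupp.ext fun j => ?_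
    change DirectSum.map F (DirectSum.decompose 𝒜 x) j = _
    rw [DirectSum.map_apply, DFinsupp.finsetSum_apply,
      Finset.sum_eq_single j (fun i _ hij => DirectSum.of_eq_of_ne _ _ _ (Ne.symm hij))
        (fun h => absurd (Finset.mem_univ j) h)]
    exact (DirectSum.of_eq_same (β := fun i => quotientGrading 𝒜 I i) _ _).symm
  let D : A ⧸ I →+ DirectSum (ZMod 2) fun i => quotientGrading 𝒜 I i :=
    QuotientAddGroup.lift I.toAddSubgroup D₀ hD₀
  exact
    { one_mem := ⟨1, SetLike.GradedOne.one_mem, map_one (Ideal.Quotient.mkₐ R I)⟩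
      mul_mem := by
        rintro i j _ _ ⟨x, hx, rfl⟩ ⟨y, hy, rfl⟩
        exact ⟨x * y, SetLike.GradedMul.mul_mem hx hy, map_mul (Ideal.Quotient.mkₐ R I) x y⟩
      decompose' := D
      left_inv := by
        intro x
        obtain ⟨x, rfl⟩ := Ideal.Quotient.mk_surjective x
        change DirectSum.coeAddMonoidHom _ (D₀ x) = _
        rw [hcoe, map_sum]
        simp only [DirectSum.coeAddMonoidHom_of]
        change ∑ i, Ideal.Quotient.mk I (DirectSum.decompose 𝒜 x i : A) = _
        rw [← map_sum]
        congr 1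
        classical
        conv_rhs => rw [← DirectSum.sum_support_decompose 𝒜 x]
        refine (Finset.sum_subset (Finset.subset_univ _) fun i _ hi => ?_).symm
        simpa using hi
      right_inv := by
        intro x
        suffices H : D.comp (DirectSum.coeAddMonoidHom fun i => quotientGrading 𝒜 I i) =
            AddMonoidHom.id _ from DFunLike.congr_fun H x
        ext i : 1
        ext x : 1
        obtain ⟨_, x, hx, rfl⟩ := x
        simp only [AddMonoidHom.comp_apply, DirectSum.coeAddMonoidHom_of, AddMonoidHom.id_apply]
        change D₀ x = _
        change DirectSum.map F (DirectSum.decompose 𝒜 x) = _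
        rw [DirectSum.decompose_of_mem 𝒜 hx, DirectSum.map_of]
        rfl }

/-- A two-sided ideal generated by homogeneous elements is homogeneous. -/
theorem isHomogeneous_span_of_homogeneous {R A : Type*} [CommRing R] [Ring A] [Algebra R A]
    (𝒜 : ZMod 2 → Submodule R A) [GradedAlgebra 𝒜] (s : Set A)
    (hs : ∀ x ∈ s, ∃ i, x ∈ 𝒜 i) :
    (TwoSidedIdeal.span s).asIdeal.IsHomogeneous 𝒜 := by
  intro i x hx
  change x ∈ TwoSidedIdeal.asIdeal _ at hx
  rw [TwoSidedIdeal.mem_asIdeal] at hx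
  rw [TwoSidedIdeal.mem_asIdeal]
  have key : ∀ x ∈ TwoSidedIdeal.span s, ∀ i, (DirectSum.decompose 𝒜 x i : A) ∈
      TwoSidedIdeal.span s := by
    intro x hx
    rw [TwoSidedIdeal.mem_span_iff_mem_addSubgroup_closure] at hx
    induction hx using AddSubgroup.closure_induction with
    | mem x hx =>
      obtain ⟨_, ⟨a, -, y, hy, rfl⟩, b, -, rfl⟩ := hx
      obtain ⟨j, hj⟩ := hs y hy
      have hy' := TwoSidedIdeal.subset_span hy
      induction a using DirectSum.Decomposition.inductionOn 𝒜 with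
      | zero => intro i; simp
      | add a a' ha ha' =>
        intro i
        simp only [add_mul, DirectSum.decompose_add, DirectSum.add_apply, Submodule.coe_add]
        exact TwoSidedIdeal.add_mem _ (ha i) (ha' i)
      | homogeneous a =>
        induction b using DirectSum.Decomposition.inductionOn 𝒜 with
        | zero => intro i; simp
        | add b b' hb hb' =>
          intro i
          simp only [mul_add, DirectSum.decompose_add, DirectSum.add_apply, Submodule.coe_add]
          exact TwoSidedIdeal.add_mem _ (hb i) (hb' i)
        | homogeneous b =>
          rename_i k l
          intro i
          have hm : (a : A) * y * b ∈ 𝒜 (k + j + l) :=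
            SetLike.GradedMul.mul_mem (SetLike.GradedMul.mul_mem a.2 hj) b.2
          have hmem : (a : A) * y * b ∈ TwoSidedIdeal.span s :=
            TwoSidedIdeal.mul_mem_right _ _ _ (TwoSidedIdeal.mul_mem_left _ _ _ hy')
          by_cases h : k + j + l = i
          · subst h
            rwa [DirectSum.decompose_of_mem_same 𝒜 hm]
          · rw [DirectSum.decompose_of_mem_ne 𝒜 hm h]
            exact TwoSidedIdeal.zero_mem _
    | zero => intro i; simp
    | add x y _ _ hx hy =>
      intro i
      simp only [DirectSum.decompose_add, DirectSum.add_apply, Submodule.coe_add]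
      exact TwoSidedIdeal.add_mem _ (hx i) (hy i)
    | neg x _ hx =>
      intro i
      have : (DirectSum.decompose 𝒜 (-x) i : A) = -(DirectSum.decompose 𝒜 x i : A) := by
        rw [DirectSum.decompose_neg]; rfl
      rw [this]
      exact TwoSidedIdeal.neg_mem _ (hx i)
  exact key x hx i

/-! ### Hopf superalgebras -/

/-- A Hopf superalgebra structure on the superalgebra `A = 𝒜 0 ⊕ 𝒜 1`: a coalgebra structure
whose comultiplication and counit are even and are algebra homomorphisms, where `A ⊗ A` carries
the multiplication `(a ⊗ b) (c ⊗ d) = (-1) ^ (|b| |c|) ac ⊗ bd`, and an even antipode. -/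
structure HopfSuperalgebra {R A : Type*} [CommRing R] [Ring A] [Algebra R A]
    (𝒜 : ZMod 2 → Submodule R A) [GradedAlgebra 𝒜] extends Coalgebra R A where
  comul_one : comul 1 = 1 ⊗ₜ[R] 1
  comul_mul : ∀ x y : A, GradedTensorProduct.of R 𝒜 𝒜 (comul (x * y)) =
    GradedTensorProduct.of R 𝒜 𝒜 (comul x) * GradedTensorProduct.of R 𝒜 𝒜 (comul y)
  counit_one : counit 1 = 1
  counit_mul : ∀ x y : A, counit (x * y) = counit x * counit y
  comul_even : ∀ i, ∀ x ∈ 𝒜 i, comul x ∈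
    ⨆ j : ZMod 2, LinearMap.range (TensorProduct.map (𝒜 j).subtype (𝒜 (i - j)).subtype)
  counit_even : ∀ x ∈ 𝒜 1, counit x = 0
  antipode : A →ₗ[R] A
  antipode_even : ∀ i, ∀ x ∈ 𝒜 i, antipode x ∈ 𝒜 i
  mul_antipode_rTensor_comul :
    LinearMap.mul' R A ∘ₗ antipode.rTensor A ∘ₗ comul = Algebra.linearMap R A ∘ₗ counit
  mul_antipode_lTensor_comul :
    LinearMap.mul' R A ∘ₗ antipode.lTensor A ∘ₗ comul = Algebra.linearMap R A ∘ₗ counit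

/-- The two-sided ideal `I` is a Hopf ideal: it is homogeneous, `Δ(I) ⊆ I ⊗ A + A ⊗ I`,
`ε(I) = 0` and `S(I) ⊆ I`. -/
structure HopfSuperalgebra.IsHopfIdeal {R A : Type*} [CommRing R] [Ring A] [Algebra R A]
    {𝒜 : ZMod 2 → Submodule R A} [GradedAlgebra 𝒜] (H : HopfSuperalgebra 𝒜)
    (I : Ideal A) [I.IsTwoSided] : Prop where
  homogeneous : I.IsHomogeneous 𝒜
  comul_mem : ∀ x ∈ I, H.comul x ∈
    LinearMap.range ((I.restrictScalars R).subtype.rTensor A) ⊔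
      LinearMap.range ((I.restrictScalars R).subtype.lTensor A)
  counit_eq_zero : ∀ x ∈ I, H.counit x = 0
  antipode_mem : ∀ x ∈ I, H.antipode x ∈ I

/-- `f` is a homomorphism of Hopf superalgebras. -/
structure IsHopfSuperalgebraHom {R A B : Type*} [CommRing R] [Ring A] [Algebra R A]
    [Ring B] [Algebra R B] {𝒜 : ZMod 2 → Submodule R A} [GradedAlgebra 𝒜]
    {ℬ : ZMod 2 → Submodule R B} [GradedAlgebra ℬ]
    (H : HopfSuperalgebra 𝒜) (K : HopfSuperalgebra ℬ) (f : A →ₐ[R] B) : Prop where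
  even : ∀ i, ∀ x ∈ 𝒜 i, f x ∈ ℬ i
  comul : ∀ x, K.comul (f x) = TensorProduct.map f.toLinearMap f.toLinearMap (H.comul x)
  counit : ∀ x, K.counit (f x) = H.counit x
  antipode : ∀ x, K.antipode (f x) = f (H.antipode x)

/-! ### The quantum supergroups `GL_q(4|1)` and `SL_q(4|1)` -/

namespace QuantumSuper

/-- `ℂ_q = ℂ[q, q⁻¹]`; the integer power `q ^ n` is `LaurentPolynomial.T n`. -/
abbrev Cq : Type := LaurentPolynomial ℂ

noncomputable instance : Invertible (2 : Cq) :=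
  (Invertible.map (algebraMap ℂ Cq) 2).copy 2 (map_ofNat _ 2).symm

/-- `q ^ n`. -/
noncomputable def qpow (n : ℤ) : Cq := LaurentPolynomial.T n

/-- The parity `p(i)` of an index: the indices `1, …, 4` (here `0, …, 3`) are even, the index
`5` (here `4`) is odd. -/
def idx (i : Fin 5) : ℕ := if i = 4 then 1 else 0

/-- The parity `π(a_ij) = p(i) + p(j)` mod 2. -/
def par (i j : Fin 5) : ℕ := (idx i + idx j) % 2

/-- The generators of `GL_q(4|1)`: the matrix entries `a_ij` and the even `D₁⁻¹`, `D₂⁻¹`. -/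
inductive Gen : Type
  | a (i j : Fin 5)
  | D₁inv
  | D₂inv

/-- The parity of a generator. -/
def Gen.parity : Gen → ZMod 2
  | .a i j => (par i j : ZMod 2)
  | .D₁inv => 0
  | .D₂inv => 0

/-- The length (number of inversions) of a permutation. -/
def permLength {n : ℕ} (σ : Equiv.Perm (Fin n)) : ℕ :=
  (Finset.univ.filter fun x : Fin n × Fin n => x.1 < x.2 ∧ σ x.2 < σ x.1).card

/-- The quantum determinant `∑_σ (-q)^{-l(σ)} M_{1σ(1)} ⋯ M_{nσ(n)}`. -/
noncomputable def qdet {A : Type*} [Ring A] [Algebra Cq A] {n : ℕ}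
    (M : Matrix (Fin n) (Fin n) A) : A :=
  ∑ σ : Equiv.Perm (Fin n), ((-1 : Cq) ^ permLength σ * qpow (-(permLength σ : ℤ))) •
    (List.ofFn fun i => M i (σ i)).prod

/-- The free algebra on the generators. -/
abbrev FreeGL : Type := FreeAlgebra Cq Gen

/-- The generator `a_ij` of the free algebra. -/
noncomputable def fa (i j : Fin 5) : FreeGL := FreeAlgebra.ι Cq (Gen.a i j)

/-- The quantum determinant `D₁` of the even-even `4 × 4` block. The quantum determinant `D₂`
of the `1 × 1` block is `a₅₅`. -/
noncomputable def fD₁ : FreeGL :=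
  qdet (Matrix.of fun i j : Fin 4 => fa i.castSucc j.castSucc)

/-- The defining relations of `GL_q(4|1)`: the odd generators square to zero, the Manin
relations, and the invertibility of `D₁` and `D₂ = a₅₅`. -/
inductive GLRel : FreeGL → FreeGL → Prop
  | sq (i j : Fin 5) (h : par i j = 1) : GLRel (fa i j * fa i j) 0
  | row (i j l : Fin 5) (h : j < l) : GLRel (fa i j * fa i l)
      (((-1 : Cq) ^ (par i j * par i l) * qpow ((-1) ^ (idx i + 1))) • (fa i l * fa i j))
  | col (i k j : Fin 5) (h : i < k) : GLRel (fa i j * fa k j)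
      (((-1 : Cq) ^ (par i j * par k j) * qpow ((-1) ^ (idx j + 1))) • (fa k j * fa i j))
  | comm (i j k l : Fin 5) (h : i < k ∧ l < j ∨ k < i ∧ j < l) : GLRel (fa i j * fa k l)
      ((-1 : Cq) ^ (par i j * par k l) • (fa k l * fa i j))
  | cross (i j k l : Fin 5) (h : i < k ∧ j < l) : GLRel
      (fa i j * fa k l)
      ((-1 : Cq) ^ (par i j * par k l) • (fa k l * fa i j) +
        ((-1 : Cq) ^ (par i j * par k j) * (qpow (-1) - qpow 1)) • (fa k j * fa i l))
  | D₁_mul : GLRel (fD₁ * FreeAlgebra.ι Cq Gen.D₁inv) 1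
  | mul_D₁ : GLRel (FreeAlgebra.ι Cq Gen.D₁inv * fD₁) 1
  | D₂_mul : GLRel (fa 4 4 * FreeAlgebra.ι Cq Gen.D₂inv) 1
  | mul_D₂ : GLRel (FreeAlgebra.ι Cq Gen.D₂inv * fa 4 4) 1

/-- `O(GL_q(4|1))`. -/
def OGL : Type := RingQuot GLRel

noncomputable instance : Ring OGL := inferInstanceAs (Ring (RingQuot GLRel))

noncomputable instance : Algebra Cq OGL := inferInstanceAs (Algebra Cq (RingQuot GLRel))

/-- The projection from the free algebra. -/
noncomputable def glMk : FreeGL →ₐ[Cq] OGL := RingQuot.mkAlgHom Cq GLRel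

theorem glMk_surjective : Function.Surjective glMk := RingQuot.mkAlgHom_surjective Cq GLRel

theorem glMk_rel {x y : FreeGL} (h : GLRel x y) : glMk x = glMk y := RingQuot.mkAlgHom_rel Cq h

/-- The universal property of `O(GL_q(4|1))`. -/
noncomputable def glLift {B : Type*} [Semiring B] [Algebra Cq B] (f : FreeGL →ₐ[Cq] B)
    (hf : ∀ ⦃x y⦄, GLRel x y → f x = f y) : OGL →ₐ[Cq] B :=
  RingQuot.liftAlgHom Cq ⟨f, hf⟩

theorem glLift_glMk {B : Type*} [Semiring B] [Algebra Cq B] (f : FreeGL →ₐ[Cq] B)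
    (hf : ∀ ⦃x y⦄, GLRel x y → f x = f y) (x : FreeGL) : glLift f hf (glMk x) = f x :=
  RingQuot.liftAlgHom_mkAlgHom_apply Cq f hf x

/-- The generators of `O(GL_q(4|1))`. -/
noncomputable def glGen (x : Gen) : OGL := glMk (FreeAlgebra.ι Cq x)

theorem adjoin_glGen : Algebra.adjoin Cq (Set.range glGen) = ⊤ := by
  have h : Set.range glGen =
      glMk '' Set.range (FreeAlgebra.ι Cq : Gen → FreeGL) := by
    rw [← Set.range_comp]; rfl
  rw [h, ← AlgHom.map_adjoin, FreeAlgebra.adjoin_range_ι, Algebra.map_top,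
    AlgHom.range_eq_top]
  exact glMk_surjective

/-- The parity automorphism on the free algebra. -/
noncomputable def freeSign : FreeGL →ₐ[Cq] FreeGL :=
  FreeAlgebra.lift Cq fun x =>
    (if x.parity = 0 then (1 : Cq) else -1) • FreeAlgebra.ι Cq x

theorem par_cases (i j : Fin 5) : par i j = 0 ∨ par i j = 1 := by
  have := Nat.mod_lt (idx i + idx j) (y := 2) (by norm_num)
  unfold par
  omega

theorem freeSign_fa (i j : Fin 5) : freeSign (fa i j) = (-1 : Cq) ^ par i j • fa i j := by
  unfold freeSign fa
  rw [FreeAlgebra.lift_ι_apply]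
  rcases par_cases i j with h | h
  · simp [Gen.parity, h]
  · rw [h, pow_one, if_neg (by simp [Gen.parity, h])]

theorem freeSign_fD₁ : freeSign fD₁ = fD₁ := by
  have h : ∀ i j : Fin 4, freeSign (fa i.castSucc j.castSucc) = fa i.castSucc j.castSucc := by
    intro i j
    have : par i.castSucc j.castSucc = 0 := by revert i j; decide
    rw [freeSign_fa, this, pow_zero, one_smul]
  simp only [fD₁, qdet, map_sum, map_smul, map_list_prod, List.map_ofFn, Matrix.of_apply,
    Function.comp_def, h]

/-- The parity automorphism of `O(GL_q(4|1))`. -/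
noncomputable def glSign : OGL →ₐ[Cq] OGL :=
  glLift (glMk.comp freeSign) (by
    have e : ∀ m n : ℕ, ∀ x y : FreeGL, ((-1 : Cq) ^ m • x) * ((-1 : Cq) ^ n • y) =
        (-1 : Cq) ^ (m + n) • (x * y) := by
      intro m n x y
      rw [smul_mul_smul_comm, pow_add]
    have hp : ∀ i j k l : Fin 5, (-1 : Cq) ^ (par k j + par i l) =
        (-1 : Cq) ^ (par i j + par k l) := by
      intro i j k l
      have : (par k j + par i l) % 2 = (par i j + par k l) % 2 := by unfold par; omega
      rw [neg_one_pow_eq_pow_mod_two, this, ← neg_one_pow_eq_pow_mod_two]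
    have hD : ∀ x : Gen, x.parity = 0 → freeSign (FreeAlgebra.ι Cq x) = FreeAlgebra.ι Cq x := by
      intro x hx
      simp [freeSign, hx]
    intro x y h
    have h' := glMk_rel h
    rw [AlgHom.comp_apply, AlgHom.comp_apply]
    cases h with
    | sq i j h =>
      rw [map_mul, freeSign_fa, e, map_smul, h', map_zero, map_zero, smul_zero, map_zero]
    | row i j l h =>
      rw [map_mul freeSign, map_smul freeSign, map_mul freeSign, freeSign_fa, freeSign_fa, e, e,
        add_comm (par i l), smul_comm, map_smul, h', ← map_smul]
    | col i k j h =>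
      rw [map_mul freeSign, map_smul freeSign, map_mul freeSign, freeSign_fa, freeSign_fa, e, e,
        add_comm (par k j), smul_comm, map_smul, h', ← map_smul]
    | comm i j k l h =>
      rw [map_mul freeSign, map_smul freeSign, map_mul freeSign, freeSign_fa, freeSign_fa, e, e,
        add_comm (par k l), smul_comm, map_smul, h', ← map_smul]
    | cross i j k l h =>
      rw [map_add freeSign, map_mul freeSign, map_smul freeSign, map_smul freeSign,
        map_mul freeSign, map_mul freeSign, freeSign_fa, freeSign_fa,
        freeSign_fa, freeSign_fa, e, e, e, add_comm (par k l), ← hp i j k l,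
        smul_comm _ ((-1 : Cq) ^ (par k j + par i l)) (fa k l * fa i j),
        smul_comm _ ((-1 : Cq) ^ (par k j + par i l)) (fa k j * fa i l), ← smul_add, map_smul, h',
        ← map_smul]
    | D₁_mul => rw [map_mul, freeSign_fD₁, hD _ rfl, h', map_one freeSign]
    | mul_D₁ => rw [map_mul, freeSign_fD₁, hD _ rfl, h', map_one freeSign]
    | D₂_mul =>
      rw [map_mul, freeSign_fa, show par 4 4 = 0 from rfl, pow_zero, one_smul, hD _ rfl, h',
        map_one freeSign]
    | mul_D₂ =>
      rw [map_mul, freeSign_fa, show par 4 4 = 0 from rfl, pow_zero, one_smul, hD _ rfl, h',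
        map_one freeSign])

theorem glSign_glGen (x : Gen) :
    glSign (glGen x) = if x.parity = 0 then glGen x else -glGen x := by
  unfold glSign glGen
  rw [glLift_glMk, AlgHom.comp_apply, freeSign, FreeAlgebra.lift_ι_apply]
  split_ifs <;> simp

/-- The grading of `O(GL_q(4|1))`. -/
noncomputable def glGrading : ZMod 2 → Submodule Cq OGL := parityPart Cq glGen Gen.parity

noncomputable instance : GradedAlgebra glGrading :=
  parityGradedAlgebra glGen Gen.parity adjoin_glGen glSign glSign_glGen

/-- The quantum Berezinian `Ber_q = det_q(A - B D⁻¹ C) D⁻¹` of the matrix of generators, written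
in blocks as `(A, B; C, D)` with `A` of size `4 × 4` and `D = a₅₅`. -/
noncomputable def ber : OGL :=
  qdet (Matrix.of fun i j : Fin 4 => glGen (.a i.castSucc j.castSucc) -
    glGen (.a i.castSucc 4) * glGen .D₂inv * glGen (.a 4 j.castSucc)) * glGen .D₂inv

/-- The two-sided ideal of `O(GL_q(4|1))` generated by `Ber_q - 1`. -/
noncomputable abbrev berIdeal : Ideal OGL := (TwoSidedIdeal.span {ber - 1}).asIdeal

theorem ber_mem : ber ∈ glGrading 0 := by
  have hg : ∀ x : Gen, glGen x ∈ glGrading x.parity := parityPart_gen_mem glGen Gen.parity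
  have hmul : ∀ {i j k : ZMod 2} {x y : OGL}, x ∈ glGrading i → y ∈ glGrading j → i + j = k →
      x * y ∈ glGrading k := by
    rintro i j _ x y hx hy rfl
    exact SetLike.GradedMul.mul_mem hx hy
  have hM : ∀ i j : Fin 4, glGen (.a i.castSucc j.castSucc) -
      glGen (.a i.castSucc 4) * glGen .D₂inv * glGen (.a 4 j.castSucc) ∈ glGrading 0 := by
    intro i j
    refine sub_mem ?_ (hmul (hmul (hg _) (hg _) rfl) (hg _) ?_)
    · have : (Gen.a i.castSucc j.castSucc).parity = 0 := by revert i j; decide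
      rw [← this]
      exact hg _
    · revert i j; decide
  refine hmul (i := 0) (j := 0) (sum_mem fun σ _ => Submodule.smul_mem _ _ ?_) (hg Gen.D₂inv) rfl
  have hl : ∀ l : List OGL, (∀ x ∈ l, x ∈ glGrading 0) → l.prod ∈ glGrading 0 := by
    intro l
    induction l with
    | nil => intro _; exact SetLike.GradedOne.one_mem
    | cons x l ih =>
      intro h
      rw [List.prod_cons]
      exact hmul (h x (by simp)) (ih fun y hy => h y (by simp [hy])) rfl
  refine hl _ fun x hx => ?_
  obtain ⟨i, rfl⟩ := (List.mem_ofFn' _ _).1 hx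
  exact hM _ _

/-- `O(SL_q(4|1))`. -/
abbrev OSL : Type := OGL ⧸ berIdeal

/-- The grading of `O(SL_q(4|1))`. -/
noncomputable def slGrading : ZMod 2 → Submodule Cq OSL := quotientGrading glGrading berIdeal

noncomputable instance : GradedAlgebra slGrading :=
  quotientGradedAlgebra glGrading berIdeal (isHomogeneous_span_of_homogeneous _ _ (by
    rintro _ rfl
    exact ⟨0, sub_mem ber_mem SetLike.GradedOne.one_mem⟩))

/-- The generators `a_ij` of `O(SL_q(4|1))`, that is `g_ij` when even and `γ_ij` when odd. -/
noncomputable def a (i j : Fin 5) : OSL := Ideal.Quotient.mk berIdeal (glGen (.a i j))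

/-- The inverse of `a₅₅` in `O(SL_q(4|1))`. -/
noncomputable def a55inv : OSL := Ideal.Quotient.mk berIdeal (glGen .D₂inv)

theorem a_mem (i j : Fin 5) : a i j ∈ slGrading (par i j : ZMod 2) :=
  Submodule.mem_map_of_mem (parityPart_gen_mem glGen Gen.parity (.a i j))

theorem a55inv_mem : a55inv ∈ slGrading 0 :=
  Submodule.mem_map_of_mem (parityPart_gen_mem glGen Gen.parity .D₂inv)

theorem a55inv_mul_mem {x : OSL} (hx : x ∈ slGrading 1) : a55inv * x ∈ slGrading 1 := by
  have h : ∀ {i j : ZMod 2} {y z : OSL}, y ∈ slGrading i → z ∈ slGrading j →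
      y * z ∈ slGrading (i + j) := fun hy hz => SetLike.GradedMul.mul_mem hy hz
  have h' := h a55inv_mem hx
  rwa [zero_add] at h'

/-! ### The quantum lower parabolic and super Poincaré supergroups -/

/-- The two-sided ideal `I_q` generated by `g₁₃, g₁₄, g₂₃, g₂₄, γ₁₅, γ₂₅`. -/
noncomputable abbrev parabolicIdeal : Ideal OSL :=
  (TwoSidedIdeal.span {a 0 2, a 0 3, a 1 2, a 1 3, a 0 4, a 1 4}).asIdeal

/-- `O(P_{l,q}) = O(SL_q(4|1)) / I_q`. -/
abbrev Parabolic : Type := OSL ⧸ parabolicIdeal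

/-- The grading of `O(P_{l,q})`. -/
noncomputable def parabolicGrading : ZMod 2 → Submodule Cq Parabolic :=
  quotientGrading slGrading parabolicIdeal

noncomputable instance : GradedAlgebra parabolicGrading :=
  quotientGradedAlgebra slGrading parabolicIdeal (isHomogeneous_span_of_homogeneous _ _ (by
    rintro x (rfl | rfl | rfl | rfl | rfl | rfl) <;> exact ⟨_, a_mem _ _⟩))

/-- The row `ξ = (g₅₅⁻¹ γ₅₃, g₅₅⁻¹ γ₅₄)` of odd elements of `O(P_{l,q})`. -/
noncomputable def xi : Fin 2 → Parabolic :=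
  ![Ideal.Quotient.mk parabolicIdeal (a55inv * a 4 2),
    Ideal.Quotient.mk parabolicIdeal (a55inv * a 4 3)]

/-- The two-sided ideal of `O(P_{l,q})` generated by the entries of `ξ`. -/
noncomputable abbrev xiIdeal : Ideal Parabolic := (TwoSidedIdeal.span (Set.range xi)).asIdeal

/-- The quotient of `O(P_{l,q})` by `ξ = 0`: the quantum super Poincaré group times dilations. -/
abbrev Poincare : Type := Parabolic ⧸ xiIdeal

/-- The grading of the quantum super Poincaré group times dilations. -/
noncomputable def poincareGrading : ZMod 2 → Submodule Cq Poincare :=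
  quotientGrading parabolicGrading xiIdeal

noncomputable instance : GradedAlgebra poincareGrading :=
  quotientGradedAlgebra parabolicGrading xiIdeal (isHomogeneous_span_of_homogeneous _ _ (by
    rintro _ ⟨i, rfl⟩
    refine ⟨1, ?_⟩
    fin_cases i
    · exact Submodule.mem_map_of_mem (a55inv_mul_mem (a_mem 4 2))
    · exact Submodule.mem_map_of_mem (a55inv_mul_mem (a_mem 4 3))))

/-- The comultiplication and counit of `O(SL_q(4|1))` take their standard values on the matrix of
generators: `Δ(a_ij) = ∑ₖ a_ik ⊗ a_kj` and `ε(a_ij) = δ_ij`. -/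
def IsStandard (H : HopfSuperalgebra slGrading) : Prop :=
  ∀ i j : Fin 5, H.comul (a i j) = ∑ k : Fin 5, a i k ⊗ₜ[Cq] a k j ∧
    H.counit (a i j) = if i = j then 1 else 0

end QuantumSuper

open scoped TensorProduct

namespace QuantumSuper

/-! ### Manin matrices and the RTT relation -/

section ManinMatrices

variable {B : Type*} [Ring B] [Algebra Cq B]

/-! A point of `O(SL_q(4|1))` in an algebra `B` is a `5 × 5` matrix `T` over `B` that satisfies the
Manin relations, has an invertible corner `T 4 4`, an even block with invertible quantum
determinant, and Berezinian 1 (`exists_slLift`). The other two generators are inverses of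
expressions in the `a i j`, so a homomorphism is determined by its matrix
(`eq_top_of_inverse_closed`). This gives uniqueness and reduces the Hopf axioms to the generators.
What has to be proved is that points with supercommuting entries can be multiplied
(comultiplication), that the identity matrix is a point (counit), and that the inverse matrix is a
point of the super-opposite algebra (antipode).

Apart from the vanishing of odd squares, the Manin relations are the RTT relation for a braiding,
and RTT passes formally to products and to inverses. For an odd entry RTT yields only `(q + q⁻¹)
T_ij² = 0`, and `q + q⁻¹` is not invertible in `ℂ[q, q⁻¹]`. The squares are therefore handled by
separate cancellations (`IsManin.mul`, `IsManin.opMatrix`). A square root of `-1` identifies the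
super-opposite algebra with the ordinary opposite one.

The determinants are controlled by a volume element. On a matrix model of the quantum exterior
algebra with variables `ξ₀, …, ξ₃`, and with a further invertible variable `η`, let `y` be the
column `T (ξ, η)`. Then `y₀y₁y₂y₃y₄⁻¹ = Ber(T) ξ₀ξ₁ξ₂ξ₃η⁻¹` up to terms of lower exterior degree
(`IsManin.prod_col_mul`). Comparing top coefficients gives multiplicativity of the Berezinian
(`IsManin.berezinian_mul`), and also the identity that the corner of `T⁻¹` times the determinant of
the even block is `Ber(T)` (`IsManin.inverse_corner_mul_qdet`). The latter reduces invertibility of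
that determinant for a product of points to invertibility of a corner. A corner of a product is a
unit plus quasi-commuting terms of square zero (`IsManin.isUnit_mul_corner`).

For the inverse, the Schur complement of the corner is again a quantum matrix (`IsManin.schur`).
Since `Ber = 1`, its quantum determinant is `a₅₅`, hence a unit, and cofactors invert it
(`IsQuantum.exists_inverse`). This inverts the whole matrix of generators, and the determinants of
the inverse follow from `IsRightQuantum.qdet_op_mul_qdet`.

Both ideals are generated by homogeneous elements, so the Hopf ideal conditions need only be checked
on generators (`HopfSuperalgebra.isHopfIdeal_span`). The point that is not formal is the antipode:
modulo `I_q` the upper right block of the inverse matrix must vanish. There the even block is block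
triangular, its determinant is a product of two commuting `2 × 2` determinants, so the upper left
one is a unit and Cramer's rule applies (`map_genInv_eq_zero`). For `ξ`, invertibility of `g₅₅` does
the rest. -/

theorem qpow_mul (m n : ℤ) : qpow m * qpow n = qpow (m + n) := (LaurentPolynomial.T_add m n).symm

theorem qpow_zero : qpow 0 = 1 := LaurentPolynomial.T_zero

theorem qpow_one_mul_neg_one : qpow 1 * qpow (-1) = 1 := by
  rw [qpow_mul]; exact qpow_zero

/-- The eigenvalues of the braiding on the vectors `e_i ⊗ e_i`. -/
noncomputable def eigenvalue (i : Fin 5) : Cq := if i = 4 then -qpow (-1) else qpow 1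

/-- The matrix `T` satisfies the defining relations of quantum `4|1` matrices. The signs are
simplified by means of the fact that the smaller of two distinct indices is even. -/
structure IsManin (T : Matrix (Fin 5) (Fin 5) B) : Prop where
  sq : ∀ i j, par i j = 1 → T i j * T i j = 0
  row : ∀ i j l, j < l →
    T i l * T i j = ((-1 : Cq) ^ (idx i * idx l) * eigenvalue i) • (T i j * T i l)
  col : ∀ i k j, i < k →
    T k j * T i j = ((-1 : Cq) ^ (idx j * idx k) * eigenvalue j) • (T i j * T k j)
  comm : ∀ i j k l, i < k → j < l →
    T k j * T i l = (-1 : Cq) ^ (idx k * idx l) • (T i l * T k j)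
  cross : ∀ i j k l, i < k → j < l →
    T i j * T k l = T k l * T i j + (qpow (-1) - qpow 1) • (T k j * T i l)

/-- The diagonal coefficients of the braiding. -/
noncomputable def braidDiag (i k : Fin 5) : Cq :=
  if i = k then eigenvalue i else if k < i then qpow 1 - qpow (-1) else 0

/-- The braiding of the quantum superspace of dimension `4|1`. -/
noncomputable def braid (B : Type*) [Ring B] [Algebra Cq B] :
    Matrix (Fin 5 × Fin 5) (Fin 5 × Fin 5) B :=
  fun x y => (if x = y then algebraMap Cq B (braidDiag x.1 x.2) else 0) +
    (if x.swap = y then (if x.1 = x.2 then 0 else 1) else 0)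

theorem braid_mul_apply (M : Matrix (Fin 5 × Fin 5) (Fin 5 × Fin 5) B) (i k : Fin 5)
    (y : Fin 5 × Fin 5) : (braid B * M) (i, k) y =
      braidDiag i k • M (i, k) y + if i = k then 0 else M (k, i) y := by
  simp only [Matrix.mul_apply, braid, add_mul, ite_mul, zero_mul, Finset.sum_add_distrib,
    Finset.sum_ite_eq, Finset.mem_univ, if_true, one_mul, Prod.swap_prod_mk, Algebra.smul_def]

theorem mul_braid_apply (M : Matrix (Fin 5 × Fin 5) (Fin 5 × Fin 5) B) (x : Fin 5 × Fin 5)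
    (j l : Fin 5) : (M * braid B) x (j, l) =
      braidDiag j l • M x (j, l) + if j = l then 0 else M x (l, j) := by
  have h : ∀ z : Fin 5 × Fin 5, z.swap = (j, l) ↔ z = (l, j) := by
    rintro ⟨a, b⟩; simp [Prod.ext_iff, and_comm]
  simp only [Matrix.mul_apply, braid, mul_add, mul_ite, mul_zero, Finset.sum_add_distrib, h,
    Finset.sum_ite_eq', Finset.mem_univ, if_true, mul_one, Algebra.smul_def,
    ← Algebra.commutes (R := Cq) (A := B), eq_comm (a := l) (b := j)]

/-- The matrix `T ⊗ 1`. -/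
def tensorLeft (T : Matrix (Fin 5) (Fin 5) B) : Matrix (Fin 5 × Fin 5) (Fin 5 × Fin 5) B :=
  fun x y => if x.2 = y.2 then T x.1 y.1 else 0

/-- The matrix `1 ⊗ T`, with the signs of the super tensor product. -/
noncomputable def tensorRight (T : Matrix (Fin 5) (Fin 5) B) :
    Matrix (Fin 5 × Fin 5) (Fin 5 × Fin 5) B :=
  fun x y => if x.1 = y.1 then (-1 : Cq) ^ (idx x.1 * par x.2 y.2) • T x.2 y.2 else 0

theorem tensorLeft_mul_apply (T : Matrix (Fin 5) (Fin 5) B)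
    (M : Matrix (Fin 5 × Fin 5) (Fin 5 × Fin 5) B) (i k : Fin 5) (y : Fin 5 × Fin 5) :
    (tensorLeft T * M) (i, k) y = ∑ m, T i m * M (m, k) y := by
  simp only [Matrix.mul_apply, tensorLeft, Fintype.sum_prod_type, ite_mul, zero_mul,
    Finset.sum_ite_eq, Finset.mem_univ, if_true]

theorem tensorRight_mul_apply (T : Matrix (Fin 5) (Fin 5) B)
    (M : Matrix (Fin 5 × Fin 5) (Fin 5 × Fin 5) B) (i k : Fin 5) (y : Fin 5 × Fin 5) :
    (tensorRight T * M) (i, k) y =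
      ∑ m, (-1 : Cq) ^ (idx i * par k m) • (T k m * M (i, m) y) := by
  simp only [Matrix.mul_apply, tensorRight, Fintype.sum_prod_type, ite_mul, zero_mul,
    smul_mul_assoc]
  rw [Finset.sum_comm]
  simp

theorem tensorLeft_mul (S T : Matrix (Fin 5) (Fin 5) B) :
    tensorLeft S * tensorLeft T = tensorLeft (S * T) := by
  ext ⟨i, k⟩ ⟨j, l⟩
  rw [tensorLeft_mul_apply]
  simp only [tensorLeft, Matrix.mul_apply, mul_ite, mul_zero]
  split_ifs <;> simp

theorem idx_cases (i : Fin 5) : idx i = 0 ∨ idx i = 1 := by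
  revert i; decide

/-- Parity is additive along `k → m → l`, so the Koszul sign of a matrix product does not depend on
the summation index. This makes `1 ⊗ T` multiplicative. -/
theorem sign_par_mul (n : ℕ) (k m l : Fin 5) :
    (-1 : Cq) ^ (n * par k m) * (-1 : Cq) ^ (n * par m l) = (-1 : Cq) ^ (n * par k l) := by
  unfold par
  obtain hk | hk := idx_cases k <;> obtain hl | hl := idx_cases l <;>
    obtain hm | hm := idx_cases m <;> simp [hk, hl, hm, ← pow_add, ← two_mul, pow_mul]

theorem tensorRight_mul (S T : Matrix (Fin 5) (Fin 5) B) :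
    tensorRight S * tensorRight T = tensorRight (S * T) := by
  ext ⟨i, k⟩ ⟨j, l⟩
  rw [tensorRight_mul_apply]
  simp only [tensorRight, Matrix.mul_apply, mul_ite, mul_zero]
  split_ifs
  · simp only [mul_smul_comm, smul_smul, sign_par_mul, Finset.smul_sum]
  · simp

theorem tensorLeft_one : tensorLeft (1 : Matrix (Fin 5) (Fin 5) B) = 1 := by
  ext ⟨i, k⟩ ⟨j, l⟩
  simp only [tensorLeft, Matrix.one_apply, Prod.mk.injEq]
  split_ifs <;> simp_all

theorem par_self (i : Fin 5) : par i i = 0 := by revert i; decide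

theorem tensorRight_one : tensorRight (1 : Matrix (Fin 5) (Fin 5) B) = 1 := by
  ext ⟨i, k⟩ ⟨j, l⟩
  simp only [tensorRight, Matrix.one_apply, Prod.mk.injEq]
  split_ifs with h1 h2 <;> simp_all [par_self]

theorem tensorLeft_mul_tensorRight_apply (S T : Matrix (Fin 5) (Fin 5) B) (i k j l : Fin 5) :
    (tensorLeft S * tensorRight T) (i, k) (j, l) =
      (-1 : Cq) ^ (idx j * par k l) • (S i j * T k l) := by
  rw [tensorLeft_mul_apply]
  simp [tensorRight]

theorem tensorRight_mul_tensorLeft_apply (S T : Matrix (Fin 5) (Fin 5) B) (i k j l : Fin 5) :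
    (tensorRight T * tensorLeft S) (i, k) (j, l) =
      (-1 : Cq) ^ (idx i * par k l) • (T k l * S i j) := by
  rw [tensorRight_mul_apply]
  simp [tensorLeft]

/-- The entries of `S` and `T` commute in the super sense. -/
def SuperCommute (S T : Matrix (Fin 5) (Fin 5) B) : Prop :=
  ∀ i j k l, S i j * T k l = (-1 : Cq) ^ (par i j * par k l) • (T k l * S i j)

theorem SuperCommute.tensor {S T : Matrix (Fin 5) (Fin 5) B} (h : SuperCommute S T) :
    tensorLeft S * tensorRight T = tensorRight T * tensorLeft S := by
  ext ⟨i, k⟩ ⟨j, l⟩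
  rw [tensorLeft_mul_tensorRight_apply, tensorRight_mul_tensorLeft_apply, h, smul_smul]
  congr 1
  have := sign_par_mul (par k l) j j i
  rw [par_self] at this
  unfold par
  obtain hk | hk := idx_cases k <;> obtain hl | hl := idx_cases l <;>
    obtain hi | hi := idx_cases i <;> obtain hj | hj := idx_cases j <;> simp [hk, hl, hi, hj]

/-- The RTT relation. -/
def IsRTT (T : Matrix (Fin 5) (Fin 5) B) : Prop :=
  braid B * (tensorLeft T * tensorRight T) = (tensorLeft T * tensorRight T) * braid B

theorem idx_of_lt {i k : Fin 5} (h : i < k) : idx i = 0 ∧ i ≠ 4 := by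
  revert i k; decide

end ManinMatrices

end QuantumSuper


/-! ### Equivalence of the Manin relations with the RTT relation -/

namespace QuantumSuper

section ManinMatrices

variable {B : Type*} [Ring B] [Algebra Cq B]

theorem isRTT_iff {T : Matrix (Fin 5) (Fin 5) B} : IsRTT T ↔ ∀ i k j l,
    braidDiag i k • ((-1 : Cq) ^ (idx j * par k l) • (T i j * T k l)) +
        (if i = k then 0 else (-1 : Cq) ^ (idx j * par i l) • (T k j * T i l)) =
      braidDiag j l • ((-1 : Cq) ^ (idx j * par k l) • (T i j * T k l)) +
        if j = l then 0 else (-1 : Cq) ^ (idx l * par k j) • (T i l * T k j) := by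
  unfold IsRTT
  rw [← Matrix.ext_iff]
  simp only [Prod.forall, braid_mul_apply, mul_braid_apply, tensorLeft_mul_tensorRight_apply]

theorem qpow_neg_mul : qpow (-1) * qpow 1 = 1 := by rw [qpow_mul]; exact qpow_zero

/-- The Hecke relation: both `q` and `-q⁻¹` are roots of `x² - (q - q⁻¹) x - 1`. -/
theorem eigenvalue_mul (i : Fin 5) :
    eigenvalue i * (eigenvalue i - (qpow 1 - qpow (-1))) = 1 := by
  by_cases h : i = 4
  · simp only [eigenvalue, h, if_true]; linear_combination qpow_neg_mul
  · simp only [eigenvalue, h, if_false]; linear_combination qpow_neg_mul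

theorem braidDiag_self (i : Fin 5) : braidDiag i i = eigenvalue i := by simp [braidDiag]

theorem braidDiag_lt {i k : Fin 5} (h : i < k) : braidDiag i k = 0 := by
  simp [braidDiag, h.ne, h.not_gt]

theorem braidDiag_gt {i k : Fin 5} (h : i < k) : braidDiag k i = qpow 1 - qpow (-1) := by
  simp [braidDiag, h, h.ne']

/-- The nine order types of `(i, k)` and `(j, l)` match the entries of RTT with single Manin
relations. Odd squares enter only when `i = k` and `j = l`, where the two eigenvalues differ exactly
for an odd entry. -/
theorem IsManin.isRTT {T : Matrix (Fin 5) (Fin 5) B} (hT : IsManin T) : IsRTT T := by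
  rw [isRTT_iff]
  intro i k j l
  obtain hik | rfl | hik := lt_trichotomy i k <;> obtain hjl | rfl | hjl := lt_trichotomy j l
  · have h := hT.comm i j k l hik hjl
    simp only [braidDiag_lt hik, braidDiag_lt hjl, hik.ne, hjl.ne, if_false, h, par,
      (idx_of_lt hjl).1, (idx_of_lt hik).1]
    obtain hk | hk := idx_cases k <;> obtain hl | hl := idx_cases l <;> simp [hk, hl]
  · have h := hT.col i k j hik
    simp only [braidDiag_lt hik, braidDiag_self, hik.ne, if_false, if_true, h, par,
      (idx_of_lt hik).1]
    obtain hk | hk := idx_cases k <;> obtain hl | hl := idx_cases j <;> simp [hk, hl]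
  · have h := hT.cross i l k j hik hjl
    have h' := hT.comm i l k j hik hjl
    rw [h'] at h
    simp only [braidDiag_lt hik, braidDiag_gt hjl, hik.ne, hjl.ne', if_false, h, par,
      (idx_of_lt hjl).1, (idx_of_lt hik).1]
    obtain hk | hk := idx_cases k <;> obtain hl | hl := idx_cases j <;> simp [hk, hl] <;> module
  · have h := hT.row i j l hjl
    simp only [braidDiag_lt hjl, braidDiag_self, hjl.ne, if_false, if_true, h, par,
      (idx_of_lt hjl).1]
    obtain hk | hk := idx_cases i <;> obtain hl | hl := idx_cases l <;> simp [hk, hl]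
  · by_cases h : par i j = 1
    · simp [hT.sq i j h]
    · have : eigenvalue i = eigenvalue j := by
        revert i j; simp only [eigenvalue]; intro i j h
        have : (i = 4) ↔ (j = 4) := by revert i j; decide
        simp [this]
      simp [braidDiag_self, this]
  · have h := hT.row i l j hjl
    have e := eigenvalue_mul i
    simp only [braidDiag_gt hjl, braidDiag_self, hjl.ne', if_false, if_true, h, par,
      (idx_of_lt hjl).1]
    obtain hk | hk := idx_cases i <;> obtain hl | hl := idx_cases j <;> simp [hk, hl] <;>
    match_scalars <;> linear_combination e
  · have h := hT.cross k j i l hik hjl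
    have h' := hT.comm k j i l hik hjl
    rw [h'] at h
    simp only [braidDiag_lt hjl, braidDiag_gt hik, hjl.ne, hik.ne', if_false, h', h, par,
      (idx_of_lt hjl).1, (idx_of_lt hik).1]
    obtain hk | hk := idx_cases i <;> obtain hl | hl := idx_cases l <;> simp [hk, hl] <;> module
  · have h := hT.col k i j hik
    have e := eigenvalue_mul j
    simp only [braidDiag_gt hik, braidDiag_self, hik.ne', if_false, if_true, h, par,
      (idx_of_lt hik).1]
    obtain hk | hk := idx_cases i <;> obtain hl | hl := idx_cases j <;> simp [hk, hl] <;>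
    match_scalars <;> first | linear_combination e | linear_combination -e
  · have h' := hT.comm k l i j hik hjl
    simp only [braidDiag_gt hjl, braidDiag_gt hik, hjl.ne', hik.ne', if_false, h', par,
      (idx_of_lt hjl).1, (idx_of_lt hik).1]
    obtain hk | hk := idx_cases i <;> obtain hl | hl := idx_cases j <;> simp [hk, hl]

theorem IsRTT.comm {T : Matrix (Fin 5) (Fin 5) B} (hT : IsRTT T) (i j k l : Fin 5) (hik : i < k)
    (hjl : j < l) : T k j * T i l = (-1 : Cq) ^ (idx k * idx l) • (T i l * T k j) := by
  have h := isRTT_iff.1 hT i k j l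
  simp only [braidDiag_lt hik, braidDiag_lt hjl, hik.ne, hjl.ne, if_false, par,
    (idx_of_lt hjl).1, (idx_of_lt hik).1] at h
  obtain hk | hk := idx_cases k <;> obtain hl | hl := idx_cases l <;> simpa [hk, hl] using h

theorem IsRTT.row {T : Matrix (Fin 5) (Fin 5) B} (hT : IsRTT T) (i j l : Fin 5) (hjl : j < l) :
    T i l * T i j = ((-1 : Cq) ^ (idx i * idx l) * eigenvalue i) • (T i j * T i l) := by
  have h := isRTT_iff.1 hT i i j l
  simp only [braidDiag_lt hjl, braidDiag_self, hjl.ne, if_false, if_true, par,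
    (idx_of_lt hjl).1] at h
  obtain hk | hk := idx_cases i <;> obtain hl | hl := idx_cases l <;> simp [hk, hl] at h ⊢ <;>
    simp [h]

theorem IsRTT.col {T : Matrix (Fin 5) (Fin 5) B} (hT : IsRTT T) (i k j : Fin 5) (hik : i < k) :
    T k j * T i j = ((-1 : Cq) ^ (idx j * idx k) * eigenvalue j) • (T i j * T k j) := by
  have h := isRTT_iff.1 hT i k j j
  simp only [braidDiag_lt hik, braidDiag_self, hik.ne, if_false, if_true, par,
    (idx_of_lt hik).1] at h
  obtain hk | hk := idx_cases k <;> obtain hl | hl := idx_cases j <;> simp [hk, hl] at h ⊢ <;>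
    simp [← h]

/-- The squares have to be supplied: RTT gives `(q + q⁻¹) T i j ^ 2 = 0` for an odd entry, and `q +
q⁻¹` cannot be cancelled. -/
theorem IsRTT.isManin {T : Matrix (Fin 5) (Fin 5) B} (hT : IsRTT T)
    (sq : ∀ i j, par i j = 1 → T i j * T i j = 0) : IsManin T := by
  refine ⟨sq, hT.row, hT.col, hT.comm, ?_⟩
  intro i j k l hik hjl
  have h := isRTT_iff.1 hT k i j l
  simp only [braidDiag_lt hjl, braidDiag_gt hik, hjl.ne, hik.ne', if_false, par,
    (idx_of_lt hjl).1, (idx_of_lt hik).1] at h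
  obtain hk | hk := idx_cases k <;> obtain hl | hl := idx_cases l <;> simp [hk, hl] at h ⊢ <;>
    rw [← h] <;> module

end ManinMatrices

end QuantumSuper


/-! ### Products of supercommuting Manin matrices -/

namespace QuantumSuper

/-- This is how squares of linear combinations are shown to vanish, without dividing by 2 or by `q +
q⁻¹`. -/
theorem sum_sum_eq_zero_of_pairs {ι M : Type*} [Fintype ι] [LinearOrder ι] [AddCommGroup M]
    (F : ι → ι → M) (h0 : ∀ i, F i i = 0) (h : ∀ i j, i < j → F i j + F j i = 0) :
    ∑ i, ∑ j, F i j = 0 := by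
  classical
  rw [← Finset.sum_product', Finset.univ_product_univ]
  refine Finset.sum_involution (fun x _ => x.swap) ?_ ?_ (fun _ _ => Finset.mem_univ _)
    (fun x _ => x.swap_swap)
  · rintro ⟨i, j⟩ -
    obtain hij | rfl | hij := lt_trichotomy i j
    · exact h i j hij
    · simp [h0]
    · rw [add_comm]; exact h j i hij
  · rintro ⟨i, j⟩ - hne heq
    simp only [Prod.swap_prod_mk, Prod.mk.injEq] at heq
    rw [heq.1, h0] at hne
    exact hne rfl

section ManinMatrices

variable {B : Type*} [Ring B] [Algebra Cq B]

theorem eigenvalue_mul_of_par {i j : Fin 5} (h : par i j = 1) :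
    eigenvalue i * eigenvalue j = -1 := by
  have : i = 4 ∧ j ≠ 4 ∨ i ≠ 4 ∧ j = 4 := by revert i j; decide
  obtain ⟨h1, h2⟩ | ⟨h1, h2⟩ := this <;> simp only [eigenvalue, h1, h2, if_true, if_false]
  · linear_combination -qpow_neg_mul
  · linear_combination -qpow_neg_mul

theorem IsManin.mul {S T : Matrix (Fin 5) (Fin 5) B} (hS : IsManin S) (hT : IsManin T)
    (h : SuperCommute T S) : IsManin (S * T) := by
  refine IsRTT.isManin ?_ ?_
  · unfold IsRTT
    -- Supercommutation exchanges `T ⊗ 1` with `1 ⊗ S`, so the tensor square of `S T` is the product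
    -- of the two tensor squares, past each of which the braiding moves.
    rw [← tensorLeft_mul, ← tensorRight_mul,
      show tensorLeft S * tensorLeft T * (tensorRight S * tensorRight T) =
        (tensorLeft S * tensorRight S) * (tensorLeft T * tensorRight T) by
        rw [mul_assoc, ← mul_assoc (tensorLeft T), h.tensor]; noncomm_ring,
      ← mul_assoc, hS.isRTT, mul_assoc, hT.isRTT]
    simp only [mul_assoc]
  · intro i j hij
    simp only [Matrix.mul_apply, Finset.sum_mul, Finset.mul_sum]
    have e : ∀ k l, S i l * T l j * (S i k * T k j) =
        (-1 : Cq) ^ (par l j * par i k) • (S i l * S i k * (T l j * T k j)) := by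
      intro k l
      rw [mul_assoc, ← mul_assoc (T l j), h]
      simp only [smul_mul_assoc, mul_smul_comm, mul_assoc]
    refine sum_sum_eq_zero_of_pairs _ (fun k => ?_) (fun k l hkl => ?_)
    · rw [e]
      have : par i k = 1 ∨ par k j = 1 := by clear e; revert i j k; decide
      obtain h1 | h1 := this
      · rw [hS.sq i k h1, zero_mul, smul_zero]
      · rw [hT.sq k j h1, mul_zero, smul_zero]
    -- The row relation of `S` contributes the eigenvalue of `i` and the column relation of `T` that
    -- of `j`. For an odd entry their product is `-1`, so the terms for `(k, l)` and `(l, k)`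
    -- cancel.
    · rw [e, e, hS.row i k l hkl, hT.col k l j hkl]
      have h2 := eigenvalue_mul_of_par hij
      simp only [smul_mul_assoc, mul_smul_comm, smul_smul, ← add_smul]
      convert zero_smul Cq _
      unfold par at hij ⊢
      simp only [(idx_of_lt hkl).1]
      obtain hi | hi := idx_cases i <;> obtain hj | hj := idx_cases j <;>
        obtain hl | hl := idx_cases l <;> simp [hi, hj, hl] at hij ⊢ <;>
        first | linear_combination h2 | linear_combination -h2

end ManinMatrices

end QuantumSuper


/-! ### The inverse of a Manin matrix over the opposite algebra -/

namespace QuantumSuper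

section ManinMatrices

variable {B : Type*} [Ring B] [Algebra Cq B]

/-- A square root of `-1`. -/
noncomputable def sqrtNegOne : Cq := algebraMap ℂ Cq Complex.I

theorem sqrtNegOne_mul : sqrtNegOne * sqrtNegOne = -1 := by
  unfold sqrtNegOne
  rw [← map_mul, Complex.I_mul_I, map_neg, map_one]

/-- The matrix `R`, with odd entries rescaled by a square root of `-1`, over the opposite
algebra. As the super-opposite algebra is isomorphic to the opposite one by means of such a
rescaling, this is `R` as a matrix over the super-opposite algebra. -/
noncomputable def opMatrix (R : Matrix (Fin 5) (Fin 5) B) : Matrix (Fin 5) (Fin 5) Bᵐᵒᵖ :=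
  fun i j => MulOpposite.op (sqrtNegOne ^ par i j • R i j)

theorem sum_univ_castSucc {M : Type*} [AddCommMonoid M] (f : Fin 5 → M) :
    ∑ k, f k = ∑ k : Fin 4, f k.castSucc + f 4 := Fin.sum_univ_castSucc f

/-- The power of `sqrtNegOne` depends only on the total parity of the four indices. It is unchanged
when `i, k` or `j, l` are exchanged, so it factors out of RTT, leaving the sign of `(1 ⊗ R)(R ⊗ 1)`.
-/
theorem sign_opMatrix (i k j l : Fin 5) :
    (-1 : Cq) ^ (idx j * par k l) * (sqrtNegOne ^ par k l * sqrtNegOne ^ par i j) =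
      sqrtNegOne ^ ((idx i + idx k + idx j + idx l) % 2) * (-1 : Cq) ^ (idx i * par k l) := by
  have h := sqrtNegOne_mul
  unfold par
  obtain hi | hi := idx_cases i <;> obtain hk | hk := idx_cases k <;>
    obtain hj | hj := idx_cases j <;> obtain hl | hl := idx_cases l <;> simp [hi, hk, hj, hl, h]

theorem IsRTT.opMatrix {T R : Matrix (Fin 5) (Fin 5) B} (hT : IsRTT T) (h1 : T * R = 1)
    (h2 : R * T = 1) : IsRTT (opMatrix R) := by
  have e1 : tensorLeft T * tensorRight T * (tensorRight R * tensorLeft R) = 1 := by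
    rw [mul_assoc, ← mul_assoc (tensorRight T), tensorRight_mul, h1, tensorRight_one, one_mul,
      tensorLeft_mul, h1, tensorLeft_one]
  have e2 : tensorRight R * tensorLeft R * (tensorLeft T * tensorRight T) = 1 := by
    rw [mul_assoc, ← mul_assoc (tensorLeft R), tensorLeft_mul, h2, tensorLeft_one, one_mul,
      tensorRight_mul, h2, tensorRight_one]
  -- `(1 ⊗ R)(R ⊗ 1)` is the inverse of `(T ⊗ 1)(1 ⊗ T)`, hence it also commutes with the braiding.
  have key : braid B * (tensorRight R * tensorLeft R) =
      (tensorRight R * tensorLeft R) * braid B := by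
    calc _ = (tensorRight R * tensorLeft R * (tensorLeft T * tensorRight T)) *
          braid B * (tensorRight R * tensorLeft R) := by rw [e2, one_mul]
      _ = (tensorRight R * tensorLeft R) * (braid B * (tensorLeft T * tensorRight T)) *
          (tensorRight R * tensorLeft R) := by rw [hT]; simp only [mul_assoc]
      _ = _ := by rw [mul_assoc, mul_assoc (braid B), e1, mul_one]
  rw [isRTT_iff]
  intro i k j l
  have e : ∀ i k j l, (-1 : Cq) ^ (idx j * par k l) •
      (QuantumSuper.opMatrix R i j * QuantumSuper.opMatrix R k l) =
      sqrtNegOne ^ ((idx i + idx k + idx j + idx l) % 2) •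
        MulOpposite.op ((tensorRight R * tensorLeft R) (i, k) (j, l)) := by
    intro i k j l
    rw [tensorRight_mul_tensorLeft_apply]
    simp only [QuantumSuper.opMatrix, ← MulOpposite.op_mul, ← MulOpposite.op_smul,
      smul_mul_assoc, mul_smul_comm, smul_smul]
    rw [← sign_opMatrix, mul_comm (sqrtNegOne ^ par i j)]
  rw [e, e, e, show idx k + idx i + idx j + idx l = idx i + idx k + idx j + idx l by ring,
    show idx i + idx k + idx l + idx j = idx i + idx k + idx j + idx l by ring]
  have h := congrArg MulOpposite.op (congrFun (congrFun key (i, k)) (j, l))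
  rw [braid_mul_apply, mul_braid_apply] at h
  have h' := congrArg (sqrtNegOne ^ ((idx i + idx k + idx j + idx l) % 2) • ·) h
  simp only [MulOpposite.op_add, smul_add, MulOpposite.op_smul, apply_ite MulOpposite.op,
    smul_ite, MulOpposite.op_zero, smul_zero] at h'
  rw [smul_comm (braidDiag i k), smul_comm (braidDiag j l)]
  exact h'

theorem sqrtNegOne_pow_cancel (n : ℕ) {x y : B}
    (h : sqrtNegOne ^ n • x = sqrtNegOne ^ n • y) : x = y := by
  have h' := congrArg ((-sqrtNegOne) ^ n • ·) h
  simpa only [smul_smul, ← mul_pow, neg_mul, sqrtNegOne_mul, neg_neg, one_pow, one_smul] using h'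

theorem opMatrix_row {R : Matrix (Fin 5) (Fin 5) B} (h : IsRTT (opMatrix R)) (i j l : Fin 5)
    (hjl : j < l) :
    R i j * R i l = ((-1 : Cq) ^ (idx i * idx l) * eigenvalue i) • (R i l * R i j) := by
  have := congrArg MulOpposite.unop (h.row i j l hjl)
  simp only [opMatrix, MulOpposite.unop_mul, MulOpposite.unop_op, MulOpposite.unop_smul] at this
  simp only [smul_mul_assoc, mul_smul_comm, smul_smul (sqrtNegOne ^ _), ← pow_add] at this
  rw [add_comm (par i l), smul_comm] at this
  exact sqrtNegOne_pow_cancel _ this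

theorem opMatrix_col {R : Matrix (Fin 5) (Fin 5) B} (h : IsRTT (opMatrix R)) (i k j : Fin 5)
    (hik : i < k) :
    R i j * R k j = ((-1 : Cq) ^ (idx j * idx k) * eigenvalue j) • (R k j * R i j) := by
  have := congrArg MulOpposite.unop (h.col i k j hik)
  simp only [opMatrix, MulOpposite.unop_mul, MulOpposite.unop_op, MulOpposite.unop_smul] at this
  simp only [smul_mul_assoc, mul_smul_comm, smul_smul (sqrtNegOne ^ _), ← pow_add] at this
  rw [add_comm (par k j), smul_comm] at this
  exact sqrtNegOne_pow_cancel _ this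

theorem idx_castSucc (i : Fin 4) : idx i.castSucc = 0 := by revert i; decide

theorem eigenvalue_castSucc (i : Fin 4) : eigenvalue i.castSucc = qpow 1 := by
  have : i.castSucc ≠ 4 := by revert i; decide
  simp [eigenvalue, this]

theorem idx_four : idx 4 = 1 := rfl

theorem eigenvalue_four : eigenvalue 4 = -qpow (-1) := by simp [eigenvalue]

theorem castSucc_lt_four (i : Fin 4) : i.castSucc < 4 := by revert i; decide

theorem par_castSucc (i j : Fin 4) : par i.castSucc j.castSucc = 0 := by revert i j; decide

theorem par_castSucc_four (i : Fin 4) : par i.castSucc 4 = 1 := by revert i; decide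

theorem par_four_castSucc (i : Fin 4) : par 4 i.castSucc = 1 := by revert i; decide

theorem par_four_four : par 4 4 = 0 := rfl

/-- The equation `R T = 1` expresses `R_i4 T_44` through the even entries of row `i`. Substituting
twice turns `R_i4² T_44²` into a double sum of `R_ik R_il T_l4 T_k4`. It vanishes in pairs, as the
factor `q` from the row of `R` meets `-q⁻¹` from the column of `T`, and the unit `T_44` is
cancelled. -/
theorem IsManin.sq_right_inverse {T R : Matrix (Fin 5) (Fin 5) B} (hT : IsManin T)
    (hR : IsRTT (QuantumSuper.opMatrix R)) (h2 : R * T = 1) (hd : IsUnit (T 4 4)) (i : Fin 4) :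
    R i.castSucc 4 * R i.castSucc 4 = 0 := by
  have h0 : R i.castSucc 4 * T 4 4 = -∑ k : Fin 4, R i.castSucc k.castSucc * T k.castSucc 4 := by
    have := congrFun (congrFun h2 i.castSucc) 4
    rw [Matrix.mul_apply, sum_univ_castSucc, Matrix.one_apply_ne (castSucc_lt_four i).ne] at this
    rw [eq_neg_iff_add_eq_zero, add_comm, this]
  have hb : ∀ k : Fin 4, T 4 4 * T k.castSucc 4 = qpow (-1) • (T k.castSucc 4 * T 4 4) := by
    intro k
    rw [hT.col _ _ _ (castSucc_lt_four k), eigenvalue_four, idx_four]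
    simp
  have hr : ∀ k : Fin 4, R i.castSucc k.castSucc * R i.castSucc 4 =
      qpow 1 • (R i.castSucc 4 * R i.castSucc k.castSucc) := by
    intro k
    rw [opMatrix_row hR _ _ _ (castSucc_lt_four k), eigenvalue_castSucc, idx_castSucc]
    simp
  have h1 : R i.castSucc 4 * R i.castSucc 4 * (T 4 4 * T 4 4) = ∑ k : Fin 4, ∑ l : Fin 4,
      R i.castSucc k.castSucc * R i.castSucc l.castSucc * (T l.castSucc 4 * T k.castSucc 4) := by
    calc _ = R i.castSucc 4 * (R i.castSucc 4 * T 4 4) * T 4 4 := by simp only [mul_assoc]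
      _ = -∑ k : Fin 4, R i.castSucc k.castSucc * (R i.castSucc 4 * T 4 4) * T k.castSucc 4 := by
        rw [h0, mul_neg, neg_mul, Finset.mul_sum, Finset.sum_mul, ← h0]
        congr 1
        refine Finset.sum_congr rfl fun k _ => ?_
        rw [← mul_assoc (R i.castSucc k.castSucc), hr, mul_assoc _ (T 4 4), hb]
        simp only [smul_mul_assoc, mul_smul_comm, smul_smul, qpow_neg_mul, one_smul, mul_assoc]
      _ = _ := by
        rw [h0, ← Finset.sum_neg_distrib]
        refine Finset.sum_congr rfl fun k _ => ?_
        rw [mul_neg, neg_mul, neg_neg, Finset.mul_sum, Finset.sum_mul]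
        simp only [mul_assoc]
  rw [sum_sum_eq_zero_of_pairs] at h1
  · exact (hd.mul hd).mul_left_eq_zero.1 h1
  · intro k
    rw [hT.sq _ _ (par_castSucc_four k), mul_zero]
  · intro k l hkl
    rw [opMatrix_row hR _ k.castSucc l.castSucc hkl, hT.col k.castSucc l.castSucc 4 hkl,
      eigenvalue_four, eigenvalue_castSucc, idx_castSucc]
    simp only [smul_mul_assoc, mul_smul_comm, smul_smul, idx_castSucc, mul_zero, pow_zero, one_mul,
      mul_neg, qpow_neg_mul, neg_smul, one_smul, neg_add_cancel]

/-- The mirror image of `IsManin.sq_right_inverse`: `T R = 1` is used, with the last row of `T` and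
a column of `R`. -/
theorem IsManin.sq_left_inverse {T R : Matrix (Fin 5) (Fin 5) B} (hT : IsManin T)
    (hR : IsRTT (QuantumSuper.opMatrix R)) (h1 : T * R = 1) (hd : IsUnit (T 4 4)) (j : Fin 4) :
    R 4 j.castSucc * R 4 j.castSucc = 0 := by
  have h0 : T 4 4 * R 4 j.castSucc = -∑ k : Fin 4, T 4 k.castSucc * R k.castSucc j.castSucc := by
    have := congrFun (congrFun h1 4) j.castSucc
    rw [Matrix.mul_apply, sum_univ_castSucc, Matrix.one_apply_ne (castSucc_lt_four j).ne'] at this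
    rw [eq_neg_iff_add_eq_zero, add_comm, this]
  have hb : ∀ k : Fin 4, T 4 4 * T 4 k.castSucc = qpow (-1) • (T 4 k.castSucc * T 4 4) := by
    intro k
    rw [hT.row _ _ _ (castSucc_lt_four k), eigenvalue_four, idx_four]
    simp
  have hr : ∀ k : Fin 4, R k.castSucc j.castSucc * R 4 j.castSucc =
      qpow 1 • (R 4 j.castSucc * R k.castSucc j.castSucc) := by
    intro k
    rw [opMatrix_col hR _ _ _ (castSucc_lt_four k), eigenvalue_castSucc, idx_castSucc]
    simp
  have h1 : T 4 4 * T 4 4 * (R 4 j.castSucc * R 4 j.castSucc) = ∑ k : Fin 4, ∑ l : Fin 4,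
      T 4 k.castSucc * T 4 l.castSucc * (R l.castSucc j.castSucc * R k.castSucc j.castSucc) := by
    calc _ = T 4 4 * (T 4 4 * R 4 j.castSucc) * R 4 j.castSucc := by simp only [mul_assoc]
      _ = -∑ k : Fin 4, T 4 k.castSucc * (T 4 4 * R 4 j.castSucc) * R k.castSucc j.castSucc := by
        rw [h0, mul_neg, neg_mul, Finset.mul_sum, Finset.sum_mul, ← h0]
        congr 1
        refine Finset.sum_congr rfl fun k _ => ?_
        rw [mul_assoc, mul_assoc, hr, ← mul_assoc, hb]
        simp only [smul_mul_assoc, mul_smul_comm, smul_smul, qpow_one_mul_neg_one, one_smul,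
          mul_assoc]
      _ = _ := by
        rw [h0, ← Finset.sum_neg_distrib]
        refine Finset.sum_congr rfl fun k _ => ?_
        rw [mul_neg, neg_mul, neg_neg, Finset.mul_sum, Finset.sum_mul]
        simp only [mul_assoc]
  rw [sum_sum_eq_zero_of_pairs] at h1
  · exact (hd.mul hd).mul_right_eq_zero.1 h1
  · intro k
    rw [hT.sq _ _ (par_four_castSucc k), zero_mul]
  · intro k l hkl
    rw [opMatrix_col hR k.castSucc l.castSucc _ hkl, hT.row 4 k.castSucc l.castSucc hkl,
      eigenvalue_four, eigenvalue_castSucc, idx_castSucc]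
    simp only [smul_mul_assoc, mul_smul_comm, smul_smul, idx_castSucc, mul_zero, pow_zero,
      one_mul, neg_mul, mul_neg, smul_neg, qpow_one_mul_neg_one, neg_smul, one_smul, add_neg_cancel]

theorem IsManin.opMatrix {T R : Matrix (Fin 5) (Fin 5) B} (hT : IsManin T) (h1 : T * R = 1)
    (h2 : R * T = 1) (hd : IsUnit (T 4 4)) : IsManin (opMatrix R) := by
  have hR := hT.isRTT.opMatrix h1 h2
  refine hR.isManin fun i j hij => ?_
  have : (∃ k : Fin 4, i = k.castSucc ∧ j = 4) ∨ ∃ k : Fin 4, i = 4 ∧ j = k.castSucc := by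
    revert i j; decide
  have h : R i j * R i j = 0 := by
    obtain ⟨k, rfl, rfl⟩ | ⟨k, rfl, rfl⟩ := this
    · exact hT.sq_right_inverse hR h2 hd k
    · exact hT.sq_left_inverse hR h1 hd k
  simp only [QuantumSuper.opMatrix, ← MulOpposite.op_mul, smul_mul_assoc, mul_smul_comm, h,
    smul_zero, MulOpposite.op_zero]

end ManinMatrices

end QuantumSuper


namespace QuantumSuper

/-! ### Quantum exterior algebras and quantum determinants -/

section Exterior

variable {B : Type*} [Ring B] [Algebra Cq B]

/-- The elements `x i` satisfy the relations of the quantum exterior algebra. -/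
structure IsExterior {n : ℕ} (x : Fin n → B) : Prop where
  sq : ∀ i, x i * x i = 0
  anti : ∀ i j, i < j → x j * x i = (-qpow (-1)) • (x i * x j)

/-- The number of inversions of a word. -/
def wordInv {n : ℕ} : List (Fin n) → ℕ
  | [] => 0
  | a :: l => l.countP (· < a) + wordInv l

/-- The coefficient of a word in the quantum determinant. -/
noncomputable def wordCoef {n : ℕ} (l : List (Fin n)) : Cq :=
  if l.Nodup then (-qpow (-1)) ^ wordInv l else 0

/-- One step of insertion sort: passing a smaller letter costs `-q⁻¹`, and meeting an equal letter
gives zero. -/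
theorem IsExterior.mul_prod {n : ℕ} {x : Fin n → B} (hx : IsExterior x) (j : Fin n)
    (l : List (Fin n)) (hl : l.Pairwise (· ≤ ·)) : x j * (l.map x).prod =
      (if j ∈ l then 0 else (-qpow (-1)) ^ l.countP (· < j)) •
        ((l.orderedInsert (· ≤ ·) j).map x).prod := by
  induction l with
  | nil => simp
  | cons i l ih =>
    have ih := ih hl.of_cons
    rw [List.pairwise_cons] at hl
    obtain h | rfl | h := lt_trichotomy j i
    · have h1 : ∀ b ∈ l, j < b := fun b hb => h.trans_le (hl.1 b hb)
      have h2 : j ∉ i :: l := by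
        simp only [List.mem_cons, not_or]
        exact ⟨h.ne, fun hj => (h1 j hj).false⟩
      have h3 : (i :: l).countP (· < j) = 0 := by
        rw [List.countP_eq_zero]
        simp only [List.mem_cons, decide_eq_true_eq, not_lt]
        rintro b (rfl | hb)
        · exact h.le
        · exact (h1 b hb).le
      rw [if_neg h2, h3, pow_zero, one_smul, List.orderedInsert, if_pos h.le, List.map_cons (a := j),
        List.prod_cons]
    · simp [← mul_assoc, hx.sq]
    · rw [List.map_cons, List.prod_cons, ← mul_assoc, hx.anti i j h, smul_mul_assoc, mul_assoc, ih,
        List.orderedInsert, if_neg h.not_ge, List.map_cons, List.prod_cons, mul_smul_comm,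
        smul_smul, List.countP_cons_of_pos (by simpa using h), pow_succ']
      simp only [List.mem_cons, h.ne', false_or]
      split_ifs <;> simp

theorem IsExterior.word {n : ℕ} {x : Fin n → B} (hx : IsExterior x) (l : List (Fin n)) :
    (l.map x).prod = wordCoef l • ((l.insertionSort (· ≤ ·)).map x).prod := by
  induction l with
  | nil => simp [wordCoef, wordInv]
  | cons a l ih =>
    rw [List.map_cons, List.prod_cons, ih, mul_smul_comm,
      hx.mul_prod a _ (List.pairwise_insertionSort _ _), smul_smul, List.insertionSort_cons]
    congr 1
    unfold wordCoef
    simp only [List.nodup_cons, (List.perm_insertionSort _ l).mem_iff,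
      (List.perm_insertionSort _ l).countP_eq, wordInv, pow_add]
    split_ifs <;> simp_all [mul_comm]

theorem insertionSort_of_nodup : ∀ a b c d : Fin 4, [a, b, c, d].Nodup →
    [a, b, c, d].insertionSort (· ≤ ·) = [0, 1, 2, 3] := by decide

theorem IsExterior.word_four {x : Fin 4 → B} (hx : IsExterior x) (a b c d : Fin 4) :
    x a * x b * x c * x d = wordCoef [a, b, c, d] • (x 0 * x 1 * x 2 * x 3) := by
  have h := hx.word [a, b, c, d]
  by_cases hn : [a, b, c, d].Nodup
  · rw [insertionSort_of_nodup a b c d hn] at h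
    simpa [mul_assoc] using h
  · rw [wordCoef, if_neg hn, zero_smul] at h ⊢
    simpa [mul_assoc] using h

theorem wordInv_perm : ∀ σ : Equiv.Perm (Fin 4), wordInv [σ 0, σ 1, σ 2, σ 3] = permLength σ := by
  decide

theorem neg_one_pow_mul_qpow (n : ℕ) : (-1 : Cq) ^ n * qpow (-(n : ℤ)) = (-qpow (-1)) ^ n := by
  rw [neg_pow (qpow (-1)), qpow, qpow, LaurentPolynomial.T_pow]
  simp

/-- Words with a repeated letter have coefficient zero, so the sum may run over all words. This is
the form in which a product of four linear forms expands. -/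
theorem qdet_eq_sum (M : Matrix (Fin 4) (Fin 4) B) : qdet M = ∑ a, ∑ b, ∑ c, ∑ d,
    wordCoef [a, b, c, d] • (M 0 a * M 1 b * M 2 c * M 3 d) := by
  have hinj : ∀ a b c d : Fin 4, [a, b, c, d].Nodup → Function.Injective ![a, b, c, d] := by
    intro a b c d h
    simp only [List.nodup_cons, List.mem_cons, List.not_mem_nil, or_false, not_or] at h
    intro i j hij
    fin_cases i <;> fin_cases j <;> simp_all
  have e : ∑ a, ∑ b, ∑ c, ∑ d, wordCoef [a, b, c, d] • (M 0 a * M 1 b * M 2 c * M 3 d) =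
      ∑ x : (Fin 4 × Fin 4) × (Fin 4 × Fin 4), wordCoef [x.1.1, x.1.2, x.2.1, x.2.2] •
        (M 0 x.1.1 * M 1 x.1.2 * M 2 x.2.1 * M 3 x.2.2) := by
    simp only [Fintype.sum_prod_type]
  rw [e]
  unfold qdet
  refine Finset.sum_of_injOn (fun σ => ((σ 0, σ 1), (σ 2, σ 3))) ?_ (fun _ _ => Finset.mem_univ _)
    ?_ ?_
  · intro σ _ τ _ h
    simp only [Prod.mk.injEq] at h
    ext i
    fin_cases i <;> simp [h]
  · rintro ⟨⟨a, b⟩, c, d⟩ - h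
    by_cases hn : [a, b, c, d].Nodup
    · refine absurd ⟨Equiv.ofBijective ![a, b, c, d]
        (Finite.injective_iff_bijective.1 (hinj a b c d hn)), Finset.mem_coe.2 (Finset.mem_univ _), ?_⟩ h
      simp
    · simp [wordCoef, hn]
  · intro σ _
    have hn : [σ 0, σ 1, σ 2, σ 3].Nodup := by
      simp [σ.injective.eq_iff]
    rw [wordCoef, if_pos hn, wordInv_perm, neg_one_pow_mul_qpow]
    simp [mul_assoc]

theorem sum_mul_sum_four {ι : Type*} [Fintype ι] (f g h k : ι → B) :
    (∑ a, f a) * (∑ b, g b) * (∑ c, h c) * (∑ d, k d) =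
      ∑ a, ∑ b, ∑ c, ∑ d, f a * g b * h c * k d := by
  rw [Finset.sum_mul_sum]
  simp only [Finset.sum_mul]
  refine Finset.sum_congr rfl fun a _ => Finset.sum_congr rfl fun b _ => ?_
  rw [mul_assoc, Finset.sum_mul_sum]
  simp only [Finset.mul_sum, mul_assoc]

theorem unop_sum {ι M : Type*} [AddCommMonoid M] (s : Finset ι) (f : ι → Mᵐᵒᵖ) :
    (∑ i ∈ s, f i).unop = ∑ i ∈ s, (f i).unop :=
  map_sum (MulOpposite.opAddEquiv (α := M)).symm f s

/-- The product of four linear combinations of exterior variables. -/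
theorem IsExterior.prod_linear {x : Fin 4 → B} (hx : IsExterior x) {M : Matrix (Fin 4) (Fin 4) B}
    (hc : ∀ i j k, x k * M i j = M i j * x k) :
    (∑ j, M 0 j * x j) * (∑ j, M 1 j * x j) * (∑ j, M 2 j * x j) * (∑ j, M 3 j * x j) =
      qdet M * (x 0 * x 1 * x 2 * x 3) := by
  rw [qdet_eq_sum, sum_mul_sum_four]
  simp only [Finset.sum_mul]
  refine Finset.sum_congr rfl fun a _ => Finset.sum_congr rfl fun b _ =>
    Finset.sum_congr rfl fun c _ => Finset.sum_congr rfl fun d _ => ?_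
  rw [smul_mul_assoc, ← mul_smul_comm, ← hx.word_four a b c d]
  have h1 : ∀ i j k z, x k * (M i j * z) = M i j * (x k * z) := fun i j k z => by
    rw [← mul_assoc, hc, mul_assoc]
  simp only [mul_assoc, h1]

/-- If `x = Y y`, then the product of the `x i` is the product of the `y i` times the quantum
determinant of `Y` with the products taken in the opposite order. -/
theorem IsExterior.prod_linear_op {x y : Fin 4 → B} (hy : IsExterior y)
    {Y : Matrix (Fin 4) (Fin 4) B} (hc : ∀ i j k, x k * Y i j = Y i j * x k)
    (hxy : ∀ i, x i = ∑ j, Y i j * y j) :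
    x 0 * x 1 * x 2 * x 3 =
      (qdet (Y.map MulOpposite.op)).unop * (y 0 * y 1 * y 2 * y 3) := by
  have h1 : ∀ i j k z, x k * (Y i j * z) = Y i j * (x k * z) := fun i j k z => by
    rw [← mul_assoc, hc, mul_assoc]
  -- The coefficients are assumed to commute with `x` but not with `y`. Therefore the last factor is
  -- replaced first and its coefficient is moved left past the remaining `x i`, which stacks the
  -- coefficients in reversed order.
  have e : x 0 * x 1 * x 2 * x 3 = ∑ a, ∑ b, ∑ c, ∑ d,
      Y 3 d * Y 2 c * Y 1 b * Y 0 a * (y a * y b * y c * y d) := by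
    calc x 0 * x 1 * x 2 * x 3 = ∑ d, Y 3 d * (x 0 * x 1 * x 2 * y d) := by
          rw [hxy 3, Finset.mul_sum]
          simp only [mul_assoc, h1]
      _ = ∑ d, ∑ c, Y 3 d * Y 2 c * (x 0 * x 1 * y c * y d) := by
          refine Finset.sum_congr rfl fun d _ => ?_
          rw [hxy 2]
          simp only [Finset.mul_sum, Finset.sum_mul]
          simp only [mul_assoc, h1]
      _ = ∑ d, ∑ c, ∑ b, Y 3 d * Y 2 c * Y 1 b * (x 0 * y b * y c * y d) := by
          refine Finset.sum_congr rfl fun d _ => Finset.sum_congr rfl fun c _ => ?_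
          rw [hxy 1]
          simp only [Finset.mul_sum, Finset.sum_mul]
          simp only [mul_assoc, h1]
      _ = ∑ d, ∑ c, ∑ b, ∑ a, Y 3 d * Y 2 c * Y 1 b * Y 0 a * (y a * y b * y c * y d) := by
          refine Finset.sum_congr rfl fun d _ => Finset.sum_congr rfl fun c _ =>
            Finset.sum_congr rfl fun b _ => ?_
          rw [hxy 0]
          simp only [Finset.mul_sum, Finset.sum_mul]
          simp only [mul_assoc]
      _ = ∑ d, ∑ c, ∑ a, ∑ b, Y 3 d * Y 2 c * Y 1 b * Y 0 a * (y a * y b * y c * y d) :=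
          Finset.sum_congr rfl fun d _ => Finset.sum_congr rfl fun c _ => Finset.sum_comm
      _ = ∑ d, ∑ a, ∑ c, ∑ b, Y 3 d * Y 2 c * Y 1 b * Y 0 a * (y a * y b * y c * y d) :=
          Finset.sum_congr rfl fun d _ => Finset.sum_comm
      _ = ∑ a, ∑ d, ∑ c, ∑ b, Y 3 d * Y 2 c * Y 1 b * Y 0 a * (y a * y b * y c * y d) :=
          Finset.sum_comm
      _ = _ := by
          refine Finset.sum_congr rfl fun a _ => ?_
          rw [Finset.sum_congr rfl fun d _ => Finset.sum_comm, Finset.sum_comm]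
          exact Finset.sum_congr rfl fun b _ => Finset.sum_comm
  rw [e, qdet_eq_sum]
  simp only [Matrix.map_apply, unop_sum, MulOpposite.unop_smul, MulOpposite.unop_mul,
    MulOpposite.unop_op, Finset.sum_mul]
  refine Finset.sum_congr rfl fun a _ => Finset.sum_congr rfl fun b _ =>
    Finset.sum_congr rfl fun c _ => Finset.sum_congr rfl fun d _ => ?_
  rw [hy.word_four, smul_mul_assoc, mul_smul_comm]
  simp only [mul_assoc]

end Exterior

end QuantumSuper


namespace QuantumSuper

/-! ### A model of the quantum exterior algebra -/

section Model

variable {B : Type*} [Ring B] [Algebra Cq B]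

/-- The exterior variable `ξ_j`, acting on the span of the monomials `ξ_J`. -/
noncomputable def xiMat (B : Type*) [Ring B] [Algebra Cq B] (j : Fin 4) :
    Matrix (Finset (Fin 4)) (Finset (Fin 4)) B :=
  fun K J => if K = insert j J then
    (if j ∈ J then 0 else algebraMap Cq B ((-qpow (-1)) ^ (J.filter (· < j)).card)) else 0

/-- A diagonal matrix with scalar entries. -/
noncomputable def diagMat (B : Type*) [Ring B] [Algebra Cq B] (f : Finset (Fin 4) → Cq) :
    Matrix (Finset (Fin 4)) (Finset (Fin 4)) B :=
  Matrix.diagonal fun K => algebraMap Cq B (f K)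

theorem mul_xiMat_apply (M : Matrix (Finset (Fin 4)) (Finset (Fin 4)) B) (j : Fin 4)
    (K J : Finset (Fin 4)) : (M * xiMat B j) K J =
      if j ∈ J then 0 else ((-qpow (-1)) ^ (J.filter (· < j)).card : Cq) • M K (insert j J) := by
  rw [Matrix.mul_apply]
  unfold xiMat
  rw [Finset.sum_eq_single (insert j J)]
  · rw [if_pos rfl]
    split_ifs
    · exact mul_zero _
    · rw [Algebra.smul_def, Algebra.commutes]
  · intro L _ hL
    rw [if_neg hL, mul_zero]
  · intro h; exact absurd (Finset.mem_univ _) h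

theorem xiMat_apply (j : Fin 4) (K J : Finset (Fin 4)) : xiMat B j K J =
    if j ∈ J then 0 else ((-qpow (-1)) ^ (J.filter (· < j)).card : Cq) •
      (1 : Matrix (Finset (Fin 4)) (Finset (Fin 4)) B) K (insert j J) := by
  rw [← mul_xiMat_apply, one_mul]

/-- For `i < j`, inserting `j` after `i` passes one more smaller element than inserting it before
`i`; this is the factor `-q⁻¹`. -/
theorem isExterior_xiMat : IsExterior (xiMat B) := by
  refine ⟨fun j => ?_, fun i j hij => ?_⟩
  · ext K J
    rw [mul_xiMat_apply, xiMat_apply]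
    simp
  · ext K J
    rw [mul_xiMat_apply, Matrix.smul_apply, mul_xiMat_apply, xiMat_apply, xiMat_apply,
      Finset.insert_comm]
    simp only [Finset.mem_insert, hij.ne, hij.ne', false_or]
    by_cases h1 : i ∈ J
    · simp [h1]
    · by_cases h2 : j ∈ J
      · simp [h2]
      · simp only [h1, h2, if_false, Finset.filter_insert, hij, if_true, hij.not_gt]
        rw [Finset.card_insert_of_notMem (by simp [h1]), smul_smul, smul_smul, smul_smul]
        congr 1
        ring

theorem diagMat_mul_xiMat {f : Finset (Fin 4) → Cq} {c : Cq} {j : Fin 4}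
    (h : ∀ J, j ∉ J → f (insert j J) = c * f J) :
    diagMat B f * xiMat B j = c • (xiMat B j * diagMat B f) := by
  ext K J
  simp only [diagMat, Matrix.diagonal_mul, Matrix.smul_apply, Matrix.mul_diagonal]
  unfold xiMat
  split_ifs with h1 h2
  · simp
  · rw [← map_mul, ← map_mul, Algebra.smul_def, ← map_mul, h1, h J h2]
    congr 1
    ring
  · simp

theorem diagMat_mul (f g : Finset (Fin 4) → Cq) :
    diagMat B f * diagMat B g = diagMat B (fun K => f K * g K) := by
  simp [diagMat, Matrix.diagonal_mul_diagonal]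

theorem diagMat_one : diagMat B (fun _ => 1) = 1 := by
  simp [diagMat]

theorem diagMat_comm (f g : Finset (Fin 4) → Cq) :
    diagMat B f * diagMat B g = diagMat B g * diagMat B f := by
  rw [diagMat_mul, diagMat_mul]; simp only [mul_comm]

/-- The constants. -/
noncomputable abbrev const : B →ₐ[Cq] Matrix (Finset (Fin 4)) (Finset (Fin 4)) B :=
  Matrix.scalarAlgHom (Finset (Fin 4)) Cq

theorem const_mul_apply (b : B) (M : Matrix (Finset (Fin 4)) (Finset (Fin 4)) B)
    (K J : Finset (Fin 4)) : (const b * M) K J = b * M K J := by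
  simp [Matrix.scalar_apply]

theorem mul_const_apply (b : B) (M : Matrix (Finset (Fin 4)) (Finset (Fin 4)) B)
    (K J : Finset (Fin 4)) : (M * const b) K J = M K J * b := by
  simp [Matrix.scalar_apply]

theorem xiMat_mul_const (j : Fin 4) (b : B) : xiMat B j * const b = const b * xiMat B j := by
  ext K J
  rw [const_mul_apply, mul_const_apply]
  unfold xiMat
  split_ifs
  · simp
  · rw [Algebra.commutes]
  · simp

theorem diagMat_mul_const (f : Finset (Fin 4) → Cq) (b : B) :
    diagMat B f * const b = const b * diagMat B f := by
  ext K J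
  rw [const_mul_apply, mul_const_apply]
  simp only [diagMat, Matrix.diagonal_apply]
  split_ifs
  · rw [Algebra.commutes]
  · simp

/-- The top coefficient of the value of an operator on the vacuum. -/
def topCoef : Matrix (Finset (Fin 4)) (Finset (Fin 4)) B →+ B where
  toFun M := M Finset.univ ∅
  map_zero' := rfl
  map_add' _ _ := rfl

theorem topCoef_const_mul (b : B) (M : Matrix (Finset (Fin 4)) (Finset (Fin 4)) B) :
    topCoef (const b * M) = b * topCoef M := const_mul_apply b M _ _

theorem topCoef_smul (c : Cq) (M : Matrix (Finset (Fin 4)) (Finset (Fin 4)) B) :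
    topCoef (c • M) = c • topCoef M := rfl

theorem topCoef_diagMat_mul (f : Finset (Fin 4) → Cq)
    (M : Matrix (Finset (Fin 4)) (Finset (Fin 4)) B) :
    topCoef (diagMat B f * M) = f Finset.univ • topCoef M := by
  change (diagMat B f * M) _ _ = _ • M _ _
  rw [diagMat, Matrix.diagonal_mul, Algebra.smul_def]

theorem topCoef_mul_diagMat (f : Finset (Fin 4) → Cq)
    (M : Matrix (Finset (Fin 4)) (Finset (Fin 4)) B) :
    topCoef (M * diagMat B f) = f ∅ • topCoef M := by
  change (M * diagMat B f) _ _ = _ • M _ _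
  rw [diagMat, Matrix.mul_diagonal, Algebra.smul_def, Algebra.commutes]

/-- With `topCoef_const_mul` this says that the top monomial is free over `B`: an identity of
multiples of it is an identity of coefficients. The concrete matrix model serves to make this
evident. -/
theorem topCoef_xiMat : topCoef (xiMat B 0 * xiMat B 1 * xiMat B 2 * xiMat B 3) = 1 := by
  change (xiMat B 0 * xiMat B 1 * xiMat B 2 * xiMat B 3) Finset.univ ∅ = 1
  rw [mul_xiMat_apply, mul_xiMat_apply, mul_xiMat_apply, xiMat_apply]
  have h : (Finset.univ : Finset (Fin 4)) = insert 0 (insert 1 (insert 2 (insert 3 ∅))) := by decide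
  have h1 : (Finset.filter (· < (2 : Fin 4)) (insert 3 ∅)).card = 0 := by decide
  have h2 : (Finset.filter (· < (1 : Fin 4)) (insert 2 (insert 3 ∅))).card = 0 := by decide
  have h3 : (Finset.filter (· < (0 : Fin 4)) (insert 1 (insert 2 (insert 3 ∅)))).card = 0 := by
    decide
  have h4 : (2 : Fin 4) ∉ (insert 3 ∅ : Finset (Fin 4)) := by decide
  have h5 : (1 : Fin 4) ∉ (insert 2 (insert 3 ∅) : Finset (Fin 4)) := by decide
  have h6 : (0 : Fin 4) ∉ (insert 1 (insert 2 (insert 3 ∅)) : Finset (Fin 4)) := by decide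
  rw [if_neg (Finset.notMem_empty _), if_neg h4, if_neg h5, if_neg h6, h1, h2, h3, ← h]
  simp

/-- `M` raises the exterior degree by at most `n`. -/
def DegreeLE (n : ℕ) (M : Matrix (Finset (Fin 4)) (Finset (Fin 4)) B) : Prop :=
  ∀ K J, J.card + n < K.card → M K J = 0

theorem DegreeLE.mono {m n : ℕ} {M : Matrix (Finset (Fin 4)) (Finset (Fin 4)) B}
    (h : DegreeLE m M) (hmn : m ≤ n) : DegreeLE n M :=
  fun K J hKJ => h K J (by omega)

theorem DegreeLE.mul {m n : ℕ} {M N : Matrix (Finset (Fin 4)) (Finset (Fin 4)) B}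
    (hM : DegreeLE m M) (hN : DegreeLE n N) : DegreeLE (m + n) (M * N) := by
  intro K J h
  rw [Matrix.mul_apply]
  refine Finset.sum_eq_zero fun L _ => ?_
  by_cases h1 : L.card + m < K.card
  · rw [hM K L h1, zero_mul]
  · rw [hN L J (by omega), mul_zero]

theorem DegreeLE.add {n : ℕ} {M N : Matrix (Finset (Fin 4)) (Finset (Fin 4)) B}
    (hM : DegreeLE n M) (hN : DegreeLE n N) : DegreeLE n (M + N) := fun K J h => by
  rw [Matrix.add_apply, hM K J h, hN K J h, add_zero]

theorem DegreeLE.smul {n : ℕ} {M : Matrix (Finset (Fin 4)) (Finset (Fin 4)) B}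
    (hM : DegreeLE n M) (c : Cq) : DegreeLE n (c • M) := fun K J h => by
  rw [Matrix.smul_apply, hM K J h, smul_zero]

theorem DegreeLE.sum {ι : Type*} {s : Finset ι} {n : ℕ}
    {f : ι → Matrix (Finset (Fin 4)) (Finset (Fin 4)) B}
    (h : ∀ i ∈ s, DegreeLE n (f i)) : DegreeLE n (∑ i ∈ s, f i) := fun K J hKJ => by
  rw [Matrix.sum_apply]
  exact Finset.sum_eq_zero fun i hi => h i hi K J hKJ

theorem degreeLE_xiMat (j : Fin 4) : DegreeLE 1 (xiMat B j) := by
  intro K J h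
  unfold xiMat
  rw [if_neg]
  rintro rfl
  have := Finset.card_insert_le j J
  omega

theorem degreeLE_diagMat (f : Finset (Fin 4) → Cq) : DegreeLE 0 (diagMat B f) := by
  intro K J h
  rw [diagMat, Matrix.diagonal_apply_ne]
  rintro rfl
  omega

theorem degreeLE_const (b : B) : DegreeLE 0 (const b) := by
  intro K J h
  rw [Matrix.scalarAlgHom_apply, Matrix.scalar_apply, Matrix.diagonal_apply_ne]
  rintro rfl
  omega

theorem DegreeLE.topCoef {M : Matrix (Finset (Fin 4)) (Finset (Fin 4)) B} (h : DegreeLE 3 M) :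
    topCoef M = 0 := h _ _ (by decide)

end Model

end QuantumSuper


namespace QuantumSuper

/-! ### Right quantum matrices -/

section RightQuantum

variable {B C : Type*} [Ring B] [Algebra Cq B] [Ring C] [Algebra Cq C]

/-- The relations of a square matrix `X` that are equivalent to the relations of the quantum
exterior algebra for the coordinates of `X ξ`. -/
structure IsRightQuantum {n : ℕ} (X : Matrix (Fin n) (Fin n) B) : Prop where
  row : ∀ i j l, j < l → X i l * X i j = qpow 1 • (X i j * X i l)
  mixed : ∀ i j k l, i < k → j < l → X k j * X i l - qpow (-1) • (X k l * X i j) =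
    (-qpow (-1)) • (X i j * X k l - qpow (-1) • (X i l * X k j))

theorem qdet_map {n : ℕ} (f : B →ₐ[Cq] C) (M : Matrix (Fin n) (Fin n) B) :
    f (qdet M) = qdet (M.map f) := by
  simp only [qdet, map_sum, map_smul, map_list_prod, List.map_ofFn, Function.comp_def,
    Matrix.map_apply]

theorem IsRightQuantum.map {n : ℕ} {X : Matrix (Fin n) (Fin n) B} (hX : IsRightQuantum X)
    (f : B →ₐ[Cq] C) : IsRightQuantum (X.map f) := by
  refine ⟨fun i j l h => ?_, fun i j k l h h' => ?_⟩
  · simp only [Matrix.map_apply, ← map_mul, ← map_smul, hX.row i j l h]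
  · simp only [Matrix.map_apply, ← map_mul, ← map_smul, ← map_sub, hX.mixed i j k l h h']

/-- Comparing coefficients of `x j * x l` for `j < l`, the row relations give the squares and the
mixed relations give the anticommutation. -/
theorem IsRightQuantum.isExterior {n : ℕ} {X : Matrix (Fin n) (Fin n) B} (hX : IsRightQuantum X)
    {x : Fin n → B} (hx : IsExterior x) (hc : ∀ i j k, x k * X i j = X i j * x k) :
    IsExterior (fun i => ∑ j, X i j * x j) := by
  have e : ∀ i k j l, X i j * x j * (X k l * x l) = X i j * X k l * (x j * x l) := by
    intro i k j l
    rw [mul_assoc, ← mul_assoc (x j), hc]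
    simp only [mul_assoc]
  refine ⟨fun i => ?_, fun i k hik => ?_⟩
  · rw [Finset.sum_mul_sum]
    refine sum_sum_eq_zero_of_pairs _ (fun j => ?_) (fun j l hjl => ?_)
    · rw [e, hx.sq, mul_zero]
    · rw [e, e, hx.anti j l hjl, hX.row i j l hjl]
      simp only [smul_mul_assoc, mul_smul_comm, smul_smul, neg_smul, qpow_neg_mul,
        mul_neg, one_smul, add_neg_cancel]
  · rw [Finset.sum_mul_sum, Finset.sum_mul_sum, ← sub_eq_zero]
    simp only [Finset.smul_sum, ← Finset.sum_sub_distrib]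
    refine sum_sum_eq_zero_of_pairs _ (fun j => ?_) (fun j l hjl => ?_)
    · rw [e, e, hx.sq, mul_zero, mul_zero, smul_zero, sub_zero]
    · have h := congrArg (· * (x j * x l)) (hX.mixed i j k l hik hjl)
      simp only [e, hx.anti j l hjl]
      simp only [sub_mul, smul_mul_assoc, mul_smul_comm] at h ⊢
      rw [← sub_eq_zero] at h ⊢
      rw [sub_zero, ← h]
      module

/-- The product of all `x i` with `i ≠ k`, in increasing order. -/
def prodErase (x : Fin 4 → B) : Fin 4 → B :=
  ![x 1 * x 2 * x 3, x 0 * x 2 * x 3, x 0 * x 1 * x 3, x 0 * x 1 * x 2]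

theorem IsExterior.mul_prodErase {x : Fin 4 → B} (hx : IsExterior x) (i k : Fin 4) :
    x i * prodErase x k =
      if i = k then (-qpow (-1)) ^ (k : ℕ) • (x 0 * x 1 * x 2 * x 3) else 0 := by
  have h : ∀ b c d : Fin 4, x i * (x b * x c * x d) =
      wordCoef [i, b, c, d] • (x 0 * x 1 * x 2 * x 3) := by
    intro b c d
    rw [← hx.word_four]
    simp only [mul_assoc]
  have h' : ∀ b c d : Fin 4, ([i, b, c, d].Nodup ↔ i = k) →
      ([i, b, c, d].Nodup → wordInv [i, b, c, d] = k) → x i * (x b * x c * x d) =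
      if i = k then (-qpow (-1)) ^ (k : ℕ) • (x 0 * x 1 * x 2 * x 3) else 0 := by
    intro b c d h1 h2
    rw [h, wordCoef]
    by_cases h3 : i = k
    · rw [if_pos (h1.2 h3), if_pos h3, h2 (h1.2 h3)]
    · rw [if_neg (mt h1.1 h3), if_neg h3, zero_smul]
  fin_cases k
  · exact h' 1 2 3 (by clear h h'; revert i; decide) (by clear h h'; revert i; decide)
  · exact h' 0 2 3 (by clear h h'; revert i; decide) (by clear h h'; revert i; decide)
  · exact h' 0 1 3 (by clear h h'; revert i; decide) (by clear h h'; revert i; decide)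
  · exact h' 0 1 2 (by clear h h'; revert i; decide) (by clear h h'; revert i; decide)

/-- Laplace expansion: the product of `x i = ∑ X_ij ξ_j` with the product of the other `x`, omitting
`x k`, is zero or a power of `-q⁻¹` times `qdet X` in top degree. Expanding only the first factor
exhibits the cofactors, which stand to the right of `X`. -/
theorem IsRightQuantum.exists_right_inverse {X : Matrix (Fin 4) (Fin 4) B}
    (hX : IsRightQuantum X) (hd : IsUnit (qdet X)) : ∃ Y, X * Y = 1 := by
  have hx := (hX.map const).isExterior isExterior_xiMat (fun i j k => xiMat_mul_const k (X i j))
  have htop := congrArg topCoef (isExterior_xiMat.prod_linear (M := X.map const)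
    (fun i j k => xiMat_mul_const k (X i j)))
  rw [← qdet_map, topCoef_const_mul, topCoef_xiMat, mul_one] at htop
  obtain ⟨x, hx0⟩ : ∃ x : Fin 4 → Matrix (Finset (Fin 4)) (Finset (Fin 4)) B,
      ∀ i, ∑ j, X.map const i j * xiMat B j = x i := ⟨_, fun _ => rfl⟩
  simp only [hx0] at hx htop
  obtain ⟨u, hu⟩ := hd
  -- The factor `(-q)^k` compensates the `(-q⁻¹)^k` produced by moving `x k` into its place.
  refine ⟨Matrix.of fun j k =>
    ((-qpow 1) ^ (k : ℕ) : Cq) • (topCoef (xiMat B j * prodErase x k) * ↑u⁻¹), ?_⟩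
  ext i k
  rw [Matrix.mul_apply]
  have h := congrArg topCoef (hx.mul_prodErase i k)
  rw [← hx0 i] at h
  simp only [Finset.sum_mul, map_sum, mul_assoc, Matrix.map_apply, topCoef_const_mul] at h
  simp only [Matrix.of_apply, mul_smul_comm, ← Finset.smul_sum, ← mul_assoc, ← Finset.sum_mul]
  rw [h, Matrix.one_apply]
  split_ifs
  · simp only [← mul_assoc]
    rw [topCoef_smul, htop, ← hu, smul_mul_assoc, Units.mul_inv, smul_smul, ← mul_pow, neg_mul_neg,
      qpow_one_mul_neg_one, one_pow, one_smul]
  · simp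

/-- The matrix `X` with both index sets reversed, over the opposite algebra. -/
def revOp (X : Matrix (Fin 4) (Fin 4) B) : Matrix (Fin 4) (Fin 4) Bᵐᵒᵖ :=
  Matrix.of fun i j => MulOpposite.op (X i.rev j.rev)

theorem IsRightQuantum.revOp {X : Matrix (Fin 4) (Fin 4) B} (hX : IsRightQuantum X) :
    IsRightQuantum (revOp X) := by
  refine ⟨fun i j l h => ?_, fun i j k l hik hjl => ?_⟩
  · simp only [QuantumSuper.revOp, Matrix.of_apply, ← MulOpposite.op_mul, ← MulOpposite.op_smul]
    rw [hX.row _ _ _ (Fin.rev_lt_rev.2 h)]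
  · simp only [QuantumSuper.revOp, Matrix.of_apply, ← MulOpposite.op_mul, ← MulOpposite.op_smul,
      ← MulOpposite.op_sub]
    rw [hX.mixed _ _ _ _ (Fin.rev_lt_rev.2 hik) (Fin.rev_lt_rev.2 hjl)]

theorem wordCoef_rev (a b c d : Fin 4) :
    wordCoef [a.rev, b.rev, c.rev, d.rev] = wordCoef [d, c, b, a] := by
  have h : ([a.rev, b.rev, c.rev, d.rev].Nodup ↔ [d, c, b, a].Nodup) ∧
      wordInv [a.rev, b.rev, c.rev, d.rev] = wordInv [d, c, b, a] := by
    revert a b c d; decide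
  unfold wordCoef
  simp only [h.1, h.2]

/-- Reversing the order of a word and the order of the alphabet preserves its inversions. -/
theorem qdet_revOp (X : Matrix (Fin 4) (Fin 4) B) :
    qdet (revOp X) = MulOpposite.op (qdet X) := by
  refine MulOpposite.unop_injective ?_
  rw [MulOpposite.unop_op, qdet_eq_sum, qdet_eq_sum]
  simp only [unop_sum, MulOpposite.unop_smul, MulOpposite.unop_mul, revOp, Matrix.of_apply,
    MulOpposite.unop_op]
  have e : ∀ F : Fin 4 → Fin 4 → Fin 4 → Fin 4 → B, ∑ a, ∑ b, ∑ c, ∑ d, F a b c d =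
      ∑ d : Fin 4, ∑ c : Fin 4, ∑ b : Fin 4, ∑ a : Fin 4, F a.rev b.rev c.rev d.rev := by
    intro F
    have r : ∀ G : Fin 4 → B, ∑ a, G a = ∑ a : Fin 4, G a.rev := fun G =>
      (Equiv.sum_comp Fin.revPerm G).symm
    rw [r]
    simp_rw [r fun b => ∑ c, ∑ d, F _ b c d, r fun c => ∑ d, F _ _ c d, r fun d => F _ _ _ d]
    calc _ = ∑ a : Fin 4, ∑ b : Fin 4, ∑ d : Fin 4, ∑ c : Fin 4, F a.rev b.rev c.rev d.rev :=
          Finset.sum_congr rfl fun a _ => Finset.sum_congr rfl fun b _ => Finset.sum_comm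
      _ = ∑ a : Fin 4, ∑ d : Fin 4, ∑ b : Fin 4, ∑ c : Fin 4, F a.rev b.rev c.rev d.rev :=
          Finset.sum_congr rfl fun a _ => Finset.sum_comm
      _ = ∑ d : Fin 4, ∑ a : Fin 4, ∑ c : Fin 4, ∑ b : Fin 4, F a.rev b.rev c.rev d.rev := by
          rw [Finset.sum_comm]
          exact Finset.sum_congr rfl fun d _ => Finset.sum_congr rfl fun a _ => Finset.sum_comm
      _ = _ := by
          refine Finset.sum_congr rfl fun d _ => ?_
          rw [Finset.sum_comm]
          exact Finset.sum_congr rfl fun c _ => Finset.sum_comm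
  rw [e]
  refine Finset.sum_congr rfl fun a _ => Finset.sum_congr rfl fun b _ =>
    Finset.sum_congr rfl fun c _ => Finset.sum_congr rfl fun d _ => ?_
  rw [wordCoef_rev]
  simp only [Fin.rev_rev, mul_assoc]
  rfl

/-- The relations of quantum matrices. -/
structure IsQuantum {n : ℕ} (X : Matrix (Fin n) (Fin n) B) : Prop where
  row : ∀ i j l, j < l → X i l * X i j = qpow 1 • (X i j * X i l)
  col : ∀ i k j, i < k → X k j * X i j = qpow 1 • (X i j * X k j)
  comm : ∀ i j k l, i < k → j < l → X k j * X i l = X i l * X k j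
  cross : ∀ i j k l, i < k → j < l →
    X i j * X k l = X k l * X i j + (qpow (-1) - qpow 1) • (X k j * X i l)

theorem IsQuantum.isRightQuantum {n : ℕ} {X : Matrix (Fin n) (Fin n) B} (hX : IsQuantum X) :
    IsRightQuantum X := by
  refine ⟨hX.row, fun i j k l hik hjl => ?_⟩
  rw [hX.cross i j k l hik hjl, hX.comm i j k l hik hjl]
  match_scalars <;> first | ring1 | linear_combination qpow_neg_mul | linear_combination -qpow_neg_mul

theorem IsQuantum.transpose {n : ℕ} {X : Matrix (Fin n) (Fin n) B} (hX : IsQuantum X) :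
    IsQuantum X.transpose := by
  refine ⟨fun i j l h => hX.col _ _ _ h, fun i k j h => hX.row _ _ _ h,
    fun i j k l hik hjl => (hX.comm _ _ _ _ hjl hik).symm, fun i j k l hik hjl => ?_⟩
  simp only [Matrix.transpose_apply]
  rw [hX.cross _ _ _ _ hjl hik, hX.comm _ _ _ _ hjl hik]

/-- The identity holds permutation by permutation. Two factors that must change places when the
product is sorted by rows instead of columns form an inversion of the permutation, and such entries
commute. -/
theorem IsQuantum.qdet_transpose {X : Matrix (Fin 4) (Fin 4) B} (hX : IsQuantum X) :
    qdet X.transpose = qdet X := by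
  have hc' : ∀ i j k l z, i < k → j < l → X k j * (X i l * z) = X i l * X k j * z :=
    fun i j k l z hik hjl => by rw [← mul_assoc, hX.comm i j k l hik hjl]
  have hterm : ∀ σ : Equiv.Perm (Fin 4), (List.ofFn fun i => X (σ i) i).prod =
      (List.ofFn fun i => X i (σ⁻¹ i)).prod := by
    intro σ
    have htab : ∀ σ : Equiv.Perm (Fin 4), (σ : Fin 4 → Fin 4) ∈ ([
        ![0, 1, 2, 3], ![0, 1, 3, 2], ![0, 2, 1, 3], ![0, 2, 3, 1],
        ![0, 3, 1, 2], ![0, 3, 2, 1], ![1, 0, 2, 3], ![1, 0, 3, 2],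
        ![1, 2, 0, 3], ![1, 2, 3, 0], ![1, 3, 0, 2], ![1, 3, 2, 0],
        ![2, 0, 1, 3], ![2, 0, 3, 1], ![2, 1, 0, 3], ![2, 1, 3, 0],
        ![2, 3, 0, 1], ![2, 3, 1, 0], ![3, 0, 1, 2], ![3, 0, 2, 1],
        ![3, 1, 0, 2], ![3, 1, 2, 0], ![3, 2, 0, 1], ![3, 2, 1, 0]] : List (Fin 4 → Fin 4)) := by decide
    have hinv : ∀ i j, σ i = j → σ⁻¹ j = i := fun i j hij => by simp [← hij]
    have h' := htab σ
    simp only [List.mem_cons, List.not_mem_nil, or_false, funext_iff] at h'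
    -- The trailing factor `1` lets `hc'` apply to the last two entries as well.
    have hofn : ∀ f : Fin 4 → B, (List.ofFn f).prod = f 0 * (f 1 * (f 2 * (f 3 * 1))) := by simp
    rw [hofn, hofn]
    rcases h' with h | h | h | h | h | h | h | h | h | h | h | h | h | h | h | h |
      h | h | h | h | h | h | h | h <;>
    · have e0 := h 0
      have e1 := h 1
      have e2 := h 2
      have e3 := h 3
      simp only [Matrix.cons_val] at e0 e1 e2 e3
      rw [e0, e1, e2, e3]
      replace e0 := hinv _ _ e0
      replace e1 := hinv _ _ e1
      replace e2 := hinv _ _ e2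
      replace e3 := hinv _ _ e3
      rw [e0, e1, e2, e3]
      try simp (disch := decide) only [hc', mul_assoc]
  have hlen : ∀ σ : Equiv.Perm (Fin 4), permLength σ⁻¹ = permLength σ := by decide
  unfold qdet
  rw [← Equiv.sum_comp (Equiv.inv _)]
  refine Finset.sum_congr rfl fun σ _ => ?_
  rw [Equiv.inv_apply, hlen]
  simp only [Matrix.transpose_apply]
  rw [hterm, inv_inv]

/-- The right inverse comes from cofactors of `X`. Reversing and transposing over the opposite
algebra preserves the right quantum relations and invertibility of the determinant, and turns a
right inverse there into a left inverse here. -/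
theorem IsQuantum.exists_inverse {X : Matrix (Fin 4) (Fin 4) B}
    (hX : IsQuantum X) (hd : IsUnit (qdet X)) : ∃ Y, X * Y = 1 ∧ Y * X = 1 := by
  obtain ⟨Y, hY⟩ := hX.isRightQuantum.exists_right_inverse hd
  obtain ⟨Z, hZ⟩ := hX.transpose.isRightQuantum.revOp.exists_right_inverse (by
    rw [qdet_revOp, hX.qdet_transpose]
    exact hd.op)
  have hZ' : (Matrix.of fun i j => (Z j.rev i.rev).unop) * X = 1 := by
    ext i k
    have h := congrArg MulOpposite.unop (congrFun (congrFun hZ k.rev) i.rev)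
    rw [Matrix.mul_apply, unop_sum] at h
    rw [Matrix.mul_apply, ← Equiv.sum_comp Fin.revPerm]
    simp only [revOp, Matrix.of_apply, Matrix.transpose_apply, MulOpposite.unop_mul,
      MulOpposite.unop_op, Fin.rev_rev, Fin.revPerm_apply] at h ⊢
    rw [h, Matrix.one_apply, Matrix.one_apply]
    simp only [Fin.rev_inj, eq_comm (a := k)]
    split_ifs <;> rfl
  refine ⟨Y, hY, ?_⟩
  rw [← left_inv_eq_right_inv hZ' hY, hZ']

/-- Since `ξ = Y (X ξ)`, the top monomial in `ξ` is computed in two steps, with the coefficients of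
`Y` coming out in opposite order. No quantum relations for `Y` are needed. -/
theorem IsRightQuantum.qdet_op_mul_qdet {X Y : Matrix (Fin 4) (Fin 4) B} (hX : IsRightQuantum X)
    (h : Y * X = 1) : (qdet (Y.map MulOpposite.op)).unop * qdet X = 1 := by
  have hx := (hX.map const).isExterior isExterior_xiMat (fun i j k => xiMat_mul_const k (X i j))
  have hprod := isExterior_xiMat.prod_linear (M := X.map const)
    (fun i j k => xiMat_mul_const k (X i j))
  have h1 := hx.prod_linear_op (x := xiMat B) (Y := Y.map const)
    (fun i j k => xiMat_mul_const k (Y i j)) (fun i => by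
      simp only [Finset.mul_sum, Matrix.map_apply, ← mul_assoc, ← map_mul]
      rw [Finset.sum_comm]
      simp only [← Finset.sum_mul, ← map_sum]
      have : ∀ j, ∑ k, Y i k * X k j = (1 : Matrix _ _ B) i j := fun j => by
        rw [← h, Matrix.mul_apply]
      simp only [this, Matrix.one_apply]
      simp)
  rw [hprod, ← qdet_map] at h1
  have h2 : (Y.map const).map MulOpposite.op = (Y.map MulOpposite.op).map (AlgHom.op const) := rfl
  rw [h2, ← qdet_map] at h1
  have h3 := congrArg topCoef h1
  change _ = topCoef (const (qdet (Y.map MulOpposite.op)).unop * _) at h3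
  rw [topCoef_const_mul, topCoef_const_mul, topCoef_xiMat, mul_one] at h3
  exact h3.symm

end RightQuantum

end QuantumSuper


namespace QuantumSuper

/-! ### Block relations of a Manin matrix and the Schur complement -/

section Schur

variable {B C : Type*} [Ring B] [Algebra Cq B] [Ring C] [Algebra Cq C]

/-- The even-even block of a supermatrix. -/
def evenBlock (T : Matrix (Fin 5) (Fin 5) B) : Matrix (Fin 4) (Fin 4) B :=
  Matrix.of fun i j => T i.castSucc j.castSucc

/-- The Schur complement `A - b e c` of the corner of a supermatrix, where `e` is the inverse of
the corner. -/
def schur (T : Matrix (Fin 5) (Fin 5) B) (e : B) : Matrix (Fin 4) (Fin 4) B :=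
  Matrix.of fun i j => T i.castSucc j.castSucc - T i.castSucc 4 * e * T 4 j.castSucc

theorem mul_inv_comm_of_comm {d e x : B} {c c' : Cq} (hde : d * e = 1) (hed : e * d = 1)
    (hc : c' * c = 1) (h : d * x = c • (x * d)) : e * x = c' • (x * e) := by
  have h1 : c' • (e * (d * x) * e) = c' • (e * (c • (x * d)) * e) := by rw [h]
  rw [← mul_assoc, hed, one_mul, mul_smul_comm, smul_mul_assoc, smul_smul, hc, one_smul,
    ← mul_assoc e x, mul_assoc (e * x), hde, mul_one] at h1
  exact h1.symm

variable {T : Matrix (Fin 5) (Fin 5) B}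

theorem IsManin.evenBlock (hT : IsManin T) : IsQuantum (evenBlock T) := by
  refine ⟨fun i j l h => ?_, fun i k j h => ?_, fun i j k l h h' => ?_, fun i j k l h h' => ?_⟩
  · simp [QuantumSuper.evenBlock, hT.row i.castSucc j.castSucc l.castSucc h, idx_castSucc,
      eigenvalue_castSucc]
  · simp [QuantumSuper.evenBlock, hT.col i.castSucc k.castSucc j.castSucc h, idx_castSucc,
      eigenvalue_castSucc]
  · simp [QuantumSuper.evenBlock, hT.comm i.castSucc j.castSucc k.castSucc l.castSucc h h',
      idx_castSucc]
  · exact hT.cross i.castSucc j.castSucc k.castSucc l.castSucc h h'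

theorem IsManin.corner_mul_col (hT : IsManin T) (i : Fin 4) :
    T 4 4 * T i.castSucc 4 = qpow (-1) • (T i.castSucc 4 * T 4 4) := by
  rw [hT.col _ _ _ (castSucc_lt_four i), eigenvalue_four, idx_four]
  simp

theorem IsManin.corner_mul_row (hT : IsManin T) (j : Fin 4) :
    T 4 4 * T 4 j.castSucc = qpow (-1) • (T 4 j.castSucc * T 4 4) := by
  rw [hT.row _ _ _ (castSucc_lt_four j), eigenvalue_four, idx_four]
  simp

theorem IsManin.row_mul_col (hT : IsManin T) (i j : Fin 4) :
    T 4 j.castSucc * T i.castSucc 4 = -(T i.castSucc 4 * T 4 j.castSucc) := by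
  rw [hT.comm _ _ _ _ (castSucc_lt_four i) (castSucc_lt_four j)]
  simp [idx_four]

theorem IsManin.col_sq (hT : IsManin T) (i : Fin 4) : T i.castSucc 4 * T i.castSucc 4 = 0 :=
  hT.sq _ _ (par_castSucc_four i)

theorem IsManin.row_sq (hT : IsManin T) (j : Fin 4) : T 4 j.castSucc * T 4 j.castSucc = 0 :=
  hT.sq _ _ (par_four_castSucc j)

variable {e : B}

theorem IsManin.inv_mul_col (hT : IsManin T) (h1 : T 4 4 * e = 1) (h2 : e * T 4 4 = 1)
    (i : Fin 4) : e * T i.castSucc 4 = qpow 1 • (T i.castSucc 4 * e) :=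
  mul_inv_comm_of_comm h1 h2 qpow_one_mul_neg_one (hT.corner_mul_col i)

theorem IsManin.inv_mul_row (hT : IsManin T) (h1 : T 4 4 * e = 1) (h2 : e * T 4 4 = 1)
    (j : Fin 4) : e * T 4 j.castSucc = qpow 1 • (T 4 j.castSucc * e) :=
  mul_inv_comm_of_comm h1 h2 qpow_one_mul_neg_one (hT.corner_mul_row j)

theorem IsManin.inv_mul_even (hT : IsManin T) (h1 : T 4 4 * e = 1) (h2 : e * T 4 4 = 1)
    (i j : Fin 4) : e * T i.castSucc j.castSucc = T i.castSucc j.castSucc * e -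
      (qpow (-1) - qpow 1) • (T i.castSucc 4 * (e * (e * T 4 j.castSucc))) := by
  have h := congrArg (fun x => e * x * e)
    (hT.cross _ _ _ _ (castSucc_lt_four i) (castSucc_lt_four j))
  have hr : T 4 j.castSucc * e = qpow (-1) • (e * T 4 j.castSucc) := by
    rw [hT.inv_mul_row h1 h2, smul_smul, qpow_neg_mul, one_smul]
  simp only [mul_add, add_mul, mul_smul_comm, smul_mul_assoc] at h
  rw [mul_assoc e, mul_assoc _ _ e, h1, mul_one, ← mul_assoc e (T 4 4), h2, one_mul,
    hT.row_mul_col] at h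
  rw [h]
  have h' : e * (-(T i.castSucc 4 * T 4 j.castSucc)) * e =
      -(T i.castSucc 4 * (e * (e * T 4 j.castSucc))) := by
    rw [mul_neg, neg_mul, ← mul_assoc e, hT.inv_mul_col h1 h2, smul_mul_assoc, smul_mul_assoc,
      mul_assoc _ _ e, hr, mul_smul_comm, smul_smul, qpow_one_mul_neg_one, one_smul]
    simp only [mul_assoc]
  rw [h', smul_neg]
  exact (sub_eq_add_neg _ _).symm

end Schur

/-- The relations between the entries of two rows and two columns of a Manin matrix and the
inverse of its corner make the corresponding `2 × 2` Schur complement satisfy the relations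
of quantum matrices. -/
theorem schur_cross {B : Type*} [Ring B] [Algebra Cq B] {p q : Cq} (hpq : p * q = 1)
    {w x y z b b' c c' e : B}
    (ew : e * w = w * e - (p - q) • (b * (e * (e * c))))
    (ex : e * x = x * e - (p - q) • (b * (e * (e * c'))))
    (ey : e * y = y * e - (p - q) • (b' * (e * (e * c))))
    (ez : e * z = z * e - (p - q) • (b' * (e * (e * c'))))
    (eb : e * b = q • (b * e)) (eb' : e * b' = q • (b' * e))
    (ce : c * e = p • (e * c)) (ce' : c' * e = p • (e * c'))
    (cb : c * b = -(b * c)) (cb' : c * b' = -(b' * c))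
    (c'b : c' * b = -(b * c')) (c'b' : c' * b' = -(b' * c'))
    (bb : b * b = 0) (b'b' : b' * b' = 0) (cc : c * c = 0) (c'c' : c' * c' = 0)
    (b'b : b' * b = -p • (b * b')) (c'c : c' * c = -p • (c * c'))
    (xw : x * w = q • (w * x)) (zy : z * y = q • (y * z))
    (yw : y * w = q • (w * y)) (zx : z * x = q • (x * z))
    (yx : y * x = x * y) (zw : z * w = w * z - (p - q) • (x * y))
    (bw : b * w = q • (w * b)) (bx : b * x = q • (x * b))
    (b'y : b' * y = q • (y * b')) (b'z : b' * z = q • (z * b'))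
    (cw : c * w = q • (w * c)) (cy : c * y = q • (y * c))
    (c'x : c' * x = q • (x * c')) (c'z : c' * z = q • (z * c'))
    (by' : b * y = y * b) (bz : b * z = z * b)
    (b'w : b' * w = w * b' - (p - q) • (y * b)) (b'x : b' * x = x * b' - (p - q) • (z * b))
    (cx : c * x = x * c) (cz : c * z = z * c)
    (c'w : c' * w = w * c' - (p - q) • (x * c)) (c'y : c' * y = y * c' - (p - q) • (z * c)) :
    (x - b * e * c') * (w - b * e * c) = q • ((w - b * e * c) * (x - b * e * c')) ∧
    (y - b' * e * c) * (w - b * e * c) = q • ((w - b * e * c) * (y - b' * e * c)) ∧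
    (z - b' * e * c') * (y - b' * e * c) = q • ((y - b' * e * c) * (z - b' * e * c')) ∧
    (z - b' * e * c') * (x - b * e * c') = q • ((x - b * e * c') * (z - b' * e * c')) ∧
    (y - b' * e * c) * (x - b * e * c') = (x - b * e * c') * (y - b' * e * c) ∧
    (w - b * e * c) * (z - b' * e * c') = (z - b' * e * c') * (w - b * e * c) +
      (p - q) • ((y - b' * e * c) * (x - b * e * c')) := by
  have assoc : ∀ {u v r : B}, u * v = r → ∀ t, u * (v * t) = r * t := by
    intro u v r h t
    rw [← mul_assoc, h]
  -- The relations serve as rewriting rules towards the order: even entries, then `b`'s, then `e`'s,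
  -- then `c`'s. The `assoc` forms apply the same rules inside right-nested products. Comparing
  -- coefficients of the normal forms then needs only `p * q = 1`.
  refine ⟨?_, ?_, ?_, ?_, ?_, ?_⟩ <;>
  simp only [mul_sub, sub_mul, mul_assoc, smul_mul_assoc, mul_smul_comm,
    neg_mul, mul_neg, zero_mul, mul_zero, smul_sub, smul_zero,
    cb, cb', c'b, c'b', bb, b'b', cc, c'c', b'b, c'c, xw, zy,
    yw, zx, yx, zw, bw, bx, b'y, b'z, cw, cy, c'x, c'z, by', bz, b'w, b'x, cx, cz, c'w, c'y,
    assoc ew, assoc ex, assoc ey, assoc ez, assoc eb, assoc eb', assoc ce, assoc ce', assoc cb,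
    assoc cb', assoc c'b, assoc c'b', assoc bb, assoc b'b', assoc cc, assoc c'c', assoc b'b,
    assoc c'c, assoc xw, assoc zy, assoc yw, assoc zx, assoc yx, assoc zw, assoc bw, assoc bx,
    assoc b'y, assoc b'z, assoc cw, assoc cy, assoc c'x, assoc c'z, assoc by', assoc bz,
    assoc b'w, assoc b'x, assoc cx, assoc cz, assoc c'w, assoc c'y] <;>
  match_scalars <;> grind

section

variable {B C : Type*} [Ring B] [Algebra Cq B] [Ring C] [Algebra Cq C]
  {T : Matrix (Fin 5) (Fin 5) B} {e : B}

theorem IsManin.schur (hT : IsManin T) (h1 : T 4 4 * e = 1) (h2 : e * T 4 4 = 1) :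
    IsQuantum (schur T e) := by
  have key := fun (i j k l : Fin 4) (hik : i < k) (hjl : j < l) => by
    have hik' : i.castSucc < k.castSucc := hik
    have hjl' : j.castSucc < l.castSucc := hjl
    have hr := hT.evenBlock.row
    have hc := hT.evenBlock.col
    have hm := hT.evenBlock.comm i j k l hik hjl
    have hx := hT.evenBlock.cross i j k l hik hjl
    simp only [QuantumSuper.evenBlock, Matrix.of_apply] at hr hc hm hx
    have ce : ∀ j : Fin 4, T 4 j.castSucc * e = qpow (-1) • (e * T 4 j.castSucc) := fun j => by
      rw [hT.inv_mul_row h1 h2, smul_smul, qpow_neg_mul, one_smul]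
    have bA : ∀ i j : Fin 4, T i.castSucc 4 * T i.castSucc j.castSucc =
        qpow 1 • (T i.castSucc j.castSucc * T i.castSucc 4) := fun i j => by
      rw [hT.row _ _ _ (castSucc_lt_four j), idx_castSucc, eigenvalue_castSucc]; simp
    have cA : ∀ i j : Fin 4, T 4 j.castSucc * T i.castSucc j.castSucc =
        qpow 1 • (T i.castSucc j.castSucc * T 4 j.castSucc) := fun i j => by
      rw [hT.col _ _ _ (castSucc_lt_four i), idx_castSucc, eigenvalue_castSucc]; simp
    have bA' : ∀ j : Fin 4, T i.castSucc 4 * T k.castSucc j.castSucc =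
        T k.castSucc j.castSucc * T i.castSucc 4 := fun j => by
      rw [hT.comm _ _ _ _ hik' (castSucc_lt_four j), idx_castSucc]; simp
    have cA' : ∀ i : Fin 4, T 4 j.castSucc * T i.castSucc l.castSucc =
        T i.castSucc l.castSucc * T 4 j.castSucc := fun i => by
      rw [hT.comm _ _ _ _ (castSucc_lt_four i) hjl', idx_castSucc]; simp
    have bA2 : ∀ j : Fin 4, T k.castSucc 4 * T i.castSucc j.castSucc =
        T i.castSucc j.castSucc * T k.castSucc 4 -
          (qpow (-1) - qpow 1) • (T k.castSucc j.castSucc * T i.castSucc 4) := fun j =>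
      eq_sub_of_add_eq (hT.cross _ _ _ _ hik' (castSucc_lt_four j)).symm
    have cA2 : ∀ i : Fin 4, T 4 l.castSucc * T i.castSucc j.castSucc =
        T i.castSucc j.castSucc * T 4 l.castSucc -
          (qpow (-1) - qpow 1) • (T i.castSucc l.castSucc * T 4 j.castSucc) := fun i => by
      rw [← cA' i]
      exact eq_sub_of_add_eq (hT.cross _ _ _ _ (castSucc_lt_four i) hjl').symm
    have bb : T k.castSucc 4 * T i.castSucc 4 =
        -qpow (-1) • (T i.castSucc 4 * T k.castSucc 4) := by
      rw [hT.col _ _ _ hik', idx_castSucc, eigenvalue_four]; simp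
    have cc : T 4 l.castSucc * T 4 j.castSucc =
        -qpow (-1) • (T 4 j.castSucc * T 4 l.castSucc) := by
      rw [hT.row _ _ _ hjl', idx_castSucc, eigenvalue_four]; simp
    exact schur_cross qpow_neg_mul
      (hT.inv_mul_even h1 h2 i j) (hT.inv_mul_even h1 h2 i l) (hT.inv_mul_even h1 h2 k j)
      (hT.inv_mul_even h1 h2 k l) (hT.inv_mul_col h1 h2 i) (hT.inv_mul_col h1 h2 k)
      (ce j) (ce l) (hT.row_mul_col i j) (hT.row_mul_col k j) (hT.row_mul_col i l)
      (hT.row_mul_col k l) (hT.col_sq i) (hT.col_sq k) (hT.row_sq j) (hT.row_sq l) bb cc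
      (hr i j l hjl) (hr k j l hjl) (hc i k j hik) (hc i k l hik) hm
      (eq_sub_of_add_eq (by rw [hx, hm])) (bA i j) (bA i l) (bA k j) (bA k l) (cA i j) (cA k j)
      (cA i l) (cA k l) (bA' j) (bA' l) (bA2 j) (bA2 l) (cA' i) (cA' k) (cA2 i) (cA2 k)
  -- `schur_cross` speaks of two rows and two columns, so a relation inside one row or one column
  -- needs an auxiliary second one.
  have hex : ∀ i : Fin 4, (∃ k, i < k) ∨ ∃ k, k < i := by decide
  refine ⟨fun i j l h => ?_, fun i k j h => ?_, fun i j k l h h' => (key i j k l h h').2.2.2.2.1,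
    fun i j k l h h' => (key i j k l h h').2.2.2.2.2⟩
  · obtain ⟨k, hk⟩ | ⟨k, hk⟩ := hex i
    · exact (key i j k l hk h).1
    · exact (key k j i l hk h).2.2.1
  · obtain ⟨l, hl⟩ | ⟨l, hl⟩ := hex j
    · exact (key i j k l h hl).2.1
    · exact (key i l k j h hl).2.2.2.1

/-! ### Invertibility of the corner of a product -/

/-- Quasi-commutation gives `p u⁻¹ p = s u⁻¹ p² = 0`, so the geometric series for the inverse stops
after `u⁻¹ - u⁻¹ p u⁻¹`. -/
theorem isUnit_add_of_sq_zero {u p : B} (hu : IsUnit u) (hp : p * p = 0) {s : Cq}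
    (h : u * p = s • (p * u)) : IsUnit (u + p) := by
  obtain ⟨u, rfl⟩ := hu
  have h1 : p * ↑u⁻¹ = s • (↑u⁻¹ * p) := by
    have := congrArg (fun x => (↑u⁻¹ : B) * x * (↑u⁻¹ : B)) h
    simpa [mul_assoc] using this
  have h2 : p * ↑u⁻¹ * p = 0 := by rw [h1, smul_mul_assoc, mul_assoc, hp, mul_zero, smul_zero]
  have h3 : p * ↑u⁻¹ * (p * ↑u⁻¹) = 0 := by rw [← mul_assoc, h2, zero_mul]
  refine ⟨⟨u + p, ↑u⁻¹ - ↑u⁻¹ * p * ↑u⁻¹, ?_, ?_⟩, rfl⟩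
  · simp only [add_mul, mul_sub, mul_assoc, Units.mul_inv, Units.mul_inv_cancel_left]
    simp only [← mul_assoc] at h3 ⊢
    rw [h3]
    abel
  · have h2' : p * (↑u⁻¹ * p) = 0 := by rw [← mul_assoc, h2]
    simp only [mul_add, sub_mul, mul_assoc, Units.inv_mul, h2', mul_zero, mul_one]
    abel

/-- The corner of a product of supercommuting Manin matrices with invertible corners is
invertible. -/
theorem IsManin.isUnit_mul_corner {S : Matrix (Fin 5) (Fin 5) B} (hS : IsManin S)
    (hT : IsManin T) (h : SuperCommute T S) (hs : IsUnit (S 4 4)) (ht : IsUnit (T 4 4)) :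
    IsUnit ((S * T) 4 4) := by
  have hd : ∀ k : Fin 4, S 4 4 * T 4 4 * (S 4 k.castSucc * T k.castSucc 4) =
      (qpow (-1) * qpow (-1)) • (S 4 k.castSucc * T k.castSucc 4 * (S 4 4 * T 4 4)) := by
    intro k
    have e1 := h 4 4 4 k.castSucc
    have e2 := h k.castSucc 4 4 4
    simp only [par_four_four, zero_mul, mul_zero, pow_zero, one_smul] at e1 e2
    rw [mul_assoc, ← mul_assoc (T 4 4), e1, ← mul_assoc, ← mul_assoc, hS.corner_mul_row,
      mul_assoc _ (T 4 4), hT.corner_mul_col]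
    simp only [smul_mul_assoc, mul_smul_comm, smul_smul]
    simp only [mul_assoc]
    rw [← mul_assoc (T _ _) (S _ _), e2, mul_assoc]
  have hpp : ∀ k l : Fin 4, S 4 k.castSucc * T k.castSucc 4 * (S 4 l.castSucc * T l.castSucc 4) =
      -(S 4 k.castSucc * S 4 l.castSucc * (T k.castSucc 4 * T l.castSucc 4)) := by
    intro k l
    rw [mul_assoc, ← mul_assoc (T _ _), h, par_castSucc_four, par_four_castSucc]
    simp [mul_assoc]
  have hsq : ∀ k : Fin 4, S 4 k.castSucc * T k.castSucc 4 * (S 4 k.castSucc * T k.castSucc 4) = 0 :=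
    fun k => by rw [hpp, hS.row_sq, zero_mul, neg_zero]
  have hanti : ∀ k l : Fin 4, k < l →
      S 4 l.castSucc * T l.castSucc 4 * (S 4 k.castSucc * T k.castSucc 4) =
      (qpow (-1) * qpow (-1)) • (S 4 k.castSucc * T k.castSucc 4 *
        (S 4 l.castSucc * T l.castSucc 4)) := by
    intro k l hkl
    rw [hpp, hpp, hS.row _ _ _ (show k.castSucc < l.castSucc from hkl),
      hT.col _ _ _ (show k.castSucc < l.castSucc from hkl)]
    simp only [idx_castSucc, idx_four, eigenvalue_four, mul_zero, pow_zero, one_mul,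
      smul_mul_assoc, mul_smul_comm, smul_smul, smul_neg, neg_mul_neg, mul_one]
  rw [Matrix.mul_apply, sum_univ_castSucc, Fin.sum_univ_four, add_comm]
  obtain ⟨p, hp⟩ : ∃ p : Fin 4 → B, ∀ k : Fin 4, S 4 k.castSucc * T k.castSucc 4 = p k :=
    ⟨_, fun _ => rfl⟩
  simp only [hp] at *
  -- The square-zero terms are added in the order 3, 2, 1, 0: each then satisfies `u p = q⁻² p u`
  -- against the partial sum already known to be a unit.
  have hu := hs.mul ht
  have h3 := isUnit_add_of_sq_zero hu (hsq 3) (hd 3)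
  have h2 := isUnit_add_of_sq_zero h3 (hsq 2) (s := qpow (-1) * qpow (-1)) (by
    rw [add_mul, mul_add, hd, hanti _ _ (by decide), smul_add])
  have h1 := isUnit_add_of_sq_zero h2 (hsq 1) (s := qpow (-1) * qpow (-1)) (by
    rw [add_mul, add_mul, mul_add, mul_add, hd, hanti 1 2 (by decide),
      hanti 1 3 (by decide), smul_add, smul_add])
  have h0 := isUnit_add_of_sq_zero h1 (hsq 0) (s := qpow (-1) * qpow (-1)) (by
    rw [add_mul, add_mul, add_mul, mul_add, mul_add, mul_add, hd, hanti 0 1 (by decide),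
      hanti 0 2 (by decide), hanti 0 3 (by decide), smul_add, smul_add, smul_add])
  convert h0 using 1
  abel

end

end QuantumSuper


namespace QuantumSuper

/-! ### The quantum Berezinian -/

section Berezinian

variable {B C : Type*} [Ring B] [Algebra Cq B] [Ring C] [Algebra Cq C]

/-- The quantum Berezinian of a supermatrix `T`, where `e` is the inverse of its corner. -/
noncomputable def berezinian (T : Matrix (Fin 5) (Fin 5) B) (e : B) : B := qdet (schur T e) * e

theorem SuperCommute.symm {S T : Matrix (Fin 5) (Fin 5) B} (h : SuperCommute S T) :
    SuperCommute T S := by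
  intro i j k l
  rw [h k l i j, smul_smul, mul_comm (par k l), ← pow_add, ← two_mul, pow_mul, neg_one_sq, one_pow,
    one_smul]

theorem par_add_par (i j k : Fin 5) : (par i j + par j k) % 2 = par i k := by
  revert i j k; decide

theorem SuperCommute.mul_left {S Z T : Matrix (Fin 5) (Fin 5) B} (hS : SuperCommute S T)
    (hZ : SuperCommute Z T) : SuperCommute (S * Z) T := by
  intro i j k l
  rw [Matrix.mul_apply, Finset.sum_mul, Finset.mul_sum, Finset.smul_sum]
  refine Finset.sum_congr rfl fun m _ => ?_
  rw [mul_assoc, hZ, mul_smul_comm, ← mul_assoc, hS, smul_mul_assoc, smul_smul, mul_assoc,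
    ← pow_add, ← add_mul, pow_mul, neg_one_pow_eq_pow_mod_two (n := par m j + par i m), add_comm,
    par_add_par, ← pow_mul]

theorem IsExterior.prod_mul_eq_zero {x : Fin 4 → B} (hx : IsExterior x) (j : Fin 4) :
    x 0 * x 1 * x 2 * x 3 * x j = 0 := by
  have z := hx.sq
  have assoc : ∀ {u v r : B}, u * v = r → ∀ t, u * (v * t) = r * t := by
    intro u v r h t
    rw [← mul_assoc, h]
  have a10 := hx.anti 0 1 (by decide)
  have a20 := hx.anti 0 2 (by decide)
  have a21 := hx.anti 1 2 (by decide)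
  have a30 := hx.anti 0 3 (by decide)
  have a31 := hx.anti 1 3 (by decide)
  have a32 := hx.anti 2 3 (by decide)
  fin_cases j <;>
  simp [mul_assoc, z, a10, a20, a21, a30, a31, a32, assoc (z _), assoc a10, assoc a20,
    assoc a21, assoc a30, assoc a31, assoc a32]

theorem IsExterior.mul_prod_eq_zero {x : Fin 4 → B} (hx : IsExterior x) (j : Fin 4) :
    x j * (x 0 * x 1 * x 2 * x 3) = 0 := by
  have z := hx.sq
  have assoc : ∀ {u v r : B}, u * v = r → ∀ t, u * (v * t) = r * t := by
    intro u v r h t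
    rw [← mul_assoc, h]
  have a10 := hx.anti 0 1 (by decide)
  have a20 := hx.anti 0 2 (by decide)
  have a21 := hx.anti 1 2 (by decide)
  have a30 := hx.anti 0 3 (by decide)
  have a31 := hx.anti 1 3 (by decide)
  have a32 := hx.anti 2 3 (by decide)
  fin_cases j <;>
  simp [mul_assoc, z, a10, a20, a21, a30, a31, a32, assoc (z _), assoc a10, assoc a20,
    assoc a21, assoc a30, assoc a31, assoc a32]

/-! ### The volume element of the last column of a product -/

section Column

variable {T Z : Matrix (Fin 5) (Fin 5) B} {e v w : B}

theorem IsManin.isExterior_col (hZ : IsManin Z) : IsExterior (fun i : Fin 4 => Z i.castSucc 4) := by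
  refine ⟨hZ.col_sq, fun i j hij => ?_⟩
  rw [hZ.col _ _ _ (show i.castSucc < j.castSucc from hij), idx_castSucc, eigenvalue_four]
  simp

/-- The coordinates of the Schur complement of `T` applied to the last column of `Z`. -/
theorem schur_mul_col (h : e * T 4 4 = 1) (i : Fin 4) :
    ∑ j, schur T e i j * Z j.castSucc 4 =
      (T * Z) i.castSucc 4 - T i.castSucc 4 * e * (T * Z) 4 4 := by
  rw [Matrix.mul_apply, Matrix.mul_apply, sum_univ_castSucc, sum_univ_castSucc, mul_add,
    Finset.mul_sum, ← mul_assoc (T i.castSucc 4 * e), mul_assoc _ e, h, mul_one,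
    add_sub_add_right_eq_sub, ← Finset.sum_sub_distrib]
  refine Finset.sum_congr rfl fun j _ => ?_
  simp only [schur, Matrix.of_apply, sub_mul, mul_assoc]

/-- Both terms in the decomposition `schur_mul_col` satisfy this relation with the corner: the
column entry because `T Z` is Manin, and `T_i4 e` because it `q⁻¹`-commutes with the corner. -/
theorem IsManin.schur_col_mul_corner (hT : IsManin T) (hZ : IsManin Z) (h : SuperCommute Z T)
    (h1 : T 4 4 * e = 1) (h2 : e * T 4 4 = 1) (i : Fin 4) :
    (∑ j, QuantumSuper.schur T e i j * Z j.castSucc 4) * (T * Z) 4 4 =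
      qpow 1 • ((T * Z) 4 4 * ∑ j, QuantumSuper.schur T e i j * Z j.castSucc 4) := by
  have hY := hT.mul hZ h
  have hy : (T * Z) i.castSucc 4 * (T * Z) 4 4 =
      qpow 1 • ((T * Z) 4 4 * (T * Z) i.castSucc 4) := by
    rw [hY.corner_mul_col, smul_smul, qpow_one_mul_neg_one, one_smul]
  have hze : ∀ k, Z k 4 * e = e * Z k 4 := by
    intro k
    have := mul_inv_comm_of_comm (c := 1) (c' := 1) h1 h2 (one_mul 1)
      (x := Z k 4) (by rw [h k 4 4 4]; simp [par_four_four])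
    rw [this, one_smul]
  have hb : (T * Z) 4 4 * (T i.castSucc 4 * e) =
      qpow (-1) • (T i.castSucc 4 * e * (T * Z) 4 4) := by
    rw [Matrix.mul_apply, sum_univ_castSucc, add_mul, mul_add, smul_add, Finset.sum_mul,
      Finset.mul_sum, Finset.smul_sum]
    congr 1
    · refine Finset.sum_congr rfl fun j _ => ?_
      have hr : T 4 j.castSucc * e = qpow (-1) • (e * T 4 j.castSucc) := by
        rw [hT.inv_mul_row h1 h2, smul_smul, qpow_neg_mul, one_smul]
      have hzb := h j.castSucc 4 i.castSucc 4
      rw [par_castSucc_four, par_castSucc_four] at hzb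
      calc T 4 j.castSucc * Z j.castSucc 4 * (T i.castSucc 4 * e)
          = T 4 j.castSucc * (Z j.castSucc 4 * T i.castSucc 4) * e := by simp only [mul_assoc]
        _ = -(T 4 j.castSucc * T i.castSucc 4 * (Z j.castSucc 4 * e)) := by
          rw [hzb]; simp [mul_assoc]
        _ = T i.castSucc 4 * (T 4 j.castSucc * e) * Z j.castSucc 4 := by
          rw [hze, hT.row_mul_col]; simp [mul_assoc]
        _ = _ := by rw [hr]; simp [mul_assoc]
    · have hzb := h 4 4 i.castSucc 4
      rw [par_four_four, zero_mul, pow_zero, one_smul] at hzb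
      calc T 4 4 * Z 4 4 * (T i.castSucc 4 * e)
          = T 4 4 * (Z 4 4 * T i.castSucc 4) * e := by simp only [mul_assoc]
        _ = T 4 4 * T i.castSucc 4 * (Z 4 4 * e) := by rw [hzb]; simp only [mul_assoc]
        _ = qpow (-1) • (T i.castSucc 4 * (T 4 4 * e) * Z 4 4) := by
          rw [hze, hT.corner_mul_col]; simp only [smul_mul_assoc, mul_assoc]
        _ = _ := by rw [h1, ← h2]; simp only [mul_assoc]
  rw [schur_mul_col h2, sub_mul, mul_sub, smul_sub, hy, ← mul_assoc ((T * Z) 4 4), hb,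
    smul_mul_assoc, smul_smul, qpow_one_mul_neg_one, one_smul]

/-- The corner of `T Z` is `T_44 Z_44` plus terms containing some `Z_j4`, and the product of all
`Z_j4` annihilates these. On that product the corner therefore acts as if it were `T_44 Z_44`. -/
theorem IsManin.prod_col_mul_inv (hT : IsManin T) (hZ : IsManin Z) (h : SuperCommute Z T)
    (h1 : T 4 4 * e = 1) (h2 : e * T 4 4 = 1) (hv1 : Z 4 4 * v = 1) (hv2 : v * Z 4 4 = 1)
    (hw1 : (T * Z) 4 4 * w = 1) :
    Z 0 4 * Z 1 4 * Z 2 4 * Z 3 4 * w = e * (Z 0 4 * Z 1 4 * Z 2 4 * Z 3 4 * v) := by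
  obtain ⟨P, hP⟩ : ∃ P, Z 0 4 * Z 1 4 * Z 2 4 * Z 3 4 = P := ⟨_, rfl⟩
  have hext := hZ.isExterior_col
  have hPz : ∀ j : Fin 4, P * Z j.castSucc 4 = 0 := by
    intro j
    rw [← hP]
    exact hext.prod_mul_eq_zero j
  have hPT : ∀ k l, P * T k l = T k l * P := by
    intro k l
    have hz := fun i : Fin 5 => h i 4 k l
    have hs : ∀ i : Fin 5, i ≠ 4 → par i 4 = 1 := by decide
    have z0 := hz 0
    have z1 := hz 1
    have z2 := hz 2
    have z3 := hz 3
    rw [hs _ (by decide)] at z0 z1 z2 z3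
    rw [← hP, mul_assoc, z3, mul_smul_comm, ← mul_assoc, mul_assoc _ (Z 2 4), z2, mul_smul_comm,
      ← mul_assoc, mul_assoc _ (Z 1 4), z1, mul_smul_comm, ← mul_assoc, z0]
    simp only [smul_mul_assoc, smul_smul, mul_assoc, ← mul_pow]
    rcases par_cases k l with hp | hp <;> simp [hp]
  have hvz : ∀ j : Fin 4, v * Z j.castSucc 4 = qpow 1 • (Z j.castSucc 4 * v) :=
    fun j => hZ.inv_mul_col hv1 hv2 j
  have hvT : ∀ k l, v * T k l = T k l * v := by
    intro k l
    have := mul_inv_comm_of_comm (c := 1) (c' := 1) hv1 hv2 (one_mul 1)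
      (x := T k l) (by rw [h 4 4 k l]; simp [par_four_four])
    rw [this, one_smul]
  have key : e * (P * v) * (T * Z) 4 4 = P := by
    rw [Matrix.mul_apply, sum_univ_castSucc, mul_add, Finset.mul_sum, Finset.sum_eq_zero, zero_add]
    · rw [← mul_assoc, mul_assoc e, mul_assoc P, hvT, ← mul_assoc P, hPT, mul_assoc e, mul_assoc _ v,
        hv2, mul_one, ← mul_assoc, h2, one_mul]
    · intro j _
      rw [← mul_assoc, mul_assoc e, mul_assoc P, hvT, ← mul_assoc P, hPT, mul_assoc e, mul_assoc _ v,
        hvz, mul_smul_comm, mul_smul_comm, mul_assoc _ P, ← mul_assoc P, hPz, zero_mul, mul_zero,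
        mul_zero, smul_zero]
  rw [hP]
  nth_rw 1 [← key]
  rw [mul_assoc, hw1, mul_one]

/-- Expansion of the product of the coordinates of the last column of `T Z`. -/
theorem IsManin.prod_col_mul (hT : IsManin T) (hZ : IsManin Z) (h : SuperCommute Z T)
    (h1 : T 4 4 * e = 1) (h2 : e * T 4 4 = 1) (hv1 : Z 4 4 * v = 1) (hv2 : v * Z 4 4 = 1)
    (hw1 : (T * Z) 4 4 * w = 1) (hw2 : w * (T * Z) 4 4 = 1) {x y : Fin 4 → B}
    (hx : ∀ i, x i = ∑ j, QuantumSuper.schur T e i j * Z j.castSucc 4)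
    (hy : ∀ i, y i = (T * Z) i.castSucc 4) :
    y 0 * y 1 * y 2 * y 3 * w = berezinian T e * (Z 0 4 * Z 1 4 * Z 2 4 * Z 3 4 * v) +
      (y 0 * y 1 * y 2 * (T 3 4 * e) + (qpow (-1)) • (y 0 * y 1 * (T 2 4 * e) * x 3) +
        (qpow (-1)) ^ 2 • (y 0 * (T 1 4 * e) * (x 2 * x 3)) +
        (qpow (-1)) ^ 3 • (T 0 4 * e * (x 1 * x 2 * x 3))) := by
  have hwx : ∀ i, x i * w = qpow (-1) • (w * x i) := by
    intro i
    have hc := hT.schur_col_mul_corner hZ h h1 h2 i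
    rw [← hx] at hc
    have := mul_inv_comm_of_comm (c := qpow (-1)) (c' := qpow 1) hw1 hw2 qpow_one_mul_neg_one
      (x := x i) (by rw [hc, smul_smul, qpow_neg_mul, one_smul])
    rw [this, smul_smul, qpow_neg_mul, one_smul]
  -- Here `x i = y i - T_i4 e (T Z)_44`. Moving `w` leftwards through the product replaces each `y
  -- i` by `x i`, and each replacement leaves one term with `T_i4 e`, which is free of the variables
  -- of the column `Z`.
  have hyw : ∀ i, y i * w = qpow (-1) • (w * x i) + T i.castSucc 4 * e := by
    intro i
    rw [← hwx, hx, schur_mul_col h2, hy, sub_mul, mul_assoc _ _ w, hw1, mul_one, sub_add_cancel]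
  have hxy : ∀ i, y i * w = x i * w + T i.castSucc 4 * e := fun i => by rw [hyw, hwx]
  have e3 : T (3 : Fin 4).castSucc 4 = T 3 4 := rfl
  have e2 : T (2 : Fin 4).castSucc 4 = T 2 4 := rfl
  have e1 : T (1 : Fin 4).castSucc 4 = T 1 4 := rfl
  have e0 : T (0 : Fin 4).castSucc 4 = T 0 4 := rfl
  have hxe : x 0 * x 1 * x 2 * x 3 * w = berezinian T e * (Z 0 4 * Z 1 4 * Z 2 4 * Z 3 4 * v) := by
    have hze : ∀ k, Z k 4 * e = e * Z k 4 := by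
      intro k
      have := mul_inv_comm_of_comm (c := 1) (c' := 1) h1 h2 (one_mul 1)
        (x := Z k 4) (by rw [h k 4 4 4]; simp [par_four_four])
      rw [this, one_smul]
    have hprod := hZ.isExterior_col.prod_linear (M := QuantumSuper.schur T e) (fun i j k => by
      have a1 := h k.castSucc 4 i.castSucc j.castSucc
      have a2 := h k.castSucc 4 i.castSucc 4
      have a3 := h k.castSucc 4 4 j.castSucc
      simp only [par_castSucc, par_castSucc_four, par_four_castSucc, mul_zero, pow_zero, one_smul,
        mul_one, pow_one, neg_smul] at a1 a2 a3
      simp only [QuantumSuper.schur, Matrix.of_apply, mul_sub, sub_mul, a1]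
      congr 1
      rw [← mul_assoc, ← mul_assoc, a2, neg_mul, neg_mul, mul_assoc _ _ e, hze, ← mul_assoc,
        mul_assoc _ _ (T 4 _), a3, mul_neg, neg_neg]
      simp only [mul_assoc])
    rw [← hx, ← hx, ← hx, ← hx] at hprod
    rw [hprod, mul_assoc]
    change _ * (Z 0 4 * Z 1 4 * Z 2 4 * Z 3 4 * w) = _
    rw [hT.prod_col_mul_inv hZ h h1 h2 hv1 hv2 hw1, ← mul_assoc]
    rfl
  have t3 : y 0 * y 1 * y 2 * y 3 * w = qpow (-1) • (y 0 * y 1 * (y 2 * w) * x 3) +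
      y 0 * y 1 * y 2 * (T 3 4 * e) := by
    rw [mul_assoc _ (y 3), hyw, mul_add, e3]
    simp only [mul_smul_comm, mul_assoc]
  have t2 : y 0 * y 1 * (y 2 * w) * x 3 = qpow (-1) • (y 0 * (y 1 * w) * (x 2 * x 3)) +
      y 0 * y 1 * (T 2 4 * e) * x 3 := by
    rw [hyw, mul_add, e2, add_mul]
    simp only [mul_smul_comm, smul_mul_assoc, mul_assoc]
  have t1 : y 0 * (y 1 * w) * (x 2 * x 3) = qpow (-1) • (y 0 * w * (x 1 * x 2 * x 3)) +
      y 0 * (T 1 4 * e) * (x 2 * x 3) := by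
    rw [hyw, mul_add, e1, add_mul]
    simp only [mul_smul_comm, smul_mul_assoc, mul_assoc]
  have hx3 : qpow (-1) ^ 3 • (x 0 * w * (x 1 * x 2 * x 3)) = x 0 * x 1 * x 2 * x 3 * w := by
    symm
    calc x 0 * x 1 * x 2 * x 3 * w = x 0 * x 1 * x 2 * (x 3 * w) := mul_assoc _ _ _
      _ = qpow (-1) • (x 0 * x 1 * (x 2 * w) * x 3) := by
        rw [hwx 3]; simp only [mul_smul_comm, mul_assoc]
      _ = qpow (-1) ^ 2 • (x 0 * (x 1 * w) * (x 2 * x 3)) := by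
        rw [hwx 2, pow_two, mul_smul]; simp only [mul_smul_comm, smul_mul_assoc, mul_assoc]
      _ = _ := by
        rw [hwx 1, pow_succ _ 2, mul_smul]; simp only [mul_smul_comm, smul_mul_assoc, mul_assoc]
  rw [t3, t2, t1, hxy, add_mul, e0]
  simp only [smul_add, smul_smul]
  rw [← hxe, ← hx3]
  module

end Column

/-! ### Supermatrices acting on the model, and the two Berezinian identities -/

section Hat

/-- The parity operator of the model of the exterior algebra. -/
noncomputable def parityMat (B : Type*) [Ring B] [Algebra Cq B] :
    Matrix (Finset (Fin 4)) (Finset (Fin 4)) B := diagMat B fun K => (-1) ^ K.card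

theorem parityMat_sq : parityMat B * parityMat B = 1 := by
  rw [parityMat, diagMat_mul, ← diagMat_one]
  simp only [← mul_pow, neg_mul_neg, one_mul, one_pow]

theorem parityMat_mul_const (b : B) : parityMat B * const b = const b * parityMat B :=
  diagMat_mul_const _ b

theorem parityMat_pow_mul_const (n : ℕ) (b : B) :
    parityMat B ^ n * const b = const b * parityMat B ^ n :=
  (Commute.pow_left (parityMat_mul_const b) n).eq

theorem parityMat_pow_eq_of_mod {m n : ℕ} (h : m % 2 = n % 2) :
    parityMat B ^ m = parityMat B ^ n := by
  have e : ∀ m, parityMat B ^ m = parityMat B ^ (m % 2) := fun m => by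
    conv_lhs => rw [← Nat.div_add_mod m 2, pow_add, pow_mul, pow_two, parityMat_sq, one_pow,
      one_mul]
  rw [e m, e n, h]

theorem parityMat_mul_xiMat (j : Fin 4) :
    parityMat B * xiMat B j = (-1 : Cq) • (xiMat B j * parityMat B) :=
  diagMat_mul_xiMat fun J hJ => by rw [Finset.card_insert_of_notMem hJ, pow_succ']

/-- The entries of `T` as operators on the model, the odd ones twisted by the parity. -/
noncomputable def hat (T : Matrix (Fin 5) (Fin 5) B) :
    Matrix (Fin 5) (Fin 5) (Matrix (Finset (Fin 4)) (Finset (Fin 4)) B) :=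
  fun i j => const (T i j) * parityMat B ^ par i j

theorem hat_mul_hat_apply (S T : Matrix (Fin 5) (Fin 5) B) (i j k l : Fin 5) :
    hat S i j * hat T k l = const (S i j * T k l) * parityMat B ^ (par i j + par k l) := by
  unfold hat
  rw [mul_assoc, ← mul_assoc (parityMat B ^ _), parityMat_pow_mul_const, map_mul, pow_add]
  simp only [mul_assoc]

/-- The relations are homogeneous for the parity, so all monomials of one relation carry the same
power of the parity operator. -/
theorem IsManin.hat {T : Matrix (Fin 5) (Fin 5) B} (hT : IsManin T) : IsManin (hat T) := by
  refine ⟨fun i j h => ?_, fun i j l h => ?_, fun i k j h => ?_, fun i j k l h h' => ?_,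
    fun i j k l h h' => ?_⟩
  · rw [hat_mul_hat_apply, hT.sq i j h, map_zero, zero_mul]
  · rw [hat_mul_hat_apply, hat_mul_hat_apply, hT.row i j l h, map_smul, smul_mul_assoc, add_comm]
  · rw [hat_mul_hat_apply, hat_mul_hat_apply, hT.col i k j h, map_smul, smul_mul_assoc, add_comm]
  · rw [hat_mul_hat_apply, hat_mul_hat_apply, hT.comm i j k l h h', map_smul, smul_mul_assoc,
      add_comm]
  · have hp : (par k j + par i l) % 2 = (par i j + par k l) % 2 := by unfold par; omega
    rw [hat_mul_hat_apply, hat_mul_hat_apply, hat_mul_hat_apply, hT.cross i j k l h h',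
      parityMat_pow_eq_of_mod hp, map_add, map_smul, add_mul, smul_mul_assoc,
      add_comm (par k l)]

theorem hat_mul (S T : Matrix (Fin 5) (Fin 5) B) : hat (S * T) = hat S * hat T := by
  refine Matrix.ext fun i k => ?_
  rw [Matrix.mul_apply]
  simp only [hat_mul_hat_apply]
  rw [hat, Matrix.mul_apply, map_sum, Finset.sum_mul]
  refine Finset.sum_congr rfl fun j _ => ?_
  rw [parityMat_pow_eq_of_mod (m := par i j + par j k) (n := par i k)]
  rw [par_add_par, Nat.mod_eq_of_lt]
  rcases par_cases i k with h | h <;> omega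

theorem hat_one : hat (1 : Matrix (Fin 5) (Fin 5) B) = 1 := by
  refine Matrix.ext fun i j => ?_
  rw [hat, Matrix.one_apply, Matrix.one_apply]
  split_ifs with h
  · rw [h, par_self, pow_zero, mul_one, map_one]
  · rw [map_zero, zero_mul]

theorem hat_four_four (T : Matrix (Fin 5) (Fin 5) B) : hat T 4 4 = const (T 4 4) := by
  rw [hat, par_four_four, pow_zero, mul_one]

theorem schur_hat (T : Matrix (Fin 5) (Fin 5) B) (e : B) :
    schur (hat T) (const e) = (schur T e).map const := by
  refine Matrix.ext fun i j => ?_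
  simp only [schur, Matrix.of_apply, Matrix.map_apply, hat, par_castSucc, par_castSucc_four,
    par_four_castSucc, pow_zero, mul_one, pow_one, map_sub, map_mul]
  congr 1
  rw [mul_assoc (const _) (parityMat B), parityMat_mul_const, mul_assoc, mul_assoc, mul_assoc,
    ← mul_assoc (parityMat B), parityMat_mul_const, mul_assoc, parityMat_sq, mul_one, ← mul_assoc]

theorem berezinian_hat (T : Matrix (Fin 5) (Fin 5) B) (e : B) :
    berezinian (hat T) (const e) = const (berezinian T e) := by
  rw [berezinian, schur_hat, ← qdet_map, ← map_mul]
  rfl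

theorem SuperCommute.hat {S T : Matrix (Fin 5) (Fin 5) B} (h : SuperCommute S T) :
    SuperCommute (hat S) (hat T) := by
  intro i j k l
  rw [hat_mul_hat_apply, hat_mul_hat_apply, h, map_smul, smul_mul_assoc, add_comm]

theorem degreeLE_hat (T : Matrix (Fin 5) (Fin 5) B) (i j : Fin 5) : DegreeLE 0 (hat T i j) := by
  rcases par_cases i j with h | h
  · rw [hat, h, pow_zero, mul_one]
    exact degreeLE_const _
  · rw [hat, h, pow_one]
    exact (degreeLE_const _).mul (degreeLE_diagMat _)

/-- The supermatrix with last column `(ξ, η)` and all other columns zero. -/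
noncomputable def baseCol (B : Type*) [Ring B] [Algebra Cq B] :
    Matrix (Fin 5) (Fin 5) (Matrix (Finset (Fin 4)) (Finset (Fin 4)) B) :=
  fun i j => if j = 4 then (Fin.snoc (α := fun _ => Matrix (Finset (Fin 4)) (Finset (Fin 4)) B)
    (xiMat B) (diagMat B fun K => qpow (-K.card)) : Fin 5 → _) i else 0

theorem baseCol_castSucc (i : Fin 4) : baseCol B i.castSucc 4 = xiMat B i := by
  rw [baseCol, if_pos rfl]
  exact Fin.snoc_castSucc (α := fun _ => Matrix (Finset (Fin 4)) (Finset (Fin 4)) B) _ _ _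

theorem baseCol_four : baseCol B 4 4 = diagMat B fun K => qpow (-K.card) := by
  rw [baseCol, if_pos rfl]
  exact Fin.snoc_last (α := fun _ => Matrix (Finset (Fin 4)) (Finset (Fin 4)) B) _ _

theorem baseCol_ne {i j : Fin 5} (h : j ≠ 4) : baseCol B i j = 0 := if_neg h

theorem exists_castSucc_or (i : Fin 5) : (∃ k : Fin 4, i = k.castSucc) ∨ i = 4 := by
  revert i; decide

theorem ne_four_of_lt {j l : Fin 5} (h : j < l) : j ≠ 4 := by
  revert j l; decide

/-- Only the last column is nonzero, so the row and mixed relations are trivial. The exponent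
`-K.card` is chosen so that `η ξ_j = q⁻¹ ξ_j η`, the column relation with the corner. -/
theorem isManin_baseCol : IsManin (baseCol B) := by
  refine ⟨fun i j h => ?_, fun i j l h => ?_, fun i k j h => ?_, fun i j k l h h' => ?_,
    fun i j k l h h' => ?_⟩
  · by_cases hj : j = 4
    · subst hj
      obtain ⟨k, rfl⟩ | rfl := exists_castSucc_or i
      · rw [baseCol_castSucc]
        exact isExterior_xiMat.sq k
      · simp [par_four_four] at h
    · rw [baseCol_ne hj, mul_zero]
  · rw [baseCol_ne (ne_four_of_lt h), mul_zero, zero_mul, smul_zero]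
  · by_cases hj : j = 4
    · subst hj
      obtain ⟨i, rfl⟩ | rfl := exists_castSucc_or i
      · obtain ⟨k, rfl⟩ | rfl := exists_castSucc_or k
        · rw [baseCol_castSucc, baseCol_castSucc, isExterior_xiMat.anti i k h, idx_castSucc,
            eigenvalue_four]
          simp
        · rw [baseCol_castSucc, baseCol_four, diagMat_mul_xiMat (c := qpow (-1)), idx_four,
            eigenvalue_four]
          · simp
          · intro J hJ
            rw [Finset.card_insert_of_notMem hJ, qpow_mul]
            congr 1
            push_cast
            ring
      · exact absurd rfl (ne_four_of_lt h)
    · rw [baseCol_ne hj, mul_zero, zero_mul, smul_zero]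
  · rw [baseCol_ne (ne_four_of_lt h'), zero_mul, mul_zero, smul_zero]
  · rw [baseCol_ne (ne_four_of_lt h'), baseCol_ne (ne_four_of_lt h'), zero_mul, zero_mul, mul_zero,
      smul_zero, add_zero]

/-- The constants commute with `ξ_j`, and the parity operator anticommutes with it. This is the
purpose of the twist in `hat`. -/
theorem superCommute_baseCol (T : Matrix (Fin 5) (Fin 5) B) :
    SuperCommute (baseCol B) (hat T) := by
  intro i j k l
  by_cases hj : j = 4
  · subst hj
    obtain ⟨i, rfl⟩ | rfl := exists_castSucc_or i
    · rw [baseCol_castSucc, par_castSucc_four, one_mul, hat, ← mul_assoc, xiMat_mul_const,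
        mul_assoc, mul_assoc]
      rcases par_cases k l with h | h
      · simp [h]
      · rw [h, pow_one, pow_one, parityMat_mul_xiMat, mul_smul_comm, smul_smul]
        simp
    · rw [baseCol_four, par_four_four, zero_mul, pow_zero, one_smul, hat, ← mul_assoc,
        diagMat_mul_const, mul_assoc, mul_assoc]
      congr 1
      exact (Commute.pow_right (a := diagMat B _) (b := parityMat B) (diagMat_comm _ _) _).eq
  · rw [baseCol_ne hj, mul_zero, zero_mul, smul_zero]

/-- The inverse of the corner of `baseCol`. -/
noncomputable def baseColInv (B : Type*) [Ring B] [Algebra Cq B] :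
    Matrix (Finset (Fin 4)) (Finset (Fin 4)) B := diagMat B fun K => qpow K.card

theorem baseCol_four_mul_inv : baseCol B 4 4 * baseColInv B = 1 := by
  rw [baseCol_four, baseColInv, diagMat_mul, ← diagMat_one]
  simp [qpow_mul, qpow_zero]

theorem baseColInv_mul_four : baseColInv B * baseCol B 4 4 = 1 := by
  rw [baseCol_four, baseColInv, diagMat_mul, ← diagMat_one]
  simp [qpow_mul, qpow_zero]

theorem degreeLE_baseCol (i j : Fin 5) : DegreeLE 1 (baseCol B i j) := by
  by_cases hj : j = 4
  · subst hj
    obtain ⟨i, rfl⟩ | rfl := exists_castSucc_or i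
    · rw [baseCol_castSucc]
      exact degreeLE_xiMat i
    · rw [baseCol_four]
      exact (degreeLE_diagMat _).mono (by norm_num)
  · rw [baseCol_ne hj]
    intro K J _
    rfl

theorem degreeLE_hat_mul (T : Matrix (Fin 5) (Fin 5) B)
    {Z : Matrix (Fin 5) (Fin 5) (Matrix (Finset (Fin 4)) (Finset (Fin 4)) B)}
    (hZ : ∀ i j, DegreeLE 1 (Z i j)) (i j : Fin 5) : DegreeLE 1 ((hat T * Z) i j) := by
  rw [Matrix.mul_apply]
  exact DegreeLE.sum fun k _ => (zero_add 1) ▸ (degreeLE_hat T i k).mul (hZ k j)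

variable {T S R : Matrix (Fin 5) (Fin 5) B} {e e' e'' : B}

/-- The product of the coordinates of the last column of `hat T * Z` in top degree. -/
theorem IsManin.exists_prod_hat_col (hT : IsManin T) (h1 : T 4 4 * e = 1) (h2 : e * T 4 4 = 1)
    {Z : Matrix (Fin 5) (Fin 5) (Matrix (Finset (Fin 4)) (Finset (Fin 4)) B)}
    {v : Matrix (Finset (Fin 4)) (Finset (Fin 4)) B}
    (hZ : IsManin Z) (h : SuperCommute Z (QuantumSuper.hat T)) (hd : ∀ i j, DegreeLE 1 (Z i j))
    (hv1 : Z 4 4 * v = 1) (hv2 : v * Z 4 4 = 1) {Y} (hY : Y = QuantumSuper.hat T * Z) :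
    ∃ w L, Y 4 4 * w = 1 ∧ w * Y 4 4 = 1 ∧ DegreeLE 3 L ∧
      Y 0 4 * Y 1 4 * Y 2 4 * Y 3 4 * w =
        const (berezinian T e) * (Z 0 4 * Z 1 4 * Z 2 4 * Z 3 4 * v) + L := by
  subst hY
  have g1 : QuantumSuper.hat T 4 4 * const e = 1 := by
    rw [hat_four_four, ← map_mul, h1, map_one]
  have g2 : const e * QuantumSuper.hat T 4 4 = 1 := by
    rw [hat_four_four, ← map_mul, h2, map_one]
  obtain ⟨w, hw1, hw2⟩ := isUnit_iff_exists.1 <| hT.hat.isUnit_mul_corner hZ h ⟨⟨_, _, g1, g2⟩, rfl⟩ ⟨⟨_, _, hv1, hv2⟩, rfl⟩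
  have key := hT.hat.prod_col_mul hZ h g1 g2 hv1 hv2 hw1 hw2 (x := _) (y := _) (fun _ => rfl)
    (fun _ => rfl)
  rw [berezinian_hat] at key
  refine ⟨w, _, hw1, hw2, ?_, key⟩
  have hy : ∀ i, DegreeLE 1 ((QuantumSuper.hat T * Z) i 4) := fun i => degreeLE_hat_mul T hd i 4
  have hx : ∀ i, DegreeLE 1 (∑ j, QuantumSuper.schur (QuantumSuper.hat T) (const e) i j *
      Z j.castSucc 4) := fun i => DegreeLE.sum fun j _ => by
    rw [schur_hat, Matrix.map_apply]
    exact (zero_add 1) ▸ (degreeLE_const _).mul (hd _ _)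
  have hb : ∀ i, DegreeLE 0 (QuantumSuper.hat T i 4 * const e) := fun i =>
    (degreeLE_hat T i 4).mul (degreeLE_const e)
  -- Each remainder term has three factors of degree at most one and one factor of degree zero,
  -- hence never reaches the top degree 4.
  refine ((DegreeLE.add ?_ (DegreeLE.smul ?_ _)).add (DegreeLE.smul ?_ _)).add
    (DegreeLE.smul ?_ _)
  · exact (((hy _).mul (hy _)).mul (hy _)).mul (hb _)
  · exact (((hy _).mul (hy _)).mul (hb _)).mul (hx _)
  · exact ((hy _).mul (hb _)).mul ((hx _).mul (hx _))
  · exact ((hb _).mul (((hx _).mul (hx _)).mul (hx _))).mono (by norm_num)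

theorem topCoef_prod_baseCol :
    topCoef (baseCol B 0 4 * baseCol B 1 4 * baseCol B 2 4 * baseCol B 3 4 * baseColInv B) = 1 := by
  change topCoef (baseCol B (Fin.castSucc 0) 4 * baseCol B (Fin.castSucc 1) 4 *
    baseCol B (Fin.castSucc 2) 4 * baseCol B (Fin.castSucc 3) 4 * baseColInv B) = 1
  simp only [baseCol_castSucc]
  rw [baseColInv, topCoef_mul_diagMat, topCoef_xiMat, Finset.card_empty, Nat.cast_zero, qpow_zero,
    one_smul]

/-- The quantum Berezinian is multiplicative for supercommuting Manin matrices. -/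
theorem IsManin.berezinian_mul (hT : IsManin T) (hS : IsManin S) (h : SuperCommute S T)
    (h1 : T 4 4 * e = 1) (h2 : e * T 4 4 = 1) (h1' : S 4 4 * e' = 1) (h2' : e' * S 4 4 = 1)
    (h1'' : (T * S) 4 4 * e'' = 1) (h2'' : e'' * (T * S) 4 4 = 1) :
    berezinian (T * S) e'' = berezinian T e * berezinian S e' := by
  have hZ := isManin_baseCol (B := B)
  have hSZ : SuperCommute (QuantumSuper.hat S * baseCol B) (QuantumSuper.hat T) :=
    h.hat.mul_left (superCommute_baseCol T)
  -- The volume element of `T S (ξ, η)` is computed in two ways: with `T S` acting at once, and with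
  -- `T` acting on the column `S (ξ, η)`.
  obtain ⟨w, L, hw1, hw2, hL, e1⟩ := (hT.mul hS h).exists_prod_hat_col h1'' h2'' hZ
    (superCommute_baseCol _) degreeLE_baseCol baseCol_four_mul_inv baseColInv_mul_four rfl
  obtain ⟨v, L', hv1, hv2, hL', e2⟩ := hS.exists_prod_hat_col h1' h2' hZ
    (superCommute_baseCol _) degreeLE_baseCol baseCol_four_mul_inv baseColInv_mul_four rfl
  obtain ⟨w', L'', hw1', hw2', hL'', e3⟩ := hT.exists_prod_hat_col h1 h2
    (hS.hat.mul hZ (superCommute_baseCol S)) hSZ (degreeLE_hat_mul S degreeLE_baseCol) hv1 hv2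
    (Y := QuantumSuper.hat (T * S) * baseCol B) (by rw [hat_mul, Matrix.mul_assoc])
  rw [← left_inv_eq_right_inv hw2 hw1', e1, e2] at e3
  have h3 := congrArg topCoef e3
  rw [map_add, map_add, topCoef_const_mul, topCoef_const_mul, map_add, topCoef_const_mul,
    topCoef_prod_baseCol, hL.topCoef, hL'.topCoef, hL''.topCoef] at h3
  simpa using h3

/-- The contribution `t i` of `η` to the coordinate `y i` has degree zero. So the top degree sees
only the linear forms `u i` in the `ξ_j`, with the even block as coefficients. -/
theorem topCoef_prod_hat_col (T : Matrix (Fin 5) (Fin 5) B) {y : Fin 4 → _}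
    (hy : ∀ i, y i = (QuantumSuper.hat T * baseCol B) i.castSucc 4) :
    topCoef (y 0 * y 1 * y 2 * y 3) = qdet (QuantumSuper.evenBlock T) := by
  obtain ⟨u, hu⟩ : ∃ u : Fin 4 → Matrix (Finset (Fin 4)) (Finset (Fin 4)) B, ∀ i,
      ∑ j, ((QuantumSuper.evenBlock T).map const) i j * xiMat B j = u i := ⟨_, fun _ => rfl⟩
  obtain ⟨t, ht⟩ : ∃ t : Fin 4 → Matrix (Finset (Fin 4)) (Finset (Fin 4)) B, ∀ i,
      QuantumSuper.hat T i.castSucc 4 * baseCol B 4 4 = t i := ⟨_, fun _ => rfl⟩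
  have hprod := isExterior_xiMat.prod_linear (M := (QuantumSuper.evenBlock T).map const)
    (fun i j k => xiMat_mul_const k _)
  rw [hu, hu, hu, hu] at hprod
  have hyu : ∀ i, y i = u i + t i := by
    intro i
    rw [hy, Matrix.mul_apply, sum_univ_castSucc, ht, ← hu]
    congr 1
    refine Finset.sum_congr rfl fun j _ => ?_
    rw [baseCol_castSucc, QuantumSuper.hat, par_castSucc, pow_zero, mul_one]
    rfl
  have du : ∀ i, DegreeLE 1 (u i) := fun i => by
    rw [← hu]
    exact DegreeLE.sum fun j _ => (zero_add 1) ▸ (degreeLE_const _).mul (degreeLE_xiMat _)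
  have dt : ∀ i, DegreeLE 0 (t i) := fun i => by
    rw [← ht, baseCol_four]
    exact (degreeLE_hat T _ _).mul (degreeLE_diagMat _)
  have dy : ∀ i, DegreeLE 1 (y i) := fun i => by
    rw [hyu]
    exact (du i).add ((dt i).mono (by norm_num))
  have hexp : y 0 * y 1 * y 2 * y 3 = u 0 * u 1 * u 2 * u 3 + (t 0 * u 1 * u 2 * u 3 +
      y 0 * t 1 * u 2 * u 3 + y 0 * y 1 * t 2 * u 3 + y 0 * y 1 * y 2 * t 3) := by
    have a0 := hyu 0
    rw [hyu 3, hyu 2, hyu 1, a0]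
    noncomm_ring
  rw [hexp, map_add, DegreeLE.topCoef (M := _ + _), add_zero, hprod, ← qdet_map, topCoef_const_mul,
    topCoef_xiMat, mul_one]
  refine ((DegreeLE.add ?_ ?_).add ?_).add ?_
  · exact (((dt _).mul (du _)).mul (du _)).mul (du _)
  · exact (((dy _).mul (dt _)).mul (du _)).mul (du _)
  · exact (((dy _).mul (dy _)).mul (dt _)).mul (du _)
  · exact (((dy _).mul (dy _)).mul (dy _)).mul (dt _)

/-- The corner of the inverse matrix times the quantum determinant of the even block is the
quantum Berezinian. -/
theorem IsManin.inverse_corner_mul_qdet (hT : IsManin T) (h1 : T 4 4 * e = 1)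
    (h2 : e * T 4 4 = 1) (hR : R * T = 1) :
    R 4 4 * qdet (QuantumSuper.evenBlock T) = berezinian T e := by
  have hZ := isManin_baseCol (B := B)
  obtain ⟨w, L, hw1, hw2, hL, e1⟩ := hT.exists_prod_hat_col h1 h2 hZ
    (superCommute_baseCol _) degreeLE_baseCol baseCol_four_mul_inv baseColInv_mul_four rfl
  have htop := topCoef_prod_hat_col T (y := _) (fun _ => rfl)
  have hY := hT.hat.mul hZ (superCommute_baseCol T)
  have hRY : QuantumSuper.hat R * (QuantumSuper.hat T * baseCol B) = baseCol B := by
    rw [← Matrix.mul_assoc, ← hat_mul, hR, hat_one, Matrix.one_mul]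
  obtain ⟨Y, hY0⟩ : ∃ Y, QuantumSuper.hat T * baseCol B = Y := ⟨_, rfl⟩
  rw [hY0] at hw1 hw2 e1 htop hY hRY
  change topCoef (Y 0 4 * Y 1 4 * Y 2 4 * Y 3 4) = _ at htop
  obtain ⟨P, hP⟩ : ∃ P, Y 0 4 * Y 1 4 * Y 2 4 * Y 3 4 = P := ⟨_, rfl⟩
  have hPz : ∀ j : Fin 4, Y j.castSucc 4 * P = 0 := by
    intro j
    rw [← hP]
    exact hY.isExterior_col.mul_prod_eq_zero j
  have hYP : Y 4 4 * P = qpow (-4) • (P * Y 4 4) := by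
    have hc := fun i : Fin 4 => hY.corner_mul_col i
    have e : P = Y (Fin.castSucc 0) 4 * Y (Fin.castSucc 1) 4 * Y (Fin.castSucc 2) 4 *
      Y (Fin.castSucc 3) 4 := hP.symm
    have hc' : ∀ (i : Fin 4) x, Y 4 4 * (Y i.castSucc 4 * x) =
        qpow (-1) • (Y i.castSucc 4 * (Y 4 4 * x)) := fun i x => by
      rw [← mul_assoc, hc, smul_mul_assoc, mul_assoc]
    have hq : qpow (-4) = qpow (-1) * (qpow (-1) * (qpow (-1) * qpow (-1))) := by
      simp only [qpow_mul]; norm_num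
    rw [e, hq]
    simp only [mul_assoc, hc, hc', mul_smul_comm, smul_smul]
  -- The last row of `R Y = (ξ, η)` gives `η = ∑ R_4k Y_k`. Multiplying by `P` on the right kills
  -- every term but the corner. The `q⁻⁴` for moving `Y 4 4` past the four factors of `P` cancels
  -- below against the eigenvalue of `η` on the top monomial.
  have hη : baseCol B 4 4 * P = qpow (-4) • (QuantumSuper.hat R 4 4 * (P * Y 4 4)) := by
    rw [← hRY, Matrix.mul_apply, sum_univ_castSucc, add_mul, Finset.sum_mul,
      Finset.sum_eq_zero (fun j _ => by rw [mul_assoc, hPz, mul_zero]), zero_add, mul_assoc, hYP,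
      mul_smul_comm]
  have h3 := congrArg (fun x => topCoef (x * w)) hη
  simp only [smul_mul_assoc, mul_assoc, hw1, mul_one] at h3
  rw [← hP, e1, hP, hat_four_four, topCoef_smul, topCoef_const_mul, ← hP, htop, baseCol_four,
    topCoef_diagMat_mul, map_add, topCoef_const_mul, topCoef_prod_baseCol, hL.topCoef, add_zero,
    mul_one] at h3
  have h4 := congrArg (qpow 4 • ·) h3
  simp only [smul_smul, qpow_mul] at h4
  simpa [qpow_zero] using h4.symm

end Hat

end Berezinian

end QuantumSuper


namespace QuantumSuper

/-! ### The universal property of `O(SL_q(4|1))` -/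

theorem eq_smul_comm {M : Type*} [AddCommGroup M] [Module Cq M] {c c' : Cq} (h : c * c' = 1)
    {x y : M} : x = c • y ↔ y = c' • x := by
  constructor
  · rintro rfl
    rw [smul_smul, mul_comm, h, one_smul]
  · rintro rfl
    rw [smul_smul, h, one_smul]

/-- `IsManin` solves the row relation of `GLRel` for the other product, so the coefficients must be
mutually inverse. For `i = 4` the two signs multiply to `-1`, which matches the eigenvalue `-q⁻¹`.
-/
theorem row_coef (i j l : Fin 5) (h : j < l) :
    ((-1 : Cq) ^ (par i j * par i l) * qpow ((-1) ^ (idx i + 1))) *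
      ((-1 : Cq) ^ (idx i * idx l) * eigenvalue i) = 1 := by
  have hj : ∀ i j l : Fin 5, j < l → (i ≠ 4 ∧ par i j * par i l = 0 ∧ idx i = 0) ∨
      (i = 4 ∧ (par i j * par i l + idx l) % 2 = 1 ∧ idx i = 1) := by decide
  obtain ⟨h1, h2, h3⟩ | ⟨rfl, h2, h3⟩ := hj i j l h
  · simp [h2, h3, eigenvalue, h1, qpow_mul, qpow_zero]
  · rw [eigenvalue_four, h3, one_mul]
    have : (-1 : Cq) ^ (par 4 j * par 4 l) * (-1) ^ (idx l) = -1 := by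
      rw [← pow_add, neg_one_pow_eq_pow_mod_two, h2, pow_one]
    have hq : qpow 1 * qpow (-1) = 1 := qpow_one_mul_neg_one
    have h4 : ((-1 : ℤ) ^ (1 + 1)) = 1 := by norm_num
    rw [h4]
    linear_combination (-(qpow 1 * qpow (-1))) * this + hq

theorem col_coef (i k j : Fin 5) (h : i < k) :
    ((-1 : Cq) ^ (par i j * par k j) * qpow ((-1) ^ (idx j + 1))) *
      ((-1 : Cq) ^ (idx j * idx k) * eigenvalue j) = 1 := by
  have hp : ∀ i j, par i j = par j i := by decide
  rw [hp i j, hp k j, row_coef j i k h]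

theorem comm_coef (i j k l : Fin 5) (h : i < k) (h' : j < l) :
    (-1 : Cq) ^ (par k j * par i l) = (-1) ^ (idx k * idx l) := by
  have hd : ∀ i j k l : Fin 5, i < k → j < l → par k j * par i l = idx k * idx l := by decide
  rw [hd i j k l h h']

theorem par_of_lt (i j k l : Fin 5) (h : i < k) (h' : j < l) : par i j = 0 := by
  revert i j k l; decide

section

variable {B C : Type*} [Ring B] [Algebra Cq B] [Ring C] [Algebra Cq C]

/-- The matrix relations of `O(GL_q(4|1))`, in the form in which they are stated there. -/
theorem isManin_iff (T : Matrix (Fin 5) (Fin 5) B) : IsManin T ↔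
    (∀ i j, par i j = 1 → T i j * T i j = 0) ∧
    (∀ i j l, j < l → T i j * T i l =
      ((-1 : Cq) ^ (par i j * par i l) * qpow ((-1) ^ (idx i + 1))) • (T i l * T i j)) ∧
    (∀ i k j, i < k → T i j * T k j =
      ((-1 : Cq) ^ (par i j * par k j) * qpow ((-1) ^ (idx j + 1))) • (T k j * T i j)) ∧
    (∀ i j k l, (i < k ∧ l < j ∨ k < i ∧ j < l) → T i j * T k l =
      (-1 : Cq) ^ (par i j * par k l) • (T k l * T i j)) ∧
    (∀ i j k l, i < k ∧ j < l → T i j * T k l =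
      (-1 : Cq) ^ (par i j * par k l) • (T k l * T i j) +
        ((-1 : Cq) ^ (par i j * par k j) * (qpow (-1) - qpow 1)) • (T k j * T i l)) := by
  have hs : ∀ m : ℕ, (-1 : Cq) ^ m * (-1) ^ m = 1 := fun m => by
    rw [← mul_pow, neg_mul_neg, one_mul, one_pow]
  constructor
  · intro hT
    refine ⟨hT.sq, fun i j l h => (eq_smul_comm (row_coef i j l h)).2 (hT.row i j l h),
      fun i k j h => (eq_smul_comm (col_coef i k j h)).2 (hT.col i k j h), ?_, ?_⟩
    · rintro i j k l (⟨h, h'⟩ | ⟨h, h'⟩)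
      · rw [mul_comm (par i j), comm_coef i l k j h h', eq_smul_comm (hs _)]
        exact hT.comm i l k j h h'
      · rw [comm_coef k j i l h h']
        exact hT.comm k j i l h h'
    · rintro i j k l ⟨h, h'⟩
      rw [par_of_lt i j k l h h', zero_mul, zero_mul, pow_zero, one_smul, one_mul]
      exact hT.cross i j k l h h'
  · rintro ⟨h1, h2, h3, h4, h5⟩
    refine ⟨h1, fun i j l h => (eq_smul_comm (row_coef i j l h)).1 (h2 i j l h),
      fun i k j h => (eq_smul_comm (col_coef i k j h)).1 (h3 i k j h), ?_, ?_⟩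
    · intro i j k l h h'
      rw [h4 k j i l (Or.inr ⟨h, h'⟩), comm_coef i j k l h h']
    · intro i j k l h h'
      have := h5 i j k l ⟨h, h'⟩
      rwa [par_of_lt i j k l h h', zero_mul, zero_mul, pow_zero, one_smul, one_mul] at this

theorem IsManin.map {T : Matrix (Fin 5) (Fin 5) B} (hT : IsManin T) (f : B →ₐ[Cq] C) :
    IsManin (T.map f) := by
  refine ⟨fun i j h => ?_, fun i j l h => ?_, fun i k j h => ?_, fun i j k l h h' => ?_,
    fun i j k l h h' => ?_⟩ <;> simp only [Matrix.map_apply, ← map_mul, ← map_smul, ← map_add]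
  · rw [hT.sq i j h, map_zero]
  · rw [hT.row i j l h]
  · rw [hT.col i k j h]
  · rw [hT.comm i j k l h h']
  · rw [hT.cross i j k l h h']

theorem berezinian_map (T : Matrix (Fin 5) (Fin 5) B) (e : B) (f : B →ₐ[Cq] C) :
    f (berezinian T e) = berezinian (T.map f) (f e) := by
  unfold berezinian
  rw [map_mul, qdet_map]
  congr 2
  refine Matrix.ext fun i j => ?_
  simp only [schur, Matrix.of_apply, Matrix.map_apply, map_sub, map_mul]

end

/-- The matrix of generators of `O(SL_q(4|1))`. -/
noncomputable def genMat : Matrix (Fin 5) (Fin 5) OSL := Matrix.of a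

/-- The inverse of the quantum determinant of the even block. -/
noncomputable def detInv : OSL := Ideal.Quotient.mk berIdeal (glGen .D₁inv)

/-- The projection of the free algebra onto `O(SL_q(4|1))`. -/
noncomputable def slMk : FreeGL →ₐ[Cq] OSL := (Ideal.Quotient.mkₐ Cq berIdeal).comp glMk

theorem slMk_rel {x y : FreeGL} (h : GLRel x y) : slMk x = slMk y :=
  congrArg (Ideal.Quotient.mkₐ Cq berIdeal) (glMk_rel h)

theorem slMk_fa (i j : Fin 5) : slMk (fa i j) = genMat i j := rfl

theorem isManin_genMat : IsManin genMat := by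
  rw [isManin_iff]
  simp only [← slMk_fa, ← map_mul, ← map_smul, ← map_add]
  exact ⟨fun i j h => (slMk_rel (.sq i j h)).trans (map_zero _),
    fun i j l h => slMk_rel (.row i j l h), fun i k j h => slMk_rel (.col i k j h),
    fun i j k l h => slMk_rel (.comm i j k l h), fun i j k l h => slMk_rel (.cross i j k l h)⟩

theorem slMk_fD₁ : slMk fD₁ = qdet (evenBlock genMat) := by
  rw [fD₁, qdet_map]
  rfl

theorem qdet_mul_detInv : qdet (evenBlock genMat) * detInv = 1 := by
  rw [← slMk_fD₁]
  exact (map_mul slMk _ _).symm.trans ((slMk_rel .D₁_mul).trans (map_one _))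

theorem detInv_mul_qdet : detInv * qdet (evenBlock genMat) = 1 := by
  rw [← slMk_fD₁]
  exact (map_mul slMk _ _).symm.trans ((slMk_rel .mul_D₁).trans (map_one _))

theorem corner_mul_a55inv : genMat 4 4 * a55inv = 1 :=
  (map_mul slMk _ _).symm.trans ((slMk_rel .D₂_mul).trans (map_one _))

theorem a55inv_mul_corner : a55inv * genMat 4 4 = 1 :=
  (map_mul slMk _ _).symm.trans ((slMk_rel .mul_D₂).trans (map_one _))

theorem berezinian_genMat : berezinian genMat a55inv = 1 := by
  have h : Ideal.Quotient.mkₐ Cq berIdeal ber = 1 := by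
    rw [← map_one (Ideal.Quotient.mkₐ Cq berIdeal)]
    refine Ideal.Quotient.eq.2 ?_
    rw [TwoSidedIdeal.mem_asIdeal]
    exact TwoSidedIdeal.subset_span rfl
  refine Eq.trans ?_ h
  unfold ber
  rw [map_mul, qdet_map]
  rfl

/-! ### Homomorphisms out of `O(SL_q(4|1))` -/

section Lift

variable {B : Type*} [Ring B] [Algebra Cq B]

/-- The universal property of `O(SL_q(4|1))`. -/
theorem exists_slLift {T : Matrix (Fin 5) (Fin 5) B} (hT : IsManin T) {e : B}
    (h1 : T 4 4 * e = 1) (h2 : e * T 4 4 = 1) (hd : IsUnit (qdet (evenBlock T)))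
    (hb : berezinian T e = 1) : ∃ f : OSL →ₐ[Cq] B, ∀ i j, f (a i j) = T i j := by
  obtain ⟨u, hu⟩ := hd
  let F : FreeGL →ₐ[Cq] B := FreeAlgebra.lift Cq fun
    | .a i j => T i j
    | .D₁inv => ↑u⁻¹
    | .D₂inv => e
  have Fa : ∀ i j, F (fa i j) = T i j := fun i j => FreeAlgebra.lift_ι_apply _ _
  have F1 : F (FreeAlgebra.ι Cq .D₁inv) = ↑u⁻¹ := FreeAlgebra.lift_ι_apply _ _
  have F2 : F (FreeAlgebra.ι Cq .D₂inv) = e := FreeAlgebra.lift_ι_apply _ _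
  have FD : F fD₁ = u := by
    rw [hu, fD₁, qdet_map]
    congr 1
    exact Matrix.ext fun i j => Fa _ _
  obtain ⟨r1, r2, r3, r4, r5⟩ := (isManin_iff T).1 hT
  have hF : ∀ ⦃x y⦄, GLRel x y → F x = F y := by
    intro x y h
    cases h with
    | sq i j h => rw [map_mul, Fa, r1 i j h, map_zero]
    | row i j l h => rw [map_mul, map_smul, map_mul, Fa, Fa, r2 i j l h]
    | col i k j h => rw [map_mul, map_smul, map_mul, Fa, Fa, r3 i k j h]
    | comm i j k l h => rw [map_mul, map_smul, map_mul, Fa, Fa, r4 i j k l h]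
    | cross i j k l h =>
      rw [map_add, map_mul, map_smul, map_smul, map_mul, map_mul, Fa, Fa, Fa, Fa, r5 i j k l h]
    | D₁_mul => rw [map_mul, FD, F1, Units.mul_inv, map_one]
    | mul_D₁ => rw [map_mul, FD, F1, Units.inv_mul, map_one]
    | D₂_mul => rw [map_mul, Fa, F2, h1, map_one]
    | mul_D₂ => rw [map_mul, Fa, F2, h2, map_one]
  let G := glLift F hF
  have Gg : ∀ x, G (glGen x) = F (FreeAlgebra.ι Cq x) := fun x => glLift_glMk F hF _
  have Gb : G ber = 1 := by
    rw [ber, map_mul, qdet_map, Gg, F2, ← hb, berezinian]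
    congr 2
    refine Matrix.ext fun i j => ?_
    simp only [schur, Matrix.of_apply, Matrix.map_apply, map_sub, map_mul, Gg, F2]
    exact congrArg₂ _ (Fa _ _) (congrArg₂ _ (congrArg (· * e) (Fa _ _)) (Fa _ _))
  have hG : ∀ x ∈ berIdeal, G x = 0 := by
    intro x hx
    rw [TwoSidedIdeal.mem_asIdeal] at hx
    have hle : TwoSidedIdeal.span {ber - 1} ≤ TwoSidedIdeal.ker G := by
      rw [TwoSidedIdeal.span_le]
      rintro _ rfl
      rw [SetLike.mem_coe, TwoSidedIdeal.mem_ker, map_sub, Gb, map_one, sub_self]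
    exact (TwoSidedIdeal.mem_ker G).1 (hle hx)
  exact ⟨Ideal.Quotient.liftₐ berIdeal G hG, fun i j => (Gg (.a i j)).trans (Fa i j)⟩

/-- A subalgebra of `O(SL_q(4|1))` that contains the generators `a_ij` and is closed under
two-sided inverses is everything. -/
theorem eq_top_of_inverse_closed (S : Subalgebra Cq OSL) (ha : ∀ i j, a i j ∈ S)
    (hinv : ∀ x y, x ∈ S → x * y = 1 → y * x = 1 → y ∈ S) : S = ⊤ := by
  have hdet : qdet (evenBlock genMat) ∈ S := by
    unfold qdet
    refine sum_mem fun σ _ => S.smul_mem (list_prod_mem fun x hx => ?_) _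
    obtain ⟨i, rfl⟩ := (List.mem_ofFn' _ _).1 hx
    exact ha _ _
  have hle : (⊤ : Subalgebra Cq OGL) ≤ S.comap (Ideal.Quotient.mkₐ Cq berIdeal) := by
    rw [← adjoin_glGen, Algebra.adjoin_le_iff]
    rintro _ ⟨x, rfl⟩
    cases x with
    | a i j => exact ha i j
    | D₁inv => exact hinv _ _ hdet qdet_mul_detInv detInv_mul_qdet
    | D₂inv => exact hinv _ _ (ha 4 4) corner_mul_a55inv a55inv_mul_corner
  rw [eq_top_iff]
  intro x _
  obtain ⟨x, rfl⟩ := Ideal.Quotient.mk_surjective x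
  exact hle (Algebra.mem_top : x ∈ (⊤ : Subalgebra Cq OGL))

theorem slHom_ext {B : Type*} [Semiring B] [Algebra Cq B] {f g : OSL →ₐ[Cq] B}
    (h : ∀ i j, f (a i j) = g (a i j)) : f = g := by
  have := eq_top_of_inverse_closed (AlgHom.equalizer f g) h (by
    intro x y hx h1 h2
    have hx' : f x = g x := hx
    change f y = g y
    have e1 : f y * f x = 1 := by rw [← map_mul, h2, map_one]
    have e2 : f x * g y = 1 := by rw [hx', ← map_mul, h1, map_one]
    exact left_inv_eq_right_inv e1 e2)
  ext x
  have hx : x ∈ AlgHom.equalizer f g := by rw [this]; trivial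
  exact hx

end Lift

end QuantumSuper


namespace QuantumSuper

/-! ### The inverse of the matrix of generators -/

section Inverse

variable {B : Type*} [Ring B] [Algebra Cq B] {T R : Matrix (Fin 5) (Fin 5) B} {e g : B}

/-- The block inversion formula relative to the invertible corner. -/
theorem exists_inverse_of_schur (h1 : T 4 4 * e = 1) (h2 : e * T 4 4 = 1)
    {Y : Matrix (Fin 4) (Fin 4) B} (hY1 : schur T e * Y = 1) (hY2 : Y * schur T e = 1) :
    ∃ R, T * R = 1 ∧ R * T = 1 := by
  let E : Fin 4 ⊕ Fin 1 ≃ Fin 5 := finSumFinEquiv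
  let b : Matrix (Fin 4) (Fin 1) B := Matrix.of fun i _ => T i.castSucc 4
  let c : Matrix (Fin 1) (Fin 4) B := Matrix.of fun _ j => T 4 j.castSucc
  let d : Matrix (Fin 1) (Fin 1) B := Matrix.of fun _ _ => T 4 4
  let f : Matrix (Fin 1) (Fin 1) B := Matrix.of fun _ _ => e
  have hdf : d * f = 1 := by
    refine Matrix.ext fun i j => ?_
    rw [Matrix.mul_apply, Fin.sum_univ_one, Subsingleton.elim j i, Matrix.one_apply_eq]
    exact h1
  have hfd : f * d = 1 := by
    refine Matrix.ext fun i j => ?_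
    rw [Matrix.mul_apply, Fin.sum_univ_one, Subsingleton.elim j i, Matrix.one_apply_eq]
    exact h2
  have hX : schur T e = evenBlock T - b * (f * c) := by
    refine Matrix.ext fun i j => ?_
    rw [Matrix.sub_apply, Matrix.mul_apply, Fin.sum_univ_one, Matrix.mul_apply, Fin.sum_univ_one]
    change _ - T i.castSucc 4 * e * T 4 j.castSucc = _ - T i.castSucc 4 * (e * T 4 j.castSucc)
    rw [mul_assoc]
    rfl
  have hT : T = (Matrix.fromBlocks (evenBlock T) b c d).submatrix E.symm E.symm := by
    refine Matrix.ext fun i j => ?_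
    obtain ⟨i, rfl⟩ := E.surjective i
    obtain ⟨j, rfl⟩ := E.surjective j
    rw [Matrix.submatrix_apply, Equiv.symm_apply_apply, Equiv.symm_apply_apply]
    obtain i | i := i <;> obtain j | j := j <;> try rw [Subsingleton.elim i 0]
    all_goals try rw [Subsingleton.elim j 0]
    all_goals rfl
  have hA : evenBlock T = schur T e + b * (f * c) := by rw [hX, sub_add_cancel]
  let N : Matrix (Fin 4 ⊕ Fin 1) (Fin 4 ⊕ Fin 1) B :=
    Matrix.fromBlocks Y (-(Y * (b * f))) (-(f * (c * Y))) (f + f * (c * (Y * (b * f))))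
  have r1 : ∀ {n : Type} (M : Matrix (Fin 4) n B), schur T e * (Y * M) = M := fun M => by
    rw [← Matrix.mul_assoc, hY1, Matrix.one_mul]
  have r2 : ∀ {n : Type} (M : Matrix (Fin 4) n B), Y * (schur T e * M) = M := fun M => by
    rw [← Matrix.mul_assoc, hY2, Matrix.one_mul]
  have r3 : ∀ {n : Type} (M : Matrix (Fin 1) n B), d * (f * M) = M := fun M => by
    rw [← Matrix.mul_assoc, hdf, Matrix.one_mul]
  have r4 : ∀ {n : Type} (M : Matrix (Fin 1) n B), f * (d * M) = M := fun M => by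
    rw [← Matrix.mul_assoc, hfd, Matrix.one_mul]
  refine ⟨N.submatrix E.symm E.symm, ?_, ?_⟩
  · rw [hT, Matrix.submatrix_mul_equiv, Matrix.fromBlocks_multiply, hA, ← Matrix.submatrix_one_equiv
      E.symm, ← Matrix.fromBlocks_one]
    congr 2 <;> simp only [Matrix.add_mul, Matrix.mul_add, Matrix.mul_neg, Matrix.neg_mul,
      Matrix.mul_assoc, r1, r3, hY1, hdf, Matrix.mul_one] <;> abel
  · rw [hT, Matrix.submatrix_mul_equiv, Matrix.fromBlocks_multiply, hA, ← Matrix.submatrix_one_equiv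
      E.symm, ← Matrix.fromBlocks_one]
    congr 2 <;> simp only [Matrix.add_mul, Matrix.mul_add, Matrix.mul_neg, Matrix.neg_mul,
      Matrix.mul_assoc, r2, r4, hY2, hfd, Matrix.mul_one] <;> abel

/-- The last column of `R T = 1` eliminates the odd entries `R_i4` from the even part of that
equation. -/
theorem evenBlock_mul_schur (hR : R * T = 1) (h1 : T 4 4 * e = 1) :
    evenBlock R * schur T e = 1 := by
  have hm : ∀ i j, ∑ k : Fin 4, R i k.castSucc * T k.castSucc j + R i 4 * T 4 j =
      (1 : Matrix (Fin 5) (Fin 5) B) i j := fun i j => by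
    rw [← hR, Matrix.mul_apply, sum_univ_castSucc]
  refine Matrix.ext fun i j => ?_
  have e1 := hm i.castSucc j.castSucc
  have e2 := hm i.castSucc 4
  rw [Matrix.one_apply_ne (castSucc_lt_four i).ne] at e2
  rw [Matrix.mul_apply]
  simp only [schur, evenBlock, Matrix.of_apply, mul_sub, Finset.sum_sub_distrib, ← mul_assoc]
  rw [eq_sub_of_add_eq e1, ← Finset.sum_mul, ← Finset.sum_mul, eq_neg_of_add_eq_zero_left e2,
    neg_mul, mul_assoc (R _ _), h1, mul_one, neg_mul, sub_neg_eq_add, sub_add_cancel,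
    Matrix.one_apply, Matrix.one_apply]
  simp

/-- The last row of `R T = 1` eliminates the odd entries `T_4j` from the even part of that equation.
-/
theorem schur_mul_evenBlock (hR : R * T = 1) (h1 : g * R 4 4 = 1) :
    schur R g * evenBlock T = 1 := by
  have hm : ∀ i j, ∑ k : Fin 4, R i k.castSucc * T k.castSucc j + R i 4 * T 4 j =
      (1 : Matrix (Fin 5) (Fin 5) B) i j := fun i j => by
    rw [← hR, Matrix.mul_apply, sum_univ_castSucc]
  refine Matrix.ext fun i j => ?_
  have e1 := hm i.castSucc j.castSucc
  have e2 := hm 4 j.castSucc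
  rw [Matrix.one_apply_ne (castSucc_lt_four j).ne'] at e2
  rw [Matrix.mul_apply]
  simp only [schur, evenBlock, Matrix.of_apply, sub_mul, Finset.sum_sub_distrib, mul_assoc]
  rw [eq_sub_of_add_eq e1, ← Finset.mul_sum, ← Finset.mul_sum, eq_neg_of_add_eq_zero_left e2,
    mul_neg, mul_neg, ← mul_assoc g, h1, one_mul, sub_neg_eq_add, sub_add_cancel,
    Matrix.one_apply, Matrix.one_apply]
  simp

theorem IsManin.col_mul_inv_mul_row (hT : IsManin T) (h1 : T 4 4 * e = 1) (h2 : e * T 4 4 = 1)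
    (i j : Fin 4) : T i.castSucc 4 * e * T 4 j.castSucc =
      -(T 4 j.castSucc * e * T i.castSucc 4) := by
  rw [mul_assoc, mul_assoc, hT.inv_mul_col h1 h2, hT.inv_mul_row h1 h2, mul_smul_comm,
    mul_smul_comm, ← mul_assoc, ← mul_assoc, hT.row_mul_col, neg_mul, smul_neg, neg_neg]

/-- Passing to the opposite algebra reverses `b e c`. The sign from `IsManin.col_mul_inv_mul_row`
and the square of `sqrtNegOne` from the two odd factors cancel. -/
theorem schur_opMatrix (hR : IsManin (opMatrix R)) (h1 : R 4 4 * g = 1) (h2 : g * R 4 4 = 1) :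
    schur (opMatrix R) (MulOpposite.op g) = (schur R g).map MulOpposite.op := by
  have hσ : opMatrix R 4 4 = MulOpposite.op (R 4 4) := by
    rw [opMatrix, par_four_four, pow_zero, one_smul]
  refine Matrix.ext fun i j => ?_
  have h := hR.col_mul_inv_mul_row (e := MulOpposite.op g)
    (by rw [hσ, ← MulOpposite.op_mul, h2, MulOpposite.op_one])
    (by rw [hσ, ← MulOpposite.op_mul, h1, MulOpposite.op_one]) i j
  rw [schur, Matrix.of_apply, h, Matrix.map_apply, schur, Matrix.of_apply]
  refine MulOpposite.unop_injective ?_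
  simp only [opMatrix, par_castSucc, par_castSucc_four, par_four_castSucc, pow_zero, one_smul,
    pow_one, MulOpposite.unop_sub, MulOpposite.unop_neg, MulOpposite.unop_mul, MulOpposite.unop_op,
    smul_mul_assoc, mul_smul_comm, smul_smul, sqrtNegOne_mul, neg_smul, neg_neg, mul_assoc]

end Inverse

theorem qdet_schur_genMat : qdet (schur genMat a55inv) = genMat 4 4 := by
  have h := berezinian_genMat
  rw [berezinian] at h
  exact left_inv_eq_right_inv h a55inv_mul_corner

/-- Because the Berezinian is 1, the Schur complement has quantum determinant `a₅₅`, a unit. So it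
is invertible, and with it the whole matrix. -/
theorem exists_genMat_inverse : ∃ R, genMat * R = 1 ∧ R * genMat = 1 := by
  obtain ⟨Y, hY1, hY2⟩ := (isManin_genMat.schur corner_mul_a55inv a55inv_mul_corner).exists_inverse
    (by rw [qdet_schur_genMat]; exact ⟨⟨_, _, corner_mul_a55inv, a55inv_mul_corner⟩, rfl⟩)
  exact exists_inverse_of_schur corner_mul_a55inv a55inv_mul_corner hY1 hY2

/-- The inverse of the matrix of generators. -/
noncomputable def genInv : Matrix (Fin 5) (Fin 5) OSL := exists_genMat_inverse.choose

theorem genMat_mul_genInv : genMat * genInv = 1 := exists_genMat_inverse.choose_spec.1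

theorem genInv_mul_genMat : genInv * genMat = 1 := exists_genMat_inverse.choose_spec.2

theorem genInv_corner : genInv 4 4 = detInv := by
  have h := isManin_genMat.inverse_corner_mul_qdet corner_mul_a55inv a55inv_mul_corner
    genInv_mul_genMat
  rw [berezinian_genMat] at h
  exact left_inv_eq_right_inv h qdet_mul_detInv

theorem isManin_opMatrix_genInv : IsManin (opMatrix genInv) :=
  isManin_genMat.opMatrix genMat_mul_genInv genInv_mul_genMat
    ⟨⟨_, _, corner_mul_a55inv, a55inv_mul_corner⟩, rfl⟩

/-- The algebra homomorphism to the opposite algebra underlying the antipode. -/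
theorem exists_antipodeHom : ∃ f : OSL →ₐ[Cq] OSLᵐᵒᵖ, ∀ i j, f (a i j) = opMatrix genInv i j := by
  have hσ : opMatrix genInv 4 4 = MulOpposite.op detInv := by
    rw [opMatrix, par_four_four, pow_zero, one_smul, genInv_corner]
  refine exists_slLift isManin_opMatrix_genInv (e := MulOpposite.op (qdet (evenBlock genMat)))
    (by rw [hσ, ← MulOpposite.op_mul, qdet_mul_detInv, MulOpposite.op_one])
    (by rw [hσ, ← MulOpposite.op_mul, detInv_mul_qdet, MulOpposite.op_one]) ?_ ?_
  -- The even block of the inverse is a left inverse of the Schur complement, whose determinant is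
  -- `a₅₅`. Its determinant over the opposite algebra is thus `a₅₅⁻¹`.
  · have h := (isManin_genMat.schur corner_mul_a55inv
      a55inv_mul_corner).isRightQuantum.qdet_op_mul_qdet
      (evenBlock_mul_schur genInv_mul_genMat corner_mul_a55inv)
    rw [qdet_schur_genMat] at h
    have h' : evenBlock (opMatrix genInv) = (evenBlock genInv).map MulOpposite.op := by
      refine Matrix.ext fun i j => ?_
      rw [evenBlock, Matrix.of_apply, opMatrix, par_castSucc, pow_zero, one_smul]
      rfl
    rw [h', ← MulOpposite.op_unop (qdet _), left_inv_eq_right_inv h corner_mul_a55inv]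
    exact (isUnit_iff_exists.2 ⟨_, a55inv_mul_corner, corner_mul_a55inv⟩).op
  -- The Schur complement of the inverse is a left inverse of the even block, so its opposite
  -- determinant is `D₁⁻¹`. This cancels the inverse corner `D₁`, leaving Berezinian 1.
  · have h := isManin_genMat.evenBlock.isRightQuantum.qdet_op_mul_qdet
      (schur_mul_evenBlock (g := qdet (evenBlock genMat)) genInv_mul_genMat
        (by rw [genInv_corner, qdet_mul_detInv]))
    rw [berezinian, schur_opMatrix isManin_opMatrix_genInv
      (by rw [genInv_corner, detInv_mul_qdet]) (by rw [genInv_corner, qdet_mul_detInv]),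
      ← MulOpposite.op_unop (qdet _), left_inv_eq_right_inv h qdet_mul_detInv,
      ← MulOpposite.op_mul, qdet_mul_detInv, MulOpposite.op_one]

end QuantumSuper


/-! ### The parity automorphism and signs -/

section Parity

variable {R A : Type*} [CommRing R] [Ring A] [Algebra R A] (𝒜 : ZMod 2 → Submodule R A)
  [GradedAlgebra 𝒜]

theorem ZMod.two_cases (i : ZMod 2) : i = 0 ∨ i = 1 := by revert i; decide

theorem uzpow_zmod_two_one : (-1 : ℤˣ) ^ (1 : ZMod 2) = -1 := uzpow_one _

/-- Induction on elements of a superalgebra, reducing to homogeneous elements. -/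
theorem superInduction {P : A → Prop} (hom : ∀ i, ∀ x ∈ 𝒜 i, P x)
    (add : ∀ x y, P x → P y → P (x + y)) (x : A) : P x := by
  induction x using DirectSum.Decomposition.inductionOn 𝒜 with
  | zero => exact hom 0 0 (zero_mem _)
  | homogeneous x => exact hom _ _ x.2
  | add x y hx hy => exact add x y hx hy

theorem proj_of_mem {i : ZMod 2} {x : A} (hx : x ∈ 𝒜 i) (j : ZMod 2) :
    GradedAlgebra.proj 𝒜 j x = if i = j then x else 0 := by
  rw [GradedAlgebra.proj_apply]
  split_ifs with h
  · subst h
    exact DirectSum.decompose_of_mem_same 𝒜 hx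
  · exact DirectSum.decompose_of_mem_ne 𝒜 hx h

theorem proj_sub_proj_of_mem {i : ZMod 2} {x : A} (hx : x ∈ 𝒜 i) :
    (GradedAlgebra.proj 𝒜 0 - GradedAlgebra.proj 𝒜 1) x = (-1 : ℤˣ) ^ i • x := by
  rw [LinearMap.sub_apply, proj_of_mem 𝒜 hx, proj_of_mem 𝒜 hx]
  obtain rfl | rfl := ZMod.two_cases i
  · simp
  · rw [uzpow_zmod_two_one]
    simp

/-- The parity automorphism of a superalgebra. -/
noncomputable def gradeSign : A →ₐ[R] A :=
  AlgHom.ofLinearMap (GradedAlgebra.proj 𝒜 0 - GradedAlgebra.proj 𝒜 1)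
    (by rw [proj_sub_proj_of_mem 𝒜 SetLike.GradedOne.one_mem, uzpow_zero, one_smul])
    (by
      intro x y
      induction x using superInduction 𝒜 with
      | add x x' hx hx' => rw [add_mul, map_add, hx, hx', map_add, add_mul]
      | hom i x hx =>
        induction y using superInduction 𝒜 with
        | add y y' hy hy' => rw [mul_add, map_add, hy, hy', map_add, mul_add]
        | hom j y hy =>
          rw [proj_sub_proj_of_mem 𝒜 hx, proj_sub_proj_of_mem 𝒜 hy,
            proj_sub_proj_of_mem 𝒜 (SetLike.GradedMul.mul_mem hx hy), uzpow_add, smul_mul_assoc,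
            mul_smul_comm, smul_smul])

theorem gradeSign_of_mem {i : ZMod 2} {x : A} (hx : x ∈ 𝒜 i) :
    gradeSign 𝒜 x = (-1 : ℤˣ) ^ i • x := proj_sub_proj_of_mem 𝒜 hx

theorem gradeSign_gradeSign (x : A) : gradeSign 𝒜 (gradeSign 𝒜 x) = x := by
  induction x using superInduction 𝒜 with
  | add x x' hx hx' => rw [map_add, map_add, hx, hx']
  | hom i x hx =>
    rw [gradeSign_of_mem 𝒜 hx, gradeSign_of_mem 𝒜 (i := i) (by
      rcases Int.units_eq_one_or ((-1 : ℤˣ) ^ i) with h | h <;> simp [h, hx]), smul_smul,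
      Int.units_mul_self, one_smul]

theorem unitsSmul_mem {M : Type*} [AddCommGroup M] [Module R M] (N : Submodule R M) (u : ℤˣ)
    {x : M} (hx : x ∈ N) : u • x ∈ N := by
  rcases Int.units_eq_one_or u with h | h <;> simp [h, hx]

theorem map_unitsSmul {M N F : Type*} [AddCommGroup M] [AddCommGroup N] [FunLike F M N]
    [AddMonoidHomClass F M N] (f : F) (u : ℤˣ) (x : M) : f (u • x) = u • f x := by
  rcases Int.units_eq_one_or u with h | h <;> simp [h]

/-- `λ(x)` for even `x` and `g λ(x)` for odd `x`, where `g` is an involution. -/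
noncomputable def signTwist {E : Type*} [Ring E] [Algebra R E]
    (f : A →ₐ[R] E) (g : E) (hg : g * g = 1) (hc : ∀ x, g * f x = f x * g) : A →ₐ[R] E :=
  AlgHom.ofLinearMap
    (f.toLinearMap ∘ₗ GradedAlgebra.proj 𝒜 0 +
      LinearMap.mulLeft R g ∘ₗ f.toLinearMap ∘ₗ GradedAlgebra.proj 𝒜 1)
    (by simp [proj_of_mem 𝒜 SetLike.GradedOne.one_mem])
    (by
      intro x y
      induction x using superInduction 𝒜 with
      | add x x' hx hx' => rw [add_mul, map_add, hx, hx', map_add, add_mul]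
      | hom i x hx =>
        induction y using superInduction 𝒜 with
        | add y y' hy hy' => rw [mul_add, map_add, hy, hy', map_add, mul_add]
        | hom j y hy =>
          simp only [LinearMap.add_apply, LinearMap.comp_apply, proj_of_mem 𝒜 hx,
            proj_of_mem 𝒜 hy, proj_of_mem 𝒜 (SetLike.GradedMul.mul_mem hx hy)]
          have h11 : (1 : ZMod 2) + 1 = 0 := rfl
          have hgg : g * f x * (g * f y) = f x * f y := by
            rw [hc, mul_assoc, ← mul_assoc g, hg, one_mul]
          obtain rfl | rfl := ZMod.two_cases i <;> obtain rfl | rfl := ZMod.two_cases j <;>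
            simp [h11, hgg, mul_assoc]
          rw [← mul_assoc, hc, mul_assoc])

theorem signTwist_of_mem {E : Type*} [Ring E] [Algebra R E] (f : A →ₐ[R] E) (g : E)
    (hg : g * g = 1) (hc : ∀ x, g * f x = f x * g) {i : ZMod 2} {x : A} (hx : x ∈ 𝒜 i) :
    signTwist 𝒜 f g hg hc x = if i = 0 then f x else g * f x := by
  change f (GradedAlgebra.proj 𝒜 0 x) + g * f (GradedAlgebra.proj 𝒜 1 x) = _
  rw [proj_of_mem 𝒜 hx, proj_of_mem 𝒜 hx]
  obtain rfl | rfl := ZMod.two_cases i <;> simp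

end Parity


/-! ### Hopf superalgebras generated by a matrix -/

section MatrixGenerated

variable {R A : Type*} [CommRing R] [Invertible (2 : R)] [Ring A] [Algebra R A]
  {𝒜 : ZMod 2 → Submodule R A} [GradedAlgebra 𝒜] {n : Type*}

theorem ZMod.add_eq_one_of_ne {i l : ZMod 2} (h : l ≠ i) : i + l = 1 := by
  revert i l; decide

theorem mem_of_two_smul_mem {M : Type*} [AddCommGroup M] [Module R M] {N : Submodule R M} {x : M}
    (h : x + x ∈ N) : x ∈ N := by
  have := N.smul_mem (⅟(2 : R)) h
  rwa [← two_smul R x, smul_smul, invOf_mul_self, one_smul] at this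

/-- The superalgebra is generated, up to adding two-sided inverses, by the homogeneous entries of
the matrix `t`. -/
structure IsMatrixGenerated (𝒜 : ZMod 2 → Submodule R A) (t : n → n → A) (π : n → n → ZMod 2) :
    Prop where
  mem : ∀ i j, t i j ∈ 𝒜 (π i j)
  add : ∀ i j k, π i j + π j k = π i k
  eq_top : ∀ S : Subalgebra R A, (∀ i j, t i j ∈ S) →
    (∀ x y, x ∈ S → x * y = 1 → y * x = 1 → y ∈ S) → S = ⊤

variable {t : n → n → A} {π : n → n → ZMod 2}

theorem IsMatrixGenerated.algHom_ext (h : IsMatrixGenerated 𝒜 t π) {B : Type*} [Semiring B]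
    [Algebra R B] {f g : A →ₐ[R] B} (hfg : ∀ i j, f (t i j) = g (t i j)) : f = g := by
  have := h.eq_top (AlgHom.equalizer f g) hfg (by
    intro x y hx h1 h2
    have hx' : f x = g x := hx
    change f y = g y
    have e1 : f y * f x = 1 := by rw [← map_mul, h2, map_one]
    have e2 : f x * g y = 1 := by rw [hx', ← map_mul, h1, map_one]
    exact left_inv_eq_right_inv e1 e2)
  ext x
  have hx : x ∈ AlgHom.equalizer f g := by rw [this]; trivial
  exact hx

theorem IsMatrixGenerated.self (h : IsMatrixGenerated 𝒜 t π) (i : n) : π i i = 0 := by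
  simpa using h.add i i i

theorem tmul_mem_iSup {i j k : ZMod 2} (hk : j + k = i) {u v : A} (hu : u ∈ 𝒜 j) (hv : v ∈ 𝒜 k) :
    u ⊗ₜ[R] v ∈
      ⨆ j : ZMod 2, LinearMap.range (TensorProduct.map (𝒜 j).subtype (𝒜 (i - j)).subtype) := by
  refine Submodule.mem_iSup_of_mem j ⟨⟨u, hu⟩ ⊗ₜ ⟨v, ?_⟩, rfl⟩
  rw [← hk, add_sub_cancel_left]
  exact hv

theorem iSup_range_induction {i : ZMod 2} {P : A ⊗[R] A → Prop} (h0 : P 0)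
    (htmul : ∀ j k, j + k = i → ∀ u ∈ 𝒜 j, ∀ v ∈ 𝒜 k, P (u ⊗ₜ v))
    (hadd : ∀ x y, P x → P y → P (x + y)) {z : A ⊗[R] A}
    (hz : z ∈ ⨆ j : ZMod 2,
      LinearMap.range (TensorProduct.map (𝒜 j).subtype (𝒜 (i - j)).subtype)) : P z := by
  induction hz using Submodule.iSup_induction' with
  | zero => exact h0
  | add x y _ _ hx hy => exact hadd x y hx hy
  | mem j x hx =>
    obtain ⟨y, rfl⟩ := hx
    induction y using TensorProduct.induction_on with
    | zero => rw [map_zero]; exact h0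
    | add x y hx hy => rw [map_add]; exact hadd _ _ hx hy
    | tmul u v => exact htmul j (i - j) (add_sub_cancel _ _) u u.2 v v.2

theorem superTensor_induction {P : A ⊗[R] A → Prop}
    (htmul : ∀ j k, ∀ u ∈ 𝒜 j, ∀ v ∈ 𝒜 k, P (u ⊗ₜ v))
    (hadd : ∀ x y, P x → P y → P (x + y)) (z : A ⊗[R] A) : P z := by
  induction z using TensorProduct.induction_on with
  | zero => simpa using htmul 0 0 0 (zero_mem _) 0 (zero_mem _)
  | add x y hx hy => exact hadd _ _ hx hy
  | tmul u v =>
    induction u using superInduction 𝒜 with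
    | add u u' h h' => rw [TensorProduct.add_tmul]; exact hadd _ _ h h'
    | hom j u hu =>
      induction v using superInduction 𝒜 with
      | add v v' h h' => rw [TensorProduct.tmul_add]; exact hadd _ _ h h'
      | hom k v hv => exact htmul j k u hu v hv

theorem gradedTmul_mul {i j : ZMod 2} {a b c d : A} (hb : b ∈ 𝒜 j) (hc : c ∈ 𝒜 i) :
    (a ᵍ⊗ₜ[R] b * c ᵍ⊗ₜ[R] d : 𝒜 ᵍ⊗[R] 𝒜) = (-1 : ℤˣ) ^ (j * i) • ((a * c) ᵍ⊗ₜ[R] (b * d)) :=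
  GradedTensorProduct.tmul_coe_mul_coe_tmul 𝒜 𝒜 a ⟨b, hb⟩ ⟨c, hc⟩ d

theorem gradedAntiComm {i j : ZMod 2} (x : 𝒜 i) (y : 𝒜 j) :
    GradedTensorProduct.includeLeft 𝒜 𝒜 (x : A) * GradedTensorProduct.includeRight 𝒜 𝒜 (y : A) =
      (-1 : ℤˣ) ^ (j * i) • ((GradedTensorProduct.includeRight 𝒜 𝒜 (y : A) : 𝒜 ᵍ⊗[R] 𝒜) *
        GradedTensorProduct.includeLeft 𝒜 𝒜 (x : A)) := by
  rw [GradedTensorProduct.includeLeft_apply, GradedTensorProduct.includeRight_apply,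
    gradedTmul_mul y.2 x.2, GradedTensorProduct.tmul_one_mul_one_tmul, one_mul, mul_one, smul_smul,
    Int.units_mul_self, one_smul]

/-- The parity automorphism of the graded tensor product. -/
noncomputable def gradeSignTensor (𝒜 : ZMod 2 → Submodule R A) [GradedAlgebra 𝒜] :
    𝒜 ᵍ⊗[R] 𝒜 →ₐ[R] 𝒜 ᵍ⊗[R] 𝒜 :=
  GradedTensorProduct.lift 𝒜 𝒜 ((GradedTensorProduct.includeLeft 𝒜 𝒜).comp (gradeSign 𝒜))
    ((GradedTensorProduct.includeRight 𝒜 𝒜).comp (gradeSign 𝒜)) (by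
      intro i j x y
      rw [AlgHom.comp_apply, AlgHom.comp_apply, gradeSign_of_mem 𝒜 x.2, gradeSign_of_mem 𝒜 y.2,
        map_unitsSmul, map_unitsSmul, smul_mul_assoc, mul_smul_comm, smul_mul_assoc, mul_smul_comm,
        gradedAntiComm]
      simp only [smul_smul]
      congr 1
      ac_rfl)

theorem gradeSignTensor_tmul {i j : ZMod 2} {x y : A} (hx : x ∈ 𝒜 i) (hy : y ∈ 𝒜 j) :
    gradeSignTensor 𝒜 (x ᵍ⊗ₜ[R] y) = (-1 : ℤˣ) ^ (i + j) • (x ᵍ⊗ₜ[R] y) := by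
  rw [gradeSignTensor, GradedTensorProduct.lift_tmul, AlgHom.comp_apply, AlgHom.comp_apply,
    gradeSign_of_mem 𝒜 hx, gradeSign_of_mem 𝒜 hy, map_unitsSmul, map_unitsSmul, smul_mul_assoc,
    mul_smul_comm, smul_smul, uzpow_add, GradedTensorProduct.includeLeft_apply,
    GradedTensorProduct.includeRight_apply, GradedTensorProduct.tmul_one_mul_one_tmul]

variable [Fintype n]

/-- The comultiplication intertwines the parity automorphisms, as is seen on generators. The
homogeneous components of the tensor square are eigenspaces of its parity automorphism, because 2 is
invertible. -/
theorem IsMatrixGenerated.comul_even (h : IsMatrixGenerated 𝒜 t π) {Δ : A →ₐ[R] 𝒜 ᵍ⊗[R] 𝒜}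
    (hΔ : ∀ i j, Δ (t i j) = ∑ k, t i k ᵍ⊗ₜ[R] t k j) (i : ZMod 2) (x : A) (hx : x ∈ 𝒜 i) :
    (GradedTensorProduct.of R 𝒜 𝒜).symm (Δ x) ∈
      ⨆ j : ZMod 2, LinearMap.range (TensorProduct.map (𝒜 j).subtype (𝒜 (i - j)).subtype) := by
  have hs : Δ.comp (gradeSign 𝒜) = (gradeSignTensor 𝒜).comp Δ := h.algHom_ext fun i j => by
    rw [AlgHom.comp_apply, AlgHom.comp_apply, gradeSign_of_mem 𝒜 (h.mem i j), map_unitsSmul, hΔ,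
      map_sum, Finset.smul_sum]
    refine Finset.sum_congr rfl fun k _ => ?_
    rw [gradeSignTensor_tmul (h.mem i k) (h.mem k j), h.add]
  have hx' : gradeSignTensor 𝒜 (Δ x) = (-1 : ℤˣ) ^ i • Δ x := by
    rw [← AlgHom.comp_apply, ← hs, AlgHom.comp_apply, gradeSign_of_mem 𝒜 hx, map_unitsSmul]
  have key : ∀ z : A ⊗[R] A, z + (-1 : ℤˣ) ^ i • (GradedTensorProduct.of R 𝒜 𝒜).symm
      (gradeSignTensor 𝒜 (GradedTensorProduct.of R 𝒜 𝒜 z)) ∈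
      ⨆ j : ZMod 2, LinearMap.range (TensorProduct.map (𝒜 j).subtype (𝒜 (i - j)).subtype) := by
    intro z
    induction z using superTensor_induction (𝒜 := 𝒜) with
    | hadd x y hx hy =>
      have := add_mem hx hy
      rw [map_add, map_add, map_add, smul_add]
      convert this using 1
      abel
    | htmul j k u hu v hv =>
      rw [gradeSignTensor_tmul hu hv, map_unitsSmul, GradedTensorProduct.of_symm_of, smul_smul,
        ← uzpow_add]
      by_cases hjk : j + k = i
      · have := tmul_mem_iSup hjk hu hv
        exact add_mem this (unitsSmul_mem _ _ this)
      · have : i + (j + k) = 1 := ZMod.add_eq_one_of_ne hjk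
        rw [this, uzpow_zmod_two_one, Units.neg_smul, one_smul, add_neg_cancel]
        exact zero_mem _
  have h2 := key ((GradedTensorProduct.of R 𝒜 𝒜).symm (Δ x))
  rw [GradedTensorProduct.symm_of_of, hx', map_unitsSmul, smul_smul, Int.units_mul_self,
    one_smul] at h2
  exact mem_of_two_smul_mem h2

/-- The counit is invariant under the parity automorphism, so on odd elements it equals its own
negative. -/
theorem IsMatrixGenerated.counit_even [DecidableEq n] (h : IsMatrixGenerated 𝒜 t π)
    {ε : A →ₐ[R] R} (hε : ∀ i j, ε (t i j) = if i = j then 1 else 0) (x : A) (hx : x ∈ 𝒜 1) :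
    ε x = 0 := by
  have hs : ε.comp (gradeSign 𝒜) = ε := h.algHom_ext fun i j => by
    rw [AlgHom.comp_apply, gradeSign_of_mem 𝒜 (h.mem i j), map_unitsSmul, hε]
    split_ifs with hij
    · rw [hij, h.self, uzpow_zero, one_smul]
    · rw [smul_zero]
  have h1 := congrArg (fun f => f x) hs
  simp only [AlgHom.comp_apply] at h1
  rw [gradeSign_of_mem 𝒜 hx, uzpow_zmod_two_one, map_unitsSmul, Units.neg_smul, one_smul] at h1
  have : ε x + ε x ∈ (⊥ : Submodule R R) := by
    nth_rw 1 [← h1]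
    rw [neg_add_cancel]
    exact zero_mem _
  exact mem_of_two_smul_mem this

/-! ### The counit axioms -/

section Counit

variable [DecidableEq n] {Δ : A →ₐ[R] 𝒜 ᵍ⊗[R] 𝒜} {ε : A →ₐ[R] R}

theorem IsMatrixGenerated.rTensor_counit (h : IsMatrixGenerated 𝒜 t π)
    (hΔ : ∀ i j, Δ (t i j) = ∑ k, t i k ᵍ⊗ₜ[R] t k j)
    (hε : ∀ i j, ε (t i j) = if i = j then 1 else 0) :
    ε.toLinearMap.rTensor A ∘ₗ (GradedTensorProduct.of R 𝒜 𝒜).symm.toLinearMap ∘ₗ Δ.toLinearMap =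
      TensorProduct.mk R _ _ 1 := by
  -- `ε ⊗ id` is an algebra homomorphism on the graded tensor square, since `ε` kills odd elements.
  -- So `(ε ⊗ id) Δ = id` may be tested on the matrix entries.
  let ψ : 𝒜 ᵍ⊗[R] 𝒜 →ₐ[R] A := GradedTensorProduct.lift 𝒜 𝒜
    ((Algebra.ofId R A).comp ε) (AlgHom.id R A) (by
      intro i j x y
      obtain rfl | rfl := ZMod.two_cases i
      · rw [mul_zero, uzpow_zero, one_smul]
        exact Algebra.commutes _ _
      · rw [AlgHom.comp_apply, h.counit_even hε x x.2, map_zero, zero_mul, mul_zero, smul_zero])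
  have hψ : ψ.comp Δ = AlgHom.id R A := h.algHom_ext fun i j => by
    rw [AlgHom.comp_apply, hΔ, map_sum]
    have : ∀ k, ψ (t i k ᵍ⊗ₜ[R] t k j) = if i = k then t k j else 0 := fun k => by
      change algebraMap R A (ε (t i k)) * t k j = _
      rw [hε]
      split_ifs <;> simp
    simp [this]
  have hz : ∀ z : A ⊗[R] A, TensorProduct.lid R A (ε.toLinearMap.rTensor A z) =
      ψ (GradedTensorProduct.of R 𝒜 𝒜 z) := by
    intro z
    induction z using TensorProduct.induction_on with
    | zero => simp
    | add x y hx hy => simp only [map_add, hx, hy]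
    | tmul u v =>
      change ε u • v = algebraMap R A (ε u) * v
      rw [Algebra.smul_def]
  refine LinearMap.ext fun x => (TensorProduct.lid R A).injective ?_
  have hx := congrArg (fun f => f x) hψ
  simp only [LinearMap.comp_apply]
  rw [hz]
  change ψ (Δ x) = _
  rw [TensorProduct.mk_apply, TensorProduct.lid_tmul, one_smul]
  exact hx

theorem IsMatrixGenerated.lTensor_counit (h : IsMatrixGenerated 𝒜 t π)
    (hΔ : ∀ i j, Δ (t i j) = ∑ k, t i k ᵍ⊗ₜ[R] t k j)
    (hε : ∀ i j, ε (t i j) = if i = j then 1 else 0) :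
    ε.toLinearMap.lTensor A ∘ₗ (GradedTensorProduct.of R 𝒜 𝒜).symm.toLinearMap ∘ₗ Δ.toLinearMap =
      (TensorProduct.mk R _ _).flip 1 := by
  let ψ : 𝒜 ᵍ⊗[R] 𝒜 →ₐ[R] A := GradedTensorProduct.lift 𝒜 𝒜
    (AlgHom.id R A) ((Algebra.ofId R A).comp ε) (by
      intro i j x y
      obtain rfl | rfl := ZMod.two_cases j
      · rw [zero_mul, uzpow_zero, one_smul]
        exact (Algebra.commutes _ _).symm
      · rw [AlgHom.comp_apply, h.counit_even hε y y.2, map_zero, zero_mul, mul_zero, smul_zero])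
  have hψ : ψ.comp Δ = AlgHom.id R A := h.algHom_ext fun i j => by
    rw [AlgHom.comp_apply, hΔ, map_sum]
    have : ∀ k, ψ (t i k ᵍ⊗ₜ[R] t k j) = if k = j then t i k else 0 := fun k => by
      change t i k * algebraMap R A (ε (t k j)) = _
      rw [hε]
      split_ifs <;> simp
    simp [this]
  have hz : ∀ z : A ⊗[R] A, TensorProduct.rid R A (ε.toLinearMap.lTensor A z) =
      ψ (GradedTensorProduct.of R 𝒜 𝒜 z) := by
    intro z
    induction z using TensorProduct.induction_on with
    | zero => simp
    | add x y hx hy => simp only [map_add, hx, hy]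
    | tmul u v =>
      change ε v • u = u * algebraMap R A (ε v)
      rw [Algebra.smul_def, Algebra.commutes]
  refine LinearMap.ext fun x => (TensorProduct.rid R A).injective ?_
  have hx := congrArg (fun f => f x) hψ
  simp only [LinearMap.comp_apply]
  rw [hz]
  change ψ (Δ x) = _
  rw [LinearMap.flip_apply, TensorProduct.mk_apply, TensorProduct.rid_tmul, one_smul]
  exact hx

end Counit

end MatrixGenerated


section MatrixGenerated

variable {R A : Type*} [CommRing R] [Invertible (2 : R)] [Ring A] [Algebra R A]
  {𝒜 : ZMod 2 → Submodule R A} [GradedAlgebra 𝒜] {n : Type*} {t : n → n → A}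
  {π : n → n → ZMod 2} [Fintype n] {Δ : A →ₐ[R] 𝒜 ᵍ⊗[R] 𝒜}

/-! ### Coassociativity -/

section Coassoc

/-- Two algebra homomorphisms supercommute. -/
def SuperCommuting (𝒜 : ZMod 2 → Submodule R A) {E : Type*} [Ring E] [Algebra R E]
    (f g : A →ₐ[R] E) : Prop :=
  ∀ ⦃i j⦄ (x : 𝒜 i) (y : 𝒜 j), f x * g y = (-1 : ℤˣ) ^ (j * i) • (g y * f x)

/-- The algebra homomorphism on the graded tensor product defined by supercommuting algebra
homomorphisms. -/
noncomputable def superLift {E : Type*} [Ring E] [Algebra R E] {f g : A →ₐ[R] E}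
    (h : SuperCommuting 𝒜 f g) : 𝒜 ᵍ⊗[R] 𝒜 →ₐ[R] E :=
  GradedTensorProduct.lift 𝒜 𝒜 f g h

theorem superLift_tmul {E : Type*} [Ring E] [Algebra R E] {f g : A →ₐ[R] E}
    (h : SuperCommuting 𝒜 f g) (x y : A) : superLift h (x ᵍ⊗ₜ[R] y) = f x * g y := rfl

/-- The convolution product of supercommuting algebra homomorphisms. -/
noncomputable def superConv {E : Type*} [Ring E] [Algebra R E] (Δ : A →ₐ[R] 𝒜 ᵍ⊗[R] 𝒜)
    {f g : A →ₐ[R] E} (h : SuperCommuting 𝒜 f g) : A →ₐ[R] E :=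
  (superLift h).comp Δ

variable {E : Type*} [Ring E] [Algebra R E] {f g k : A →ₐ[R] E}

theorem IsMatrixGenerated.superConv_gen (hΔ : ∀ i j, Δ (t i j) = ∑ k, t i k ᵍ⊗ₜ[R] t k j)
    (h : SuperCommuting 𝒜 f g) (i j : n) :
    superConv Δ h (t i j) = ∑ k, f (t i k) * g (t k j) := by
  rw [superConv, AlgHom.comp_apply, hΔ, map_sum]
  rfl

theorem IsMatrixGenerated.superCommuting_left (h : IsMatrixGenerated 𝒜 t π)
    (hΔ : ∀ i j, Δ (t i j) = ∑ k, t i k ᵍ⊗ₜ[R] t k j) (hfg : SuperCommuting 𝒜 f g)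
    (hfk : SuperCommuting 𝒜 f k) (hgk : SuperCommuting 𝒜 g k) :
    SuperCommuting 𝒜 (superConv Δ hfg) k := by
  intro i j x y
  have hx := h.comul_even hΔ i x x.2
  rw [superConv, AlgHom.comp_apply, ← GradedTensorProduct.symm_of_of 𝒜 𝒜 (Δ x)]
  generalize (GradedTensorProduct.of R 𝒜 𝒜).symm (Δ x) = z at hx
  refine iSup_range_induction (P := fun z => superLift hfg (GradedTensorProduct.of R 𝒜 𝒜 z) * k y =
    (-1 : ℤˣ) ^ (j * i) • (k y * superLift hfg (GradedTensorProduct.of R 𝒜 𝒜 z))) ?_ (fun l m hlm u hu v hv => ?_) (fun u v hu hv => ?_) hx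
  · simp
  · rw [superLift_tmul, mul_assoc, hgk ⟨v, hv⟩ y, mul_smul_comm, ← mul_assoc,
      hfk ⟨u, hu⟩ y, smul_mul_assoc, smul_smul, mul_assoc, ← uzpow_add, ← mul_add, add_comm m, hlm]
  · rw [map_add, map_add, add_mul, hu, hv, mul_add, smul_add]

theorem IsMatrixGenerated.superCommuting_right (h : IsMatrixGenerated 𝒜 t π)
    (hΔ : ∀ i j, Δ (t i j) = ∑ k, t i k ᵍ⊗ₜ[R] t k j) (hfg : SuperCommuting 𝒜 f g)
    (hfk : SuperCommuting 𝒜 f k) (hgk : SuperCommuting 𝒜 g k) :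
    SuperCommuting 𝒜 f (superConv Δ hgk) := by
  intro i j x y
  have hy := h.comul_even hΔ j y y.2
  rw [superConv, AlgHom.comp_apply, ← GradedTensorProduct.symm_of_of 𝒜 𝒜 (Δ y)]
  generalize (GradedTensorProduct.of R 𝒜 𝒜).symm (Δ y) = z at hy
  refine iSup_range_induction (P := fun z => f x * superLift hgk (GradedTensorProduct.of R 𝒜 𝒜 z) =
    (-1 : ℤˣ) ^ (j * i) • (superLift hgk (GradedTensorProduct.of R 𝒜 𝒜 z) * f x)) ?_ (fun l m hlm u hu v hv => ?_) (fun u v hu hv => ?_) hy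
  · simp
  · rw [superLift_tmul, ← mul_assoc, hfg x ⟨u, hu⟩, smul_mul_assoc, mul_assoc,
      hfk x ⟨v, hv⟩, mul_smul_comm, smul_smul, ← mul_assoc, ← uzpow_add, ← add_mul, hlm]
  · rw [map_add, map_add, mul_add, hu, hv, add_mul, smul_add]

/-- On the matrix entries this is associativity of matrix multiplication, and homomorphisms are
determined there. -/
theorem IsMatrixGenerated.superConv_assoc (h : IsMatrixGenerated 𝒜 t π)
    (hΔ : ∀ i j, Δ (t i j) = ∑ k, t i k ᵍ⊗ₜ[R] t k j) (hfg : SuperCommuting 𝒜 f g)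
    (hfk : SuperCommuting 𝒜 f k) (hgk : SuperCommuting 𝒜 g k) :
    superConv Δ (h.superCommuting_left hΔ hfg hfk hgk) =
      superConv Δ (h.superCommuting_right hΔ hfg hfk hgk) := by
  refine h.algHom_ext fun i j => ?_
  rw [superConv_gen hΔ, superConv_gen hΔ]
  simp only [superConv_gen hΔ, Finset.sum_mul, Finset.mul_sum]
  rw [Finset.sum_comm]
  simp only [mul_assoc]

theorem unitsSmul_tmul {M N : Type*} [AddCommGroup M] [AddCommGroup N] [Module R M] [Module R N]
    (u : ℤˣ) (x : M) (y : N) : (u • x) ⊗ₜ[R] y = u • (x ⊗ₜ[R] y) := by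
  rcases Int.units_eq_one_or u with h | h <;> simp [h, TensorProduct.neg_tmul]

theorem tmul_unitsSmul {M N : Type*} [AddCommGroup M] [AddCommGroup N] [Module R M] [Module R N]
    (u : ℤˣ) (x : M) (y : N) : x ⊗ₜ[R] (u • y) = u • (x ⊗ₜ[R] y) := by
  rcases Int.units_eq_one_or u with h | h <;> simp [h, TensorProduct.tmul_neg]

/-- A representation of a superalgebra together with a parity operator and a linear section. -/
structure SignedRep (𝒜 : ZMod 2 → Submodule R A) (E : Type*) [Ring E] [Algebra R E] where
  /-- The representation. -/
  rep : A →ₐ[R] E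
  /-- The powers of the parity operator. -/
  sign : ZMod 2 → E
  sign_zero : sign 0 = 1
  sign_mul_self : ∀ i, sign i * sign i = 1
  sign_mul_rep : ∀ i j, ∀ x ∈ 𝒜 j, sign i * rep x = (-1 : ℤˣ) ^ (i * j) • (rep x * sign i)
  /-- The section. -/
  eval : E →ₗ[R] A
  eval_rep_mul : ∀ x i j, eval (rep x * (sign i * sign j)) = x

namespace SignedRep

variable (ρ : SignedRep 𝒜 E)

theorem sign_mul_comm (i j : ZMod 2) : ρ.sign i * ρ.sign j = ρ.sign j * ρ.sign i := by
  obtain rfl | rfl := ZMod.two_cases i <;> obtain rfl | rfl := ZMod.two_cases j <;>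
    simp [ρ.sign_zero]

/-- The action of the first tensor factor on a triple tensor product. -/
noncomputable def factorOne : A →ₐ[R] E ⊗[R] (E ⊗[R] E) :=
  Algebra.TensorProduct.includeLeft.comp ρ.rep

/-- The action of the second tensor factor on a triple tensor product. -/
noncomputable def factorTwo : A →ₐ[R] E ⊗[R] (E ⊗[R] E) :=
  signTwist 𝒜 (((Algebra.TensorProduct.includeRight : E ⊗[R] E →ₐ[R] E ⊗[R] (E ⊗[R] E)).comp
    Algebra.TensorProduct.includeLeft).comp ρ.rep) (ρ.sign 1 ⊗ₜ (1 ⊗ₜ 1))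
    (by simp only [Algebra.TensorProduct.tmul_mul_tmul, ρ.sign_mul_self, one_mul]; rfl)
    (fun x => by
      change ρ.sign 1 ⊗ₜ[R] ((1 : E) ⊗ₜ[R] (1 : E)) * (1 : E) ⊗ₜ[R] (ρ.rep x ⊗ₜ[R] (1 : E)) =
        (1 : E) ⊗ₜ[R] (ρ.rep x ⊗ₜ[R] (1 : E)) * ρ.sign 1 ⊗ₜ[R] ((1 : E) ⊗ₜ[R] (1 : E))
      simp only [Algebra.TensorProduct.tmul_mul_tmul, one_mul, mul_one])

/-- The action of the third tensor factor on a triple tensor product. -/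
noncomputable def factorThree : A →ₐ[R] E ⊗[R] (E ⊗[R] E) :=
  signTwist 𝒜 (((Algebra.TensorProduct.includeRight : E ⊗[R] E →ₐ[R] E ⊗[R] (E ⊗[R] E)).comp
    Algebra.TensorProduct.includeRight).comp ρ.rep) (ρ.sign 1 ⊗ₜ (ρ.sign 1 ⊗ₜ 1))
    (by simp only [Algebra.TensorProduct.tmul_mul_tmul, ρ.sign_mul_self, one_mul]; rfl)
    (fun x => by
      change ρ.sign 1 ⊗ₜ[R] (ρ.sign 1 ⊗ₜ[R] (1 : E)) * (1 : E) ⊗ₜ[R] ((1 : E) ⊗ₜ[R] ρ.rep x) =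
        (1 : E) ⊗ₜ[R] ((1 : E) ⊗ₜ[R] ρ.rep x) * ρ.sign 1 ⊗ₜ[R] (ρ.sign 1 ⊗ₜ[R] (1 : E))
      simp only [Algebra.TensorProduct.tmul_mul_tmul, one_mul, mul_one])

theorem factorOne_apply (x : A) : ρ.factorOne x = ρ.rep x ⊗ₜ (1 ⊗ₜ 1) := rfl

theorem factorTwo_of_mem {i : ZMod 2} {x : A} (hx : x ∈ 𝒜 i) :
    ρ.factorTwo x = ρ.sign i ⊗ₜ (ρ.rep x ⊗ₜ 1) := by
  rw [factorTwo, signTwist_of_mem 𝒜 _ _ _ _ hx]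
  split_ifs with h
  · rw [h, ρ.sign_zero]
    rfl
  · have h1 : i = 1 := (ZMod.two_cases i).resolve_left h
    rw [h1]
    change ρ.sign 1 ⊗ₜ[R] ((1 : E) ⊗ₜ[R] (1 : E)) * (1 : E) ⊗ₜ[R] (ρ.rep x ⊗ₜ[R] (1 : E)) = _
    simp only [Algebra.TensorProduct.tmul_mul_tmul, one_mul, mul_one]

theorem factorThree_of_mem {i : ZMod 2} {x : A} (hx : x ∈ 𝒜 i) :
    ρ.factorThree x = ρ.sign i ⊗ₜ (ρ.sign i ⊗ₜ ρ.rep x) := by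
  rw [factorThree, signTwist_of_mem 𝒜 _ _ _ _ hx]
  split_ifs with h
  · rw [h, ρ.sign_zero]
    rfl
  · have h1 : i = 1 := (ZMod.two_cases i).resolve_left h
    rw [h1]
    change ρ.sign 1 ⊗ₜ[R] (ρ.sign 1 ⊗ₜ[R] (1 : E)) * (1 : E) ⊗ₜ[R] ((1 : E) ⊗ₜ[R] ρ.rep x) = _
    simp only [Algebra.TensorProduct.tmul_mul_tmul, one_mul, mul_one]

theorem superCommuting_one_two : SuperCommuting 𝒜 ρ.factorOne ρ.factorTwo := by
  intro i j x y
  rw [factorOne_apply, factorTwo_of_mem ρ y.2]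
  simp only [Algebra.TensorProduct.tmul_mul_tmul]
  rw [ρ.sign_mul_rep j i _ x.2, unitsSmul_tmul, smul_smul,
    Int.units_mul_self, one_smul, one_mul, mul_one, mul_one]

theorem superCommuting_one_three : SuperCommuting 𝒜 ρ.factorOne ρ.factorThree := by
  intro i j x y
  rw [factorOne_apply, factorThree_of_mem ρ y.2]
  simp only [Algebra.TensorProduct.tmul_mul_tmul]
  rw [ρ.sign_mul_rep j i _ x.2, unitsSmul_tmul, smul_smul,
    Int.units_mul_self, one_smul, one_mul, mul_one, one_mul, mul_one]

theorem superCommuting_two_three : SuperCommuting 𝒜 ρ.factorTwo ρ.factorThree := by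
  intro i j x y
  rw [factorTwo_of_mem ρ x.2, factorThree_of_mem ρ y.2]
  simp only [Algebra.TensorProduct.tmul_mul_tmul]
  rw [ρ.sign_mul_rep j i _ x.2, unitsSmul_tmul, tmul_unitsSmul, smul_smul,
    Int.units_mul_self, one_smul, one_mul, mul_one, ρ.sign_mul_comm]

/-- The section on the triple tensor product. -/
noncomputable def tripleEval : E ⊗[R] (E ⊗[R] E) →ₗ[R] A ⊗[R] (A ⊗[R] A) :=
  TensorProduct.map ρ.eval (TensorProduct.map ρ.eval ρ.eval)

theorem tripleEval_mul (x y z : A) :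
    ρ.tripleEval (ρ.factorOne x * (ρ.factorTwo y * ρ.factorThree z)) = x ⊗ₜ (y ⊗ₜ z) := by
  induction y using superInduction 𝒜 with
  | add y y' h h' =>
    rw [map_add ρ.factorTwo, add_mul, mul_add, map_add, h, h', TensorProduct.add_tmul,
      TensorProduct.tmul_add]
  | hom j y hy =>
    induction z using superInduction 𝒜 with
    | add z z' h h' =>
      rw [map_add ρ.factorThree, mul_add, mul_add, map_add, h, h', TensorProduct.tmul_add,
        TensorProduct.tmul_add]
    | hom k z hz =>
      have e1 := ρ.eval_rep_mul y k 0
      have e2 := ρ.eval_rep_mul z 0 0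
      rw [ρ.sign_zero, mul_one] at e1
      rw [ρ.sign_zero, mul_one, mul_one] at e2
      rw [factorOne_apply, factorTwo_of_mem ρ hy, factorThree_of_mem ρ hz]
      simp only [Algebra.TensorProduct.tmul_mul_tmul, one_mul]
      rw [tripleEval, TensorProduct.map_tmul, TensorProduct.map_tmul, ρ.eval_rep_mul, e1, e2]

end SignedRep

/-- The left regular representation. -/
noncomputable def regularRep (𝒜 : ZMod 2 → Submodule R A) [GradedAlgebra 𝒜] :
    SignedRep 𝒜 (Module.End R A) where
  rep := Algebra.lmul R A
  sign i := if i = 0 then 1 else (gradeSign 𝒜).toLinearMap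
  sign_zero := if_pos rfl
  sign_mul_self i := by
    split_ifs
    · exact one_mul 1
    · exact LinearMap.ext fun x => gradeSign_gradeSign 𝒜 x
  sign_mul_rep i j x hx := by
    obtain rfl | rfl := ZMod.two_cases i
    · simp
    · refine LinearMap.ext fun y => ?_
      simp only [one_ne_zero, if_false, one_mul]
      change gradeSign 𝒜 (x * y) = (-1 : ℤˣ) ^ j • (x * gradeSign 𝒜 y)
      rw [map_mul, gradeSign_of_mem 𝒜 hx, smul_mul_assoc]
  eval := LinearMap.applyₗ 1
  eval_rep_mul x i j := by
    have hs : ∀ i : ZMod 2,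
        (if i = 0 then (1 : Module.End R A) else (gradeSign 𝒜).toLinearMap) 1 = 1 := fun i => by
      split_ifs
      · rfl
      · exact map_one (gradeSign 𝒜)
    change x * (ite _ _ _ : Module.End R A) ((ite _ _ _ : Module.End R A) 1) = x
    rw [hs, hs, mul_one]

theorem IsMatrixGenerated.coassoc (h : IsMatrixGenerated 𝒜 t π)
    (hΔ : ∀ i j, Δ (t i j) = ∑ k, t i k ᵍ⊗ₜ[R] t k j) :
    TensorProduct.assoc R A A A ∘ₗ
      ((GradedTensorProduct.of R 𝒜 𝒜).symm.toLinearMap ∘ₗ Δ.toLinearMap).rTensor A ∘ₗ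
        ((GradedTensorProduct.of R 𝒜 𝒜).symm.toLinearMap ∘ₗ Δ.toLinearMap) =
      ((GradedTensorProduct.of R 𝒜 𝒜).symm.toLinearMap ∘ₗ Δ.toLinearMap).lTensor A ∘ₗ
        ((GradedTensorProduct.of R 𝒜 𝒜).symm.toLinearMap ∘ₗ Δ.toLinearMap) := by
  obtain ⟨δ, hδ⟩ : ∃ δ : A →ₗ[R] A ⊗[R] A,
    (GradedTensorProduct.of R 𝒜 𝒜).symm.toLinearMap ∘ₗ Δ.toLinearMap = δ := ⟨_, rfl⟩
  have hδ' : ∀ x, Δ x = GradedTensorProduct.of R 𝒜 𝒜 (δ x) := fun x => by rw [← hδ]; rfl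
  rw [hδ]
  -- Coassociativity is read off from associativity of convolution for the three embeddings of `A`
  -- into `End(A) ⊗ End(A) ⊗ End(A)`. Parity operators in the earlier factors make these embeddings
  -- supercommute, and evaluation at 1 recovers `A ⊗ A ⊗ A`.
  let ρ := regularRep 𝒜
  have h12 := ρ.superCommuting_one_two
  have h13 := ρ.superCommuting_one_three
  have h23 := ρ.superCommuting_two_three
  have hl : ∀ z : A ⊗[R] A, ρ.tripleEval (superLift
      (h.superCommuting_left hΔ h12 h13 h23) (GradedTensorProduct.of R 𝒜 𝒜 z)) =
      TensorProduct.assoc R A A A (δ.rTensor A z) := by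
    intro z
    induction z using TensorProduct.induction_on with
    | zero => simp
    | add x y hx hy => simp only [map_add, hx, hy]
    | tmul u v =>
      rw [superLift_tmul, superConv, AlgHom.comp_apply, hδ',
        LinearMap.rTensor_tmul]
      generalize δ u = w
      induction w using TensorProduct.induction_on with
      | zero => simp
      | add x y hx hy => simp only [map_add, add_mul, hx, hy, TensorProduct.add_tmul]
      | tmul p r =>
        rw [superLift_tmul, mul_assoc, ρ.tripleEval_mul, TensorProduct.assoc_tmul]
  have hr : ∀ z : A ⊗[R] A, ρ.tripleEval (superLift
      (h.superCommuting_right hΔ h12 h13 h23) (GradedTensorProduct.of R 𝒜 𝒜 z)) =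
      δ.lTensor A z := by
    intro z
    induction z using TensorProduct.induction_on with
    | zero => simp
    | add x y hx hy => simp only [map_add, hx, hy]
    | tmul u v =>
      rw [superLift_tmul, superConv, AlgHom.comp_apply, hδ',
        LinearMap.lTensor_tmul]
      generalize δ v = w
      induction w using TensorProduct.induction_on with
      | zero => simp
      | add x y hx hy => simp only [map_add, mul_add, hx, hy, TensorProduct.tmul_add]
      | tmul p r => rw [superLift_tmul, ρ.tripleEval_mul]
  refine LinearMap.ext fun x => ?_
  have key := congrArg (fun F => ρ.tripleEval (F x)) (h.superConv_assoc hΔ h12 h13 h23)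
  simp only [superConv, AlgHom.comp_apply] at key
  rw [hδ'] at key
  exact (hl _).symm.trans (key.trans (hr _))

end Coassoc

/-! ### The antipode axioms -/

section Antipode

variable [DecidableEq n] {ε : A →ₐ[R] R} {S : A →ₗ[R] A}

theorem IsMatrixGenerated.antipode_left (h : IsMatrixGenerated 𝒜 t π)
    (hΔ : ∀ i j, Δ (t i j) = ∑ k, t i k ᵍ⊗ₜ[R] t k j)
    (hε : ∀ i j, ε (t i j) = if i = j then 1 else 0) (h1 : S 1 = 1)
    (hS : ∀ i j, ∀ x ∈ 𝒜 i, ∀ y ∈ 𝒜 j, S (x * y) = (-1 : ℤˣ) ^ (j * i) • (S y * S x))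
    (hSt : ∀ i j, ∑ k, S (t i k) * t k j = if i = j then 1 else 0) :
    LinearMap.mul' R A ∘ₗ S.rTensor A ∘ₗ
      ((GradedTensorProduct.of R 𝒜 𝒜).symm.toLinearMap ∘ₗ Δ.toLinearMap) =
      Algebra.linearMap R A ∘ₗ ε.toLinearMap := by
  let Φ : 𝒜 ᵍ⊗[R] 𝒜 →ₗ[R] A :=
    LinearMap.mul' R A ∘ₗ S.rTensor A ∘ₗ (GradedTensorProduct.of R 𝒜 𝒜).symm.toLinearMap
  have hΦ : ∀ u v : A, Φ (u ᵍ⊗ₜ[R] v) = S u * v := fun _ _ => rfl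
  -- The antipode identity is strengthened by an arbitrary right factor `v`. In this form the
  -- elements satisfying it are visibly closed under products and inverses.
  let T : Subalgebra R A :=
    { carrier := {x | ∀ v, Φ (Δ x * v) = ε x • Φ v}
      mul_mem' := fun {x y} hx hy v => by
        rw [map_mul Δ, mul_assoc, hx, hy, smul_smul, map_mul ε]
      add_mem' := fun {x y} hx hy v => by
        rw [map_add Δ, add_mul, map_add, hx, hy, map_add ε, add_smul]
      algebraMap_mem' := fun r v => by
        rw [AlgHom.commutes, AlgHom.commutes, ← Algebra.smul_def, map_smul]
        rfl }
  have hT : T = ⊤ := h.eq_top T (fun i j v => by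
      obtain ⟨v, rfl⟩ := (GradedTensorProduct.of R 𝒜 𝒜).surjective v
      induction v using superTensor_induction (𝒜 := 𝒜) with
      | hadd x y hx hy => rw [map_add, mul_add, map_add, hx, hy, map_add, smul_add]
      | htmul l m u hu w hw =>
        rw [hΔ, Finset.sum_mul, map_sum, hε]
        -- The signs combine to one depending on `π i k + π k j = π i j` only, so it leaves the sum
        -- over `k`.
        have : ∀ k, Φ (t i k ᵍ⊗ₜ[R] t k j * u ᵍ⊗ₜ[R] w) =
            (-1 : ℤˣ) ^ (π i j * l) • (S u * (S (t i k) * t k j) * w) := fun k => by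
          rw [gradedTmul_mul (h.mem k j) hu, map_unitsSmul, hΦ, hS _ _ _ (h.mem i k) _ hu,
            smul_mul_assoc, smul_smul, ← uzpow_add, mul_comm l, ← add_mul, add_comm (π k j), h.add]
          simp only [mul_assoc]
        simp only [this]
        rw [← Finset.smul_sum, ← Finset.sum_mul, ← Finset.mul_sum, hSt]
        split_ifs with hij
        · rw [hij, h.self, zero_mul, uzpow_zero, one_smul, one_smul, mul_one]
          rfl
        · rw [mul_zero, zero_mul, smul_zero, zero_smul])
    (fun x y hx hxy hyx v => by
      have e1 := hx (Δ y * v)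
      rw [← mul_assoc, ← map_mul, hxy, map_one, one_mul] at e1
      rw [e1, smul_smul, ← map_mul, hyx, map_one, one_smul])
  refine LinearMap.ext fun x => ?_
  have hx : x ∈ T := by rw [hT]; trivial
  have := hx 1
  rw [mul_one] at this
  change Φ (Δ x) = algebraMap R A (ε x)
  rw [this, ← GradedTensorProduct.of_one, Algebra.TensorProduct.one_def, hΦ, h1, one_mul,
    Algebra.algebraMap_eq_smul_one]

theorem IsMatrixGenerated.antipode_right (h : IsMatrixGenerated 𝒜 t π)
    (hΔ : ∀ i j, Δ (t i j) = ∑ k, t i k ᵍ⊗ₜ[R] t k j)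
    (hε : ∀ i j, ε (t i j) = if i = j then 1 else 0) (h1 : S 1 = 1)
    (hS : ∀ i j, ∀ x ∈ 𝒜 i, ∀ y ∈ 𝒜 j, S (x * y) = (-1 : ℤˣ) ^ (j * i) • (S y * S x))
    (hSt : ∀ i j, ∑ k, t i k * S (t k j) = if i = j then 1 else 0) :
    LinearMap.mul' R A ∘ₗ S.lTensor A ∘ₗ
      ((GradedTensorProduct.of R 𝒜 𝒜).symm.toLinearMap ∘ₗ Δ.toLinearMap) =
      Algebra.linearMap R A ∘ₗ ε.toLinearMap := by
  let Φ : 𝒜 ᵍ⊗[R] 𝒜 →ₗ[R] A :=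
    LinearMap.mul' R A ∘ₗ S.lTensor A ∘ₗ (GradedTensorProduct.of R 𝒜 𝒜).symm.toLinearMap
  have hΦ : ∀ u v : A, Φ (u ᵍ⊗ₜ[R] v) = u * S v := fun _ _ => rfl
  -- As for the left identity, but with the arbitrary factor on the left of `Δ x`.
  let T : Subalgebra R A :=
    { carrier := {x | ∀ v, Φ (v * Δ x) = ε x • Φ v}
      mul_mem' := fun {x y} hx hy v => by
        rw [map_mul Δ, ← mul_assoc, hy, hx, smul_smul, map_mul ε, mul_comm]
      add_mem' := fun {x y} hx hy v => by
        rw [map_add Δ, mul_add, map_add, hx, hy, map_add ε, add_smul]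
      algebraMap_mem' := fun r v => by
        rw [AlgHom.commutes, AlgHom.commutes, ← Algebra.commutes, ← Algebra.smul_def, map_smul]
        rfl }
  have hT : T = ⊤ := h.eq_top T (fun i j v => by
      obtain ⟨v, rfl⟩ := (GradedTensorProduct.of R 𝒜 𝒜).surjective v
      induction v using superTensor_induction (𝒜 := 𝒜) with
      | hadd x y hx hy => rw [map_add, add_mul, map_add, hx, hy, map_add, smul_add]
      | htmul l m u hu w hw =>
        rw [hΔ, Finset.mul_sum, map_sum, hε]
        have : ∀ k, Φ (u ᵍ⊗ₜ[R] w * t i k ᵍ⊗ₜ[R] t k j) =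
            (-1 : ℤˣ) ^ (π i j * m) • (u * (t i k * S (t k j)) * S w) := fun k => by
          rw [gradedTmul_mul hw (h.mem i k), map_unitsSmul, hΦ, hS _ _ _ hw _ (h.mem k j),
            mul_smul_comm, smul_smul, ← uzpow_add, mul_comm m, ← add_mul, h.add]
          simp only [mul_assoc]
        simp only [this]
        rw [← Finset.smul_sum, ← Finset.sum_mul, ← Finset.mul_sum, hSt]
        split_ifs with hij
        · rw [hij, h.self, zero_mul, uzpow_zero, one_smul, one_smul, mul_one]
          rfl
        · rw [mul_zero, zero_mul, smul_zero, zero_smul])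
    (fun x y hx hxy hyx v => by
      have e1 := hx (v * Δ y)
      rw [mul_assoc, ← map_mul, hyx, map_one, mul_one] at e1
      rw [e1, smul_smul, ← map_mul, hyx, map_one, one_smul])
  refine LinearMap.ext fun x => ?_
  have hx : x ∈ T := by rw [hT]; trivial
  have := hx 1
  rw [one_mul] at this
  change Φ (Δ x) = algebraMap R A (ε x)
  rw [this, ← GradedTensorProduct.of_one, Algebra.TensorProduct.one_def, hΦ, h1, one_mul,
    Algebra.algebraMap_eq_smul_one]

/-- A superalgebra generated by a matrix is a Hopf superalgebra with the standard comultiplication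
and counit as soon as these and an antipode exist. -/
theorem IsMatrixGenerated.exists_hopfSuperalgebra (h : IsMatrixGenerated 𝒜 t π)
    (hΔ : ∀ i j, Δ (t i j) = ∑ k, t i k ᵍ⊗ₜ[R] t k j)
    (hε : ∀ i j, ε (t i j) = if i = j then 1 else 0) (h1 : S 1 = 1)
    (heven : ∀ i, ∀ x ∈ 𝒜 i, S x ∈ 𝒜 i)
    (hS : ∀ i j, ∀ x ∈ 𝒜 i, ∀ y ∈ 𝒜 j, S (x * y) = (-1 : ℤˣ) ^ (j * i) • (S y * S x))
    (hSt : ∀ i j, ∑ k, S (t i k) * t k j = if i = j then 1 else 0)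
    (hSt' : ∀ i j, ∑ k, t i k * S (t k j) = if i = j then 1 else 0) :
    ∃ H : HopfSuperalgebra 𝒜, (∀ i j, H.comul (t i j) = ∑ k, t i k ⊗ₜ[R] t k j) ∧
      (∀ i j, H.counit (t i j) = if i = j then 1 else 0) ∧ H.antipode = S :=
  ⟨{ comul := (GradedTensorProduct.of R 𝒜 𝒜).symm.toLinearMap ∘ₗ Δ.toLinearMap
     counit := ε.toLinearMap
     coassoc := h.coassoc hΔ
     rTensor_counit_comp_comul := h.rTensor_counit hΔ hε
     lTensor_counit_comp_comul := h.lTensor_counit hΔ hε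
     comul_one := map_one Δ
     comul_mul := map_mul Δ
     counit_one := map_one ε
     counit_mul := map_mul ε
     comul_even := h.comul_even hΔ
     counit_even := h.counit_even hε
     antipode := S
     antipode_even := heven
     mul_antipode_rTensor_comul := h.antipode_left hΔ hε h1 hS hSt
     mul_antipode_lTensor_comul := h.antipode_right hΔ hε h1 hS hSt' },
    fun i j => by
      change (GradedTensorProduct.of R 𝒜 𝒜).symm (Δ (t i j)) = _
      rw [hΔ, map_sum]
      rfl, hε, rfl⟩

end Antipode

end MatrixGenerated


/-! ### Parity and antipodes -/

section Parity

variable {R A : Type*} [CommRing R] [Invertible (2 : R)] [Ring A] [Algebra R A]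
  (𝒜 : ZMod 2 → Submodule R A) [GradedAlgebra 𝒜]

theorem mem_of_gradeSign {i : ZMod 2} {x : A} (hx : gradeSign 𝒜 x = (-1 : ℤˣ) ^ i • x) :
    x ∈ 𝒜 i := by
  have key : ∀ z : A, z + (-1 : ℤˣ) ^ i • gradeSign 𝒜 z ∈ 𝒜 i := by
    intro z
    induction z using superInduction 𝒜 with
    | add x y hx hy =>
      have := add_mem hx hy
      rw [map_add, smul_add]
      convert this using 1
      abel
    | hom j z hz =>
      rw [gradeSign_of_mem 𝒜 hz, smul_smul, ← uzpow_add]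
      by_cases hji : j = i
      · subst hji
        exact add_mem hz (unitsSmul_mem _ _ hz)
      · rw [ZMod.add_eq_one_of_ne hji, uzpow_zmod_two_one, Units.neg_smul, one_smul,
          add_neg_cancel]
        exact zero_mem _
  have h := key x
  rw [hx, smul_smul, Int.units_mul_self, one_smul] at h
  exact mem_of_two_smul_mem h

/-- The super anti-endomorphism attached to a homomorphism to the opposite algebra, where `s` is a
square root of `-1`. -/
noncomputable def superAnti (f : A →ₐ[R] Aᵐᵒᵖ) (s : R) : A →ₗ[R] A :=
  (MulOpposite.opLinearEquiv R).symm.toLinearMap ∘ₗ f.toLinearMap ∘ₗ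
    (GradedAlgebra.proj 𝒜 0 - s • GradedAlgebra.proj 𝒜 1)

theorem superAnti_of_mem (f : A →ₐ[R] Aᵐᵒᵖ) (s : R) {i : ZMod 2} {x : A} (hx : x ∈ 𝒜 i) :
    superAnti 𝒜 f s x = if i = 0 then (f x).unop else -(s • (f x).unop) := by
  change (f ((GradedAlgebra.proj 𝒜 0 - s • GradedAlgebra.proj 𝒜 1) x)).unop = _
  rw [LinearMap.sub_apply, LinearMap.smul_apply, proj_of_mem 𝒜 hx, proj_of_mem 𝒜 hx]
  obtain rfl | rfl := ZMod.two_cases i <;> simp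

/-- On two odd elements the factors `-s` contribute `s² = -1`, which cancels the Koszul sign. -/
theorem superAnti_mul (f : A →ₐ[R] Aᵐᵒᵖ) {s : R} (hs : s * s = -1) (i j : ZMod 2) (x : A)
    (hx : x ∈ 𝒜 i) (y : A) (hy : y ∈ 𝒜 j) : superAnti 𝒜 f s (x * y) =
      (-1 : ℤˣ) ^ (j * i) • (superAnti 𝒜 f s y * superAnti 𝒜 f s x) := by
  rw [superAnti_of_mem 𝒜 f s (SetLike.GradedMul.mul_mem hx hy), superAnti_of_mem 𝒜 f s hx,
    superAnti_of_mem 𝒜 f s hy, map_mul, MulOpposite.unop_mul]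
  have h11 : (1 : ZMod 2) + 1 = 0 := rfl
  obtain rfl | rfl := ZMod.two_cases i <;> obtain rfl | rfl := ZMod.two_cases j <;>
    simp [h11, smul_smul, hs, uzpow_zmod_two_one]

theorem superAnti_mem {f : A →ₐ[R] Aᵐᵒᵖ}
    (hf : ∀ x, f (gradeSign 𝒜 x) = MulOpposite.op (gradeSign 𝒜 (f x).unop)) (s : R) (i : ZMod 2)
    (x : A) (hx : x ∈ 𝒜 i) : superAnti 𝒜 f s x ∈ 𝒜 i := by
  have h : (f x).unop ∈ 𝒜 i := by
    refine mem_of_gradeSign 𝒜 ?_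
    rw [← MulOpposite.unop_op (gradeSign 𝒜 _), ← hf, gradeSign_of_mem 𝒜 hx, map_unitsSmul]
    rfl
  rw [superAnti_of_mem 𝒜 f s hx]
  split_ifs
  · exact h
  · exact neg_mem (Submodule.smul_mem _ _ h)

end Parity

namespace QuantumSuper

theorem uzpow_natCast_smul {M : Type*} [AddCommGroup M] [Module Cq M] (m : ℕ) (x : M) :
    (-1 : ℤˣ) ^ (m : ZMod 2) • x = (-1 : Cq) ^ m • x := by
  rw [uzpow_natCast]
  rcases Nat.even_or_odd m with h | h
  · rw [h.neg_one_pow, h.neg_one_pow, one_smul, one_smul]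
  · rw [h.neg_one_pow, h.neg_one_pow, Units.neg_smul, one_smul, neg_smul, one_smul]

theorem isMatrixGenerated : IsMatrixGenerated slGrading a fun i j => (par i j : ZMod 2) where
  mem := a_mem
  add i j k := by rw [← par_add_par i j k, ZMod.natCast_mod, Nat.cast_add]
  eq_top := eq_top_of_inverse_closed

/-! ### The counit -/

theorem isManin_one {B : Type*} [Ring B] [Algebra Cq B] :
    IsManin (1 : Matrix (Fin 5) (Fin 5) B) := by
  refine IsRTT.isManin ?_ fun i j h => ?_
  · unfold IsRTT
    rw [tensorLeft_one, tensorRight_one, mul_one, mul_one, one_mul]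
  · have : i ≠ j := by
      rintro rfl
      rw [par_self] at h
      exact zero_ne_one h
    rw [Matrix.one_apply_ne this, zero_mul]

theorem qdet_one {n : ℕ} : qdet (1 : Matrix (Fin n) (Fin n) Cq) = 1 := by
  unfold qdet
  rw [Finset.sum_eq_single 1]
  · have : permLength (1 : Equiv.Perm (Fin n)) = 0 := by
      unfold permLength
      rw [Finset.card_eq_zero, Finset.filter_eq_empty_iff]
      rintro ⟨i, j⟩ - ⟨h1, h2⟩
      exact h1.asymm h2
    rw [this]
    have h (i : Fin n) : (1 : Matrix (Fin n) (Fin n) Cq) i ((1 : Equiv.Perm (Fin n)) i) = 1 :=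
      Matrix.one_apply_eq i
    simp [List.prod_ofFn, qpow_zero, h]
  · intro σ _ hσ
    obtain ⟨i, hi⟩ : ∃ i, σ i ≠ i := by
      by_contra! h
      exact hσ (Equiv.ext h)
    have h : (1 : Matrix (Fin n) (Fin n) Cq) i (σ i) = 0 := Matrix.one_apply_ne hi.symm
    rw [List.prod_ofFn, Finset.prod_eq_zero (Finset.mem_univ i) h, smul_zero]
  · exact fun h => absurd (Finset.mem_univ _) h

theorem exists_counit : ∃ ε : OSL →ₐ[Cq] Cq, ∀ i j, ε (a i j) = if i = j then 1 else 0 := by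
  have h0 : evenBlock (1 : Matrix (Fin 5) (Fin 5) Cq) = 1 := by
    refine Matrix.ext fun i j => ?_
    rw [evenBlock, Matrix.of_apply, Matrix.one_apply, Matrix.one_apply]
    simp
  have h1 : schur (1 : Matrix (Fin 5) (Fin 5) Cq) 1 = 1 := by
    rw [← h0]
    refine Matrix.ext fun i j => ?_
    rw [schur, evenBlock, Matrix.of_apply, Matrix.of_apply,
      Matrix.one_apply_ne (i := i.castSucc) (j := 4) (Fin.castSucc_lt_last i).ne]
    simp
  obtain ⟨ε, hε⟩ := exists_slLift (B := Cq) isManin_one (e := 1)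
    (by rw [Matrix.one_apply_eq, mul_one]) (by rw [Matrix.one_apply_eq, mul_one])
    (by rw [h0, qdet_one]; exact isUnit_one) (by rw [berezinian, h1, qdet_one, mul_one])
  exact ⟨ε, fun i j => by rw [hε, Matrix.one_apply]⟩

/-! ### The comultiplication -/

/-- Applying the parity automorphism with the expected signs to the inverse gives another left
inverse; by uniqueness it is the inverse itself. -/
theorem genInv_mem (i j : Fin 5) : genInv i j ∈ slGrading (par i j : ZMod 2) := by
  have hs : ∀ m : ℕ, ∀ x : OSL, (-1 : Cq) ^ m • (-1 : Cq) ^ m • x = x := fun m x => by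
    rw [smul_smul, ← mul_pow, neg_mul_neg, one_mul, one_pow, one_smul]
  have h : Matrix.of (fun i j => (-1 : Cq) ^ par i j • gradeSign slGrading (genInv i j)) *
      genMat = 1 := by
    refine Matrix.ext fun i j => ?_
    rw [Matrix.mul_apply]
    have e : ∀ k, (-1 : Cq) ^ par i k • gradeSign slGrading (genInv i k) * genMat k j =
        (-1 : Cq) ^ par i j • gradeSign slGrading (genInv i k * genMat k j) := fun k => by
      have ha : gradeSign slGrading (genMat k j) = (-1 : Cq) ^ par k j • genMat k j := by
        rw [← uzpow_natCast_smul]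
        exact gradeSign_of_mem slGrading (a_mem k j)
      rw [map_mul, ha, mul_smul_comm, smul_smul, smul_mul_assoc, ← par_add_par i k j,
        ← neg_one_pow_eq_pow_mod_two, pow_add, mul_assoc, ← mul_pow, neg_mul_neg, one_mul,
        one_pow, mul_one]
    simp only [Matrix.of_apply, e]
    rw [← Finset.smul_sum, ← map_sum, ← Matrix.mul_apply, genInv_mul_genMat, Matrix.one_apply]
    split_ifs with hij
    · rw [hij, par_self, map_one, pow_zero, one_smul]
    · rw [map_zero, smul_zero]
  have h' : (-1 : Cq) ^ par i j • gradeSign slGrading (genInv i j) = genInv i j := by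
    exact Matrix.ext_iff.2 (left_inv_eq_right_inv h genMat_mul_genInv) i j
  refine mem_of_gradeSign slGrading ?_
  nth_rw 2 [← h']
  rw [uzpow_natCast_smul, hs]

section Product

variable {B : Type*} [Ring B] [Algebra Cq B]

theorem superCommute_map {f g : OSL →ₐ[Cq] B} (h : SuperCommuting slGrading f g)
    {M N : Matrix (Fin 5) (Fin 5) OSL} (hM : ∀ i j, M i j ∈ slGrading (par i j : ZMod 2))
    (hN : ∀ i j, N i j ∈ slGrading (par i j : ZMod 2)) : SuperCommute (M.map f) (N.map g) := by
  intro i j k l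
  have := h ⟨M i j, hM i j⟩ ⟨N k l, hN k l⟩
  rwa [← Nat.cast_mul, uzpow_natCast_smul, mul_comm (par k l)] at this

theorem SuperCommute.opMatrix {S T : Matrix (Fin 5) (Fin 5) B} (h : SuperCommute S T) :
    SuperCommute (opMatrix S) (opMatrix T) := by
  intro i j k l
  simp only [QuantumSuper.opMatrix, ← MulOpposite.op_mul, ← MulOpposite.op_smul, smul_mul_assoc,
    mul_smul_comm]
  rw [h.symm k l i j, mul_comm (par k l)]
  congr 1
  module

theorem opMatrix_mul_corner {S T : Matrix (Fin 5) (Fin 5) B} (h : SuperCommute T S) :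
    (opMatrix S * opMatrix T) 4 4 = MulOpposite.op ((S * T) 4 4) := by
  refine MulOpposite.unop_injective ?_
  rw [Matrix.mul_apply, Matrix.mul_apply, MulOpposite.unop_op, unop_sum]
  refine Finset.sum_congr rfl fun k _ => ?_
  simp only [opMatrix, MulOpposite.unop_mul, MulOpposite.unop_op, smul_mul_assoc, mul_smul_comm]
  rw [h]
  obtain ⟨k, rfl⟩ | rfl := exists_castSucc_or k
  · rw [par_castSucc_four, par_four_castSucc]
    simp [smul_smul, sqrtNegOne_mul]
  · simp [par_self]

/-- The product of two supercommuting points of `SL_q(4|1)`. -/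
theorem exists_slProd {f g : OSL →ₐ[Cq] B} (h : SuperCommuting slGrading f g) :
    ∃ F : OSL →ₐ[Cq] B, ∀ i j, F (a i j) = ∑ k, f (a i k) * g (a k j) := by
  have hT := isManin_genMat.map f
  have hS := isManin_genMat.map g
  have hgen : ∀ i j, genMat i j ∈ slGrading (par i j : ZMod 2) := a_mem
  have hTS := superCommute_map h hgen hgen
  have hc1 : ∀ f : OSL →ₐ[Cq] B, (genMat.map f) 4 4 * f a55inv = 1 := fun f => by
    rw [Matrix.map_apply, ← map_mul, corner_mul_a55inv, map_one]
  have hc2 : ∀ f : OSL →ₐ[Cq] B, f a55inv * (genMat.map f) 4 4 = 1 := fun f => by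
    rw [Matrix.map_apply, ← map_mul, a55inv_mul_corner, map_one]
  have hber : ∀ f : OSL →ₐ[Cq] B, berezinian (genMat.map f) (f a55inv) = 1 := fun f => by
    rw [← berezinian_map, berezinian_genMat, map_one]
  have hP := hT.mul hS hTS.symm
  obtain ⟨e, he1, he2⟩ := isUnit_iff_exists.1 (hT.isUnit_mul_corner hS hTS.symm
    (isUnit_iff_exists.2 ⟨_, hc1 f, hc2 f⟩) (isUnit_iff_exists.2 ⟨_, hc1 g, hc2 g⟩))
  have hb : berezinian (genMat.map f * genMat.map g) e = 1 := by
    rw [hT.berezinian_mul hS hTS.symm (hc1 f) (hc2 f) (hc1 g) (hc2 g) he1 he2, hber, hber, one_mul]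
  have hinv : genInv.map g * genInv.map f * (genMat.map f * genMat.map g) = 1 := by
    have e : ∀ f : OSL →ₐ[Cq] B, genInv.map f * genMat.map f = 1 := fun f => by
      rw [← Matrix.map_mul, genInv_mul_genMat, Matrix.map_one _ (map_zero f) (map_one f)]
    rw [Matrix.mul_assoc, ← Matrix.mul_assoc (genInv.map f), e, Matrix.one_mul, e]
  -- The quantum determinant of the even block is not multiplicative on supermatrices. Its
  -- invertibility is obtained from the corner of the inverse product, which is the corner of a
  -- product of Manin matrices over the opposite algebra.
  have hR : IsUnit ((genInv.map g * genInv.map f) 4 4) := by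
    have hcomm := superCommute_map h genInv_mem genInv_mem
    have hop : ∀ f : OSL →ₐ[Cq] B, IsManin (opMatrix (genInv.map f)) := fun f => by
      have := isManin_opMatrix_genInv.map (AlgHom.op f)
      convert this using 1
      refine Matrix.ext fun i j => ?_
      simp only [opMatrix, Matrix.map_apply, AlgHom.op_apply_apply, MulOpposite.unop_op, map_smul]
    have hu : ∀ f : OSL →ₐ[Cq] B, IsUnit (opMatrix (genInv.map f) 4 4) := fun f => by
      rw [opMatrix, par_self, pow_zero, one_smul, Matrix.map_apply, genInv_corner]
      refine IsUnit.op (IsUnit.map f ?_)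
      exact isUnit_iff_exists.2 ⟨_, detInv_mul_qdet, qdet_mul_detInv⟩
    have := (hop g).isUnit_mul_corner (hop f) hcomm.opMatrix (hu g) (hu f)
    rw [opMatrix_mul_corner hcomm] at this
    exact this.unop
  have hd : IsUnit (qdet (evenBlock (genMat.map f * genMat.map g))) := by
    have h1 := hP.inverse_corner_mul_qdet he1 he2 hinv
    rw [hb] at h1
    obtain ⟨u, hu⟩ := hR
    rw [← hu] at h1
    rw [eq_comm, ← Units.inv_mul_eq_iff_eq_mul, mul_one] at h1
    rw [← h1]
    exact Units.isUnit _
  obtain ⟨F, hF⟩ := exists_slLift hP he1 he2 hd hb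
  exact ⟨F, fun i j => by rw [hF, Matrix.mul_apply]; rfl⟩

end Product

theorem exists_comul : ∃ Δ : OSL →ₐ[Cq] slGrading ᵍ⊗[Cq] slGrading,
    ∀ i j, Δ (a i j) = ∑ k, a i k ᵍ⊗ₜ[Cq] a k j := by
  obtain ⟨F, hF⟩ := exists_slProd (f := GradedTensorProduct.includeLeft slGrading slGrading)
    (g := GradedTensorProduct.includeRight slGrading slGrading)
    (fun i j x y => gradedAntiComm x y)
  refine ⟨F, fun i j => ?_⟩
  rw [hF]
  refine Finset.sum_congr rfl fun k _ => ?_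
  rw [GradedTensorProduct.includeLeft_apply, GradedTensorProduct.includeRight_apply,
    GradedTensorProduct.tmul_one_mul_one_tmul]

/-! ### The antipode -/

theorem exists_antipode : ∃ S : OSL →ₗ[Cq] OSL, S 1 = 1 ∧
    (∀ i, ∀ x ∈ slGrading i, S x ∈ slGrading i) ∧
    (∀ i j, ∀ x ∈ slGrading i, ∀ y ∈ slGrading j,
      S (x * y) = (-1 : ℤˣ) ^ (j * i) • (S y * S x)) ∧
    ∀ i j, S (a i j) = genInv i j := by
  obtain ⟨f, hf⟩ := exists_antipodeHom
  -- On odd generators the factor `-sqrtNegOne` undoes the rescaling in `opMatrix`.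
  refine ⟨superAnti slGrading f sqrtNegOne, ?_, superAnti_mem slGrading (fun x => ?_) _,
    superAnti_mul slGrading f sqrtNegOne_mul, fun i j => ?_⟩
  · rw [superAnti_of_mem slGrading f _ SetLike.GradedOne.one_mem, if_pos rfl, map_one,
      MulOpposite.unop_one]
  · have : f.comp (gradeSign slGrading) = (AlgHom.op (gradeSign slGrading)).comp f :=
      slHom_ext fun i j => by
        rw [AlgHom.comp_apply, AlgHom.comp_apply, gradeSign_of_mem slGrading (a_mem i j),
          map_unitsSmul, hf, opMatrix, AlgHom.op_apply_apply, MulOpposite.unop_op, map_smul,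
          gradeSign_of_mem slGrading (genInv_mem i j), uzpow_natCast_smul, uzpow_natCast_smul,
          ← MulOpposite.op_smul, smul_comm]
    exact DFunLike.congr_fun this x
  · rw [superAnti_of_mem slGrading f _ (a_mem i j), hf, opMatrix, MulOpposite.unop_op]
    obtain h | h := par_cases i j
    · simp [h]
    · simp [h, smul_smul, sqrtNegOne_mul]

/-- The standard Hopf superalgebra structure on `O(SL_q(4|1))`. -/
theorem exists_standard : ∃ H : HopfSuperalgebra slGrading, IsStandard H ∧
    (∀ i j, ∀ x ∈ slGrading i, ∀ y ∈ slGrading j,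
      H.antipode (x * y) = (-1 : ℤˣ) ^ (j * i) • (H.antipode y * H.antipode x)) ∧
    ∀ i j, H.antipode (a i j) = genInv i j := by
  obtain ⟨Δ, hΔ⟩ := exists_comul
  obtain ⟨ε, hε⟩ := exists_counit
  obtain ⟨S, hS1, hSe, hSm, hSa⟩ := exists_antipode
  obtain ⟨H, h1, h2, rfl⟩ := isMatrixGenerated.exists_hopfSuperalgebra hΔ hε hS1 hSe hSm
    (fun i j => by
      simp only [hSa]
      have := congrFun₂ genInv_mul_genMat i j
      rwa [Matrix.mul_apply, Matrix.one_apply] at this)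
    (fun i j => by
      simp only [hSa]
      have := congrFun₂ genMat_mul_genInv i j
      rwa [Matrix.mul_apply, Matrix.one_apply] at this)
  exact ⟨H, fun i j => ⟨h1 i j, h2 i j⟩, hSm, hSa⟩

end QuantumSuper


/-! ### Uniqueness and quotients of Hopf superalgebras -/

theorem coalgebra_ext {R A : Type*} [CommSemiring R] [AddCommMonoid A] [Module R A]
    {C D : Coalgebra R A} (h1 : C.comul = D.comul) (h2 : C.counit = D.counit) : C = D := by
  obtain @⟨⟨c, e⟩, _, _, _⟩ := C
  obtain @⟨⟨c', e'⟩, _, _, _⟩ := D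
  obtain rfl : c = c' := h1
  obtain rfl : e = e' := h2
  rfl

namespace HopfSuperalgebra

variable {R A : Type*} [CommRing R] [Ring A] [Algebra R A] {𝒜 : ZMod 2 → Submodule R A}
  [GradedAlgebra 𝒜]

/-- Both antipodes are convolution inverses of the identity. The convolution product on linear maps
involves no signs, so the usual argument applies. -/
theorem antipode_unique {H K : HopfSuperalgebra 𝒜} (h : H.toCoalgebra = K.toCoalgebra) :
    H.antipode = K.antipode := by
  letI := K.toCoalgebra
  have hH1 := H.mul_antipode_rTensor_comul
  rw [h] at hH1
  have h1 : WithConv.toConv H.antipode * WithConv.toConv (LinearMap.id : A →ₗ[R] A) = 1 :=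
    congrArg WithConv.toConv hH1
  have h2 : WithConv.toConv (LinearMap.id : A →ₗ[R] A) * WithConv.toConv K.antipode = 1 :=
    congrArg WithConv.toConv K.mul_antipode_lTensor_comul
  exact WithConv.toConv_injective (left_inv_eq_right_inv h1 h2)

theorem eq_of_comul_eq {H K : HopfSuperalgebra 𝒜} (h1 : H.comul = K.comul)
    (h2 : H.counit = K.counit) : H = K := by
  have h : H.toCoalgebra = K.toCoalgebra := coalgebra_ext h1 h2
  have h3 := antipode_unique h
  obtain ⟨⟩ := H
  obtain ⟨⟩ := K
  simp only at h h3
  subst h h3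
  rfl

/-- The comultiplication as an algebra homomorphism to the graded tensor product. -/
noncomputable def comulHom (H : HopfSuperalgebra 𝒜) : A →ₐ[R] 𝒜 ᵍ⊗[R] 𝒜 :=
  AlgHom.ofLinearMap ((GradedTensorProduct.of R 𝒜 𝒜).toLinearMap ∘ₗ H.comul)
    (congrArg (GradedTensorProduct.of R 𝒜 𝒜) H.comul_one) H.comul_mul

/-- The counit as an algebra homomorphism. -/
noncomputable def counitHom (H : HopfSuperalgebra 𝒜) : A →ₐ[R] R :=
  AlgHom.ofLinearMap H.counit H.counit_one H.counit_mul

theorem eq_of_matrix [Invertible (2 : R)] {n : Type*} {t : n → n → A} {π : n → n → ZMod 2}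
    (h : IsMatrixGenerated 𝒜 t π) {H K : HopfSuperalgebra 𝒜}
    (h1 : ∀ i j, H.comul (t i j) = K.comul (t i j))
    (h2 : ∀ i j, H.counit (t i j) = K.counit (t i j)) : H = K := by
  have e1 : H.comulHom = K.comulHom :=
    h.algHom_ext fun i j => congrArg (GradedTensorProduct.of R 𝒜 𝒜) (h1 i j)
  have e2 : H.counitHom = K.counitHom := h.algHom_ext h2
  exact eq_of_comul_eq
    (LinearMap.ext fun x => (GradedTensorProduct.of R 𝒜 𝒜).injective (DFunLike.congr_fun e1 x))
    (LinearMap.ext fun x => DFunLike.congr_fun e2 x)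

end HopfSuperalgebra

theorem LinearMap.exists_factor {R M N P : Type*} [Ring R] [AddCommGroup M] [Module R M]
    [AddCommGroup N] [Module R N] [AddCommGroup P] [Module R P] {f : M →ₗ[R] N}
    (hf : Function.Surjective f) (g : M →ₗ[R] P) (h : ∀ x, f x = 0 → g x = 0) :
    ∃ k : N →ₗ[R] P, ∀ x, k (f x) = g x := by
  refine ⟨(LinearMap.ker f).liftQ g h ∘ₗ (f.quotKerEquivOfSurjective hf).symm.toLinearMap,
    fun x => ?_⟩
  have : (f.quotKerEquivOfSurjective hf).symm (f x) = (LinearMap.ker f).mkQ x := by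
    rw [LinearEquiv.symm_apply_eq]
    rfl
  rw [LinearMap.comp_apply, LinearEquiv.coe_coe, this]
  rfl

/-! ### Quotients by Hopf ideals -/

section Quotient

variable {R A B : Type*} [CommRing R] [Invertible (2 : R)] [Ring A] [Algebra R A]
  {𝒜 : ZMod 2 → Submodule R A} [GradedAlgebra 𝒜] [Ring B] [Algebra R B]
  {ℬ : ZMod 2 → Submodule R B} [GradedAlgebra ℬ]

/-- An even homomorphism of superalgebras induces a homomorphism of graded tensor squares. -/
noncomputable def gradedSquare (f : A →ₐ[R] B) (hf : ∀ i, ∀ x ∈ 𝒜 i, f x ∈ ℬ i) :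
    𝒜 ᵍ⊗[R] 𝒜 →ₐ[R] ℬ ᵍ⊗[R] ℬ :=
  GradedTensorProduct.lift 𝒜 𝒜 ((GradedTensorProduct.includeLeft ℬ ℬ).comp f)
    ((GradedTensorProduct.includeRight ℬ ℬ).comp f)
    (fun i j x y => gradedAntiComm (⟨f x, hf i x x.2⟩ : ℬ i) ⟨f y, hf j y y.2⟩)

theorem gradedSquare_of (f : A →ₐ[R] B) (hf : ∀ i, ∀ x ∈ 𝒜 i, f x ∈ ℬ i) (z : A ⊗[R] A) :
    gradedSquare f hf (GradedTensorProduct.of R 𝒜 𝒜 z) =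
      GradedTensorProduct.of R ℬ ℬ (TensorProduct.map f.toLinearMap f.toLinearMap z) := by
  induction z using TensorProduct.induction_on with
  | zero => simp
  | add x y hx hy => simp only [map_add, hx, hy]
  | tmul x y =>
    change GradedTensorProduct.includeLeft ℬ ℬ (f x) * GradedTensorProduct.includeRight ℬ ℬ (f y) =
      f x ᵍ⊗ₜ[R] f y
    rw [GradedTensorProduct.includeLeft_apply, GradedTensorProduct.includeRight_apply,
      GradedTensorProduct.tmul_one_mul_one_tmul]

namespace HopfSuperalgebra

/-- A Hopf superalgebra structure descends along a surjection as soon as the comultiplication,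
counit and antipode do. -/
theorem exists_quotient (H : HopfSuperalgebra 𝒜) {f : A →ₐ[R] B} (hf : Function.Surjective f)
    (hgr : ∀ i, ℬ i = (𝒜 i).map f.toLinearMap)
    (hΔ : ∀ x, f x = 0 → TensorProduct.map f.toLinearMap f.toLinearMap (H.comul x) = 0)
    (hε : ∀ x, f x = 0 → H.counit x = 0) (hS : ∀ x, f x = 0 → f (H.antipode x) = 0) :
    ∃ K : HopfSuperalgebra ℬ, IsHopfSuperalgebraHom H K f := by
  have heven : ∀ i, ∀ x ∈ 𝒜 i, f x ∈ ℬ i := fun i x hx => by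
    rw [hgr]
    exact Submodule.mem_map_of_mem hx
  have hex : ∀ i, ∀ y ∈ ℬ i, ∃ x ∈ 𝒜 i, f x = y := fun i y hy => by
    rw [hgr] at hy
    exact hy
  obtain ⟨Δ, hΔ'⟩ := LinearMap.exists_factor (f := f.toLinearMap) hf
    (TensorProduct.map f.toLinearMap f.toLinearMap ∘ₗ H.comul) hΔ
  obtain ⟨ε, hε'⟩ := LinearMap.exists_factor (f := f.toLinearMap) hf H.counit hε
  obtain ⟨S, hS'⟩ := LinearMap.exists_factor (f := f.toLinearMap) hf
    (f.toLinearMap ∘ₗ H.antipode) hS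
  have hΔf : ∀ x, Δ (f x) = TensorProduct.map f.toLinearMap f.toLinearMap (H.comul x) := hΔ'
  have hεf : ∀ x, ε (f x) = H.counit x := hε'
  have hSf : ∀ x, S (f x) = f (H.antipode x) := hS'
  have c1 : ∀ z : A ⊗[R] A, TensorProduct.assoc R B B B
      (Δ.rTensor B (TensorProduct.map f.toLinearMap f.toLinearMap z)) =
      TensorProduct.map f.toLinearMap (TensorProduct.map f.toLinearMap f.toLinearMap)
        (TensorProduct.assoc R A A A (H.comul.rTensor A z)) := by
    intro z
    induction z using TensorProduct.induction_on with
    | zero => simp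
    | add x y hx hy => simp only [map_add, hx, hy]
    | tmul x y =>
      rw [TensorProduct.map_tmul, LinearMap.rTensor_tmul, LinearMap.rTensor_tmul,
        AlgHom.toLinearMap_apply, AlgHom.toLinearMap_apply, hΔf]
      generalize H.comul x = w
      induction w using TensorProduct.induction_on with
      | zero => simp
      | add x y hx hy => simp only [map_add, hx, hy, TensorProduct.add_tmul]
      | tmul u v => rfl
  have c2 : ∀ z : A ⊗[R] A, Δ.lTensor B (TensorProduct.map f.toLinearMap f.toLinearMap z) =
      TensorProduct.map f.toLinearMap (TensorProduct.map f.toLinearMap f.toLinearMap)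
        (H.comul.lTensor A z) := by
    intro z
    induction z using TensorProduct.induction_on with
    | zero => simp
    | add x y hx hy => simp only [map_add, hx, hy]
    | tmul x y =>
      rw [TensorProduct.map_tmul, LinearMap.lTensor_tmul, LinearMap.lTensor_tmul,
        AlgHom.toLinearMap_apply, AlgHom.toLinearMap_apply, hΔf, TensorProduct.map_tmul]
      rfl
  have c3 : ∀ z : A ⊗[R] A, ε.rTensor B (TensorProduct.map f.toLinearMap f.toLinearMap z) =
      TensorProduct.map LinearMap.id f.toLinearMap (H.counit.rTensor A z) := by
    intro z
    induction z using TensorProduct.induction_on with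
    | zero => simp
    | add x y hx hy => simp only [map_add, hx, hy]
    | tmul x y => exact congrArg (· ⊗ₜ[R] f y) (hεf x)
  have c4 : ∀ z : A ⊗[R] A, ε.lTensor B (TensorProduct.map f.toLinearMap f.toLinearMap z) =
      TensorProduct.map f.toLinearMap LinearMap.id (H.counit.lTensor A z) := by
    intro z
    induction z using TensorProduct.induction_on with
    | zero => simp
    | add x y hx hy => simp only [map_add, hx, hy]
    | tmul x y => exact congrArg (f x ⊗ₜ[R] ·) (hεf y)
  have c5 : ∀ z : A ⊗[R] A, LinearMap.mul' R B
      (S.rTensor B (TensorProduct.map f.toLinearMap f.toLinearMap z)) =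
      f (LinearMap.mul' R A (H.antipode.rTensor A z)) := by
    intro z
    induction z using TensorProduct.induction_on with
    | zero => simp
    | add x y hx hy => simp only [map_add, hx, hy]
    | tmul x y => exact (congrArg (· * f y) (hSf x)).trans (map_mul f _ _).symm
  have c6 : ∀ z : A ⊗[R] A, LinearMap.mul' R B
      (S.lTensor B (TensorProduct.map f.toLinearMap f.toLinearMap z)) =
      f (LinearMap.mul' R A (H.antipode.lTensor A z)) := by
    intro z
    induction z using TensorProduct.induction_on with
    | zero => simp
    | add x y hx hy => simp only [map_add, hx, hy]
    | tmul x y => exact (congrArg (f x * ·) (hSf y)).trans (map_mul f _ _).symm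
  refine ⟨{
    comul := Δ
    counit := ε
    coassoc := LinearMap.ext fun y => ?_
    rTensor_counit_comp_comul := LinearMap.ext fun y => ?_
    lTensor_counit_comp_comul := LinearMap.ext fun y => ?_
    comul_one := ?_
    comul_mul := fun y y' => ?_
    counit_one := ?_
    counit_mul := fun y y' => ?_
    comul_even := fun i y hy => ?_
    counit_even := fun y hy => ?_
    antipode := S
    antipode_even := fun i y hy => ?_
    mul_antipode_rTensor_comul := LinearMap.ext fun y => ?_
    mul_antipode_lTensor_comul := LinearMap.ext fun y => ?_ }, heven, hΔf, hεf, hSf⟩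
  · obtain ⟨x, rfl⟩ := hf y
    have := LinearMap.congr_fun H.coassoc x
    simp only [LinearMap.comp_apply, LinearEquiv.coe_coe] at this ⊢
    rw [hΔf, c1, c2, this]
  · obtain ⟨x, rfl⟩ := hf y
    have := LinearMap.congr_fun H.rTensor_counit_comp_comul x
    simp only [LinearMap.comp_apply] at this ⊢
    rw [hΔf, c3, this]
    rfl
  · obtain ⟨x, rfl⟩ := hf y
    have := LinearMap.congr_fun H.lTensor_counit_comp_comul x
    simp only [LinearMap.comp_apply] at this ⊢
    rw [hΔf, c4, this]
    rfl
  · rw [← map_one f, hΔf, H.comul_one]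
    rfl
  · obtain ⟨x, rfl⟩ := hf y
    obtain ⟨x', rfl⟩ := hf y'
    rw [← map_mul, hΔf, hΔf, hΔf, ← gradedSquare_of f heven, ← gradedSquare_of f heven,
      ← gradedSquare_of f heven, H.comul_mul, map_mul]
  · rw [← map_one f, hεf, H.counit_one]
  · obtain ⟨x, rfl⟩ := hf y
    obtain ⟨x', rfl⟩ := hf y'
    rw [← map_mul, hεf, hεf, hεf, H.counit_mul]
  · obtain ⟨x, hx, rfl⟩ := hex i y hy
    rw [hΔf]
    refine iSup_range_induction (P := fun z => TensorProduct.map f.toLinearMap f.toLinearMap z ∈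
      ⨆ j : ZMod 2, LinearMap.range (TensorProduct.map (ℬ j).subtype (ℬ (i - j)).subtype)) ?_
      (fun j k hjk u hu v hv => ?_) (fun u v hu hv => ?_) (H.comul_even i x hx)
    · rw [map_zero]
      exact zero_mem _
    · exact tmul_mem_iSup hjk (heven j u hu) (heven k v hv)
    · rw [map_add]
      exact add_mem hu hv
  · obtain ⟨x, hx, rfl⟩ := hex 1 y hy
    rw [hεf, H.counit_even x hx]
  · obtain ⟨x, hx, rfl⟩ := hex i y hy
    rw [hSf]
    exact heven i _ (H.antipode_even i x hx)
  · obtain ⟨x, rfl⟩ := hf y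
    have := LinearMap.congr_fun H.mul_antipode_rTensor_comul x
    simp only [LinearMap.comp_apply] at this ⊢
    rw [hΔf, c5, this, hεf]
    exact f.commutes _
  · obtain ⟨x, rfl⟩ := hf y
    have := LinearMap.congr_fun H.mul_antipode_lTensor_comul x
    simp only [LinearMap.comp_apply] at this ⊢
    rw [hΔf, c6, this, hεf]
    exact f.commutes _

theorem quotient_unique {H : HopfSuperalgebra 𝒜} {K K' : HopfSuperalgebra ℬ} {f : A →ₐ[R] B}
    (hf : Function.Surjective f) (hK : IsHopfSuperalgebraHom H K f)
    (hK' : IsHopfSuperalgebraHom H K' f) : K' = K := by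
  refine eq_of_comul_eq (LinearMap.ext fun y => ?_) (LinearMap.ext fun y => ?_) <;>
    obtain ⟨x, rfl⟩ := hf y
  · rw [hK.comul, hK'.comul]
  · rw [hK.counit, hK'.counit]

section Ideal

variable {I : Ideal A} [I.IsTwoSided]

/-- Right exactness of the tensor product. The condition on `Δ(I)` becomes the vanishing of a
homomorphism, which can be tested on generators. -/
theorem map_mk_eq_zero_iff (z : A ⊗[R] A) :
    TensorProduct.map (Ideal.Quotient.mkₐ R I).toLinearMap (Ideal.Quotient.mkₐ R I).toLinearMap z =
      0 ↔ z ∈ LinearMap.range ((I.restrictScalars R).subtype.rTensor A) ⊔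
        LinearMap.range ((I.restrictScalars R).subtype.lTensor A) := by
  have hex : Function.Exact (I.restrictScalars R).subtype
      (Ideal.Quotient.mkₐ R I).toLinearMap := fun x => by
    rw [Submodule.coe_subtype, Subtype.range_coe]
    exact Ideal.Quotient.eq_zero_iff_mem
  have hs : Function.Surjective (Ideal.Quotient.mkₐ R I).toLinearMap :=
    Ideal.Quotient.mk_surjective
  rw [← LinearMap.mem_ker, TensorProduct.map_ker hex hs hex hs, sup_comm]

/-- The quotient of a Hopf superalgebra by a Hopf ideal is a Hopf superalgebra in a unique way. -/
theorem IsHopfIdeal.exists_quotient {H : HopfSuperalgebra 𝒜} (h : H.IsHopfIdeal I)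
    {ℬ : ZMod 2 → Submodule R (A ⧸ I)} [GradedAlgebra ℬ] (hℬ : ℬ = quotientGrading 𝒜 I) :
    ∃ K : HopfSuperalgebra ℬ, IsHopfSuperalgebraHom H K (Ideal.Quotient.mkₐ R I) ∧
      ∀ K' : HopfSuperalgebra ℬ,
        IsHopfSuperalgebraHom H K' (Ideal.Quotient.mkₐ R I) → K' = K := by
  have hs : Function.Surjective (Ideal.Quotient.mkₐ R I) := Ideal.Quotient.mk_surjective
  obtain ⟨K, hK⟩ := H.exists_quotient (ℬ := ℬ) hs (fun i => congrFun hℬ i)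
    (fun x hx => (map_mk_eq_zero_iff _).2 (h.comul_mem x (Ideal.Quotient.eq_zero_iff_mem.1 hx)))
    (fun x hx => h.counit_eq_zero x (Ideal.Quotient.eq_zero_iff_mem.1 hx))
    (fun x hx => Ideal.Quotient.eq_zero_iff_mem.2
      (h.antipode_mem x (Ideal.Quotient.eq_zero_iff_mem.1 hx)))
  exact ⟨K, hK, fun K' hK' => quotient_unique hs hK hK'⟩

end Ideal

/-- A two-sided ideal generated by homogeneous elements is a Hopf ideal as soon as its generators
satisfy the defining conditions. -/
theorem isHopfIdeal_span {H : HopfSuperalgebra 𝒜} {s : Set A} (hs : ∀ x ∈ s, ∃ i, x ∈ 𝒜 i)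
    (hSm : ∀ i j, ∀ x ∈ 𝒜 i, ∀ y ∈ 𝒜 j,
      H.antipode (x * y) = (-1 : ℤˣ) ^ (j * i) • (H.antipode y * H.antipode x))
    (hΔ : ∀ x ∈ s, TensorProduct.map
      (Ideal.Quotient.mkₐ R (TwoSidedIdeal.span s).asIdeal).toLinearMap
      (Ideal.Quotient.mkₐ R (TwoSidedIdeal.span s).asIdeal).toLinearMap (H.comul x) = 0)
    (hε : ∀ x ∈ s, H.counit x = 0)
    (hS : ∀ x ∈ s, H.antipode x ∈ (TwoSidedIdeal.span s).asIdeal) :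
    H.IsHopfIdeal (TwoSidedIdeal.span s).asIdeal := by
  have hhom := isHomogeneous_span_of_homogeneous 𝒜 s hs
  refine ⟨hhom, fun x hx => ?_, fun x hx => ?_, fun x hx => ?_⟩
  · rw [← map_mk_eq_zero_iff]
    letI := quotientGradedAlgebra 𝒜 _ hhom
    -- The comultiplication followed by the projection is an algebra homomorphism into the graded
    -- tensor square of the quotient. Its kernel is a two-sided ideal, so it suffices that it
    -- contains the generators.
    let F := (gradedSquare (ℬ := quotientGrading 𝒜 (TwoSidedIdeal.span s).asIdeal)
      (Ideal.Quotient.mkₐ R (TwoSidedIdeal.span s).asIdeal)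
      (fun i x hx => Submodule.mem_map_of_mem hx)).comp H.comulHom
    have hF : ∀ x, F x = GradedTensorProduct.of R _ _ (TensorProduct.map
      (Ideal.Quotient.mkₐ R (TwoSidedIdeal.span s).asIdeal).toLinearMap
      (Ideal.Quotient.mkₐ R (TwoSidedIdeal.span s).asIdeal).toLinearMap (H.comul x)) :=
        fun x => gradedSquare_of _ (fun i x hx => Submodule.mem_map_of_mem hx) _
    have hle : TwoSidedIdeal.span s ≤ TwoSidedIdeal.ker F := by
      rw [TwoSidedIdeal.span_le]
      intro y hy
      rw [SetLike.mem_coe, TwoSidedIdeal.mem_ker, hF, hΔ y hy, map_zero]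
    have hx' := (TwoSidedIdeal.mem_ker F).1 (hle (TwoSidedIdeal.mem_asIdeal.1 hx))
    rw [hF] at hx'
    exact (GradedTensorProduct.of R _ _).map_eq_zero_iff.1 hx'
  · have hle : TwoSidedIdeal.span s ≤ TwoSidedIdeal.ker H.counitHom := by
      rw [TwoSidedIdeal.span_le]
      intro y hy
      rw [SetLike.mem_coe, TwoSidedIdeal.mem_ker]
      exact hε y hy
    exact (TwoSidedIdeal.mem_ker H.counitHom).1 (hle (TwoSidedIdeal.mem_asIdeal.1 hx))
  -- For homogeneous `u, v`, `S(u y v)` is up to sign `S(v) S(y) S(u)`, by super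
  -- anti-multiplicativity.
  · rw [TwoSidedIdeal.mem_asIdeal, TwoSidedIdeal.mem_span_iff_mem_addSubgroup_closure] at hx
    induction hx using AddSubgroup.closure_induction with
    | zero => rw [map_zero]; exact zero_mem _
    | add x y _ _ hx hy => rw [map_add]; exact add_mem hx hy
    | neg x _ hx => rw [map_neg]; exact neg_mem hx
    | mem x hx =>
      obtain ⟨_, ⟨u, -, y, hy, rfl⟩, v, -, rfl⟩ := hx
      obtain ⟨j, hj⟩ := hs y hy
      change H.antipode (u * y * v) ∈ _
      induction u using superInduction 𝒜 with
      | add u u' hu hu' => rw [add_mul, add_mul, map_add]; exact add_mem hu hu'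
      | hom i u hu =>
        induction v using superInduction 𝒜 with
        | add v v' hv hv' => rw [mul_add, map_add]; exact add_mem hv hv'
        | hom k v hv =>
          rw [hSm _ _ _ (SetLike.GradedMul.mul_mem hu hj) _ hv, hSm _ _ _ hu _ hj]
          have hI : ∀ (w : ℤˣ) (z : A), z ∈ (TwoSidedIdeal.span s).asIdeal →
              w • z ∈ (TwoSidedIdeal.span s).asIdeal := fun w z hz =>
            unitsSmul_mem (Submodule.restrictScalars R (TwoSidedIdeal.span s).asIdeal) w hz
          refine hI _ _ ?_
          rw [mul_smul_comm]
          refine hI _ _ ?_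
          exact Ideal.mul_mem_left _ _ (Ideal.mul_mem_right _ _ (hS y hy))

end HopfSuperalgebra

/-- The antipode of a quotient is a super anti-homomorphism if the antipode is. -/
theorem IsHopfSuperalgebraHom.antipode_mul {H : HopfSuperalgebra 𝒜} {K : HopfSuperalgebra ℬ}
    {f : A →ₐ[R] B} (h : IsHopfSuperalgebraHom H K f)
    (hgr : ∀ i, ℬ i = (𝒜 i).map f.toLinearMap)
    (hSm : ∀ i j, ∀ x ∈ 𝒜 i, ∀ y ∈ 𝒜 j,
      H.antipode (x * y) = (-1 : ℤˣ) ^ (j * i) • (H.antipode y * H.antipode x))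
    (i j : ZMod 2) (x : B) (hx : x ∈ ℬ i) (y : B) (hy : y ∈ ℬ j) :
    K.antipode (x * y) = (-1 : ℤˣ) ^ (j * i) • (K.antipode y * K.antipode x) := by
  rw [hgr] at hx hy
  obtain ⟨x, hx, rfl⟩ := hx
  obtain ⟨y, hy, rfl⟩ := hy
  change K.antipode (f x * f y) = _ • (K.antipode (f y) * K.antipode (f x))
  rw [← map_mul, h.antipode, h.antipode, h.antipode, hSm i j x hx y hy, map_unitsSmul, map_mul]

end Quotient


namespace QuantumSuper

/-! ### Lower block triangular quantum matrices -/

section BlockTriangular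

variable {B : Type*} [Ring B] [Algebra Cq B]

/-- A surviving word has its first two letters in `{0, 1}`, hence its last two in `{2, 3}`, and its
inversions split accordingly. -/
theorem qdet_of_blockTriangular {M : Matrix (Fin 4) (Fin 4) B}
    (h : ∀ i j : Fin 4, i < 2 → 2 ≤ j → M i j = 0) :
    qdet M = (M 0 0 * M 1 1 - qpow (-1) • (M 0 1 * M 1 0)) *
      (M 2 2 * M 3 3 - qpow (-1) • (M 2 3 * M 3 2)) := by
  have w0 : ∀ l : List (Fin 4), ¬ l.Nodup → wordCoef l = 0 := fun l hl => if_neg hl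
  have w1 : wordCoef [(0 : Fin 4), 1, 2, 3] = 1 := by
    simp [wordCoef, wordInv, qpow_zero]
  have w2 : wordCoef [(0 : Fin 4), 1, 3, 2] = -qpow (-1) := by
    simp [wordCoef, wordInv]
  have w3 : wordCoef [(1 : Fin 4), 0, 2, 3] = -qpow (-1) := by
    simp [wordCoef, wordInv]
  have w4 : wordCoef [(1 : Fin 4), 0, 3, 2] = qpow (-1) * qpow (-1) := by
    simp [wordCoef, wordInv, sq]
  have hsum : ∀ a b : Fin 4, (a = 0 ∧ b = 1 ∨ a = 1 ∧ b = 0) →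
      ∑ c, ∑ d, wordCoef [a, b, c, d] • (M 0 a * M 1 b * M 2 c * M 3 d) =
        wordCoef [a, b, 2, 3] • (M 0 a * M 1 b * M 2 2 * M 3 3) +
          wordCoef [a, b, 3, 2] • (M 0 a * M 1 b * M 2 3 * M 3 2) := by
    rintro a b (⟨rfl, rfl⟩ | ⟨rfl, rfl⟩) <;> rw [← Finset.sum_product', Finset.univ_product_univ,
      Finset.sum_eq_add (2, 3) (3, 2) (by decide)] <;>
      try simp only [Finset.mem_univ, not_true_eq_false, false_implies]
    all_goals
      rintro ⟨c, d⟩ - ⟨h1, h2⟩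
      rw [w0 _ (by revert c d; decide), zero_smul]
  have hzero : ∀ a b : Fin 4, ¬(a = 0 ∧ b = 1 ∨ a = 1 ∧ b = 0) →
      ∑ c, ∑ d, wordCoef [a, b, c, d] • (M 0 a * M 1 b * M 2 c * M 3 d) = 0 := by
    intro a b hab
    refine Finset.sum_eq_zero fun c _ => Finset.sum_eq_zero fun d _ => ?_
    have : a = b ∨ 2 ≤ a ∨ 2 ≤ b := by revert a b; decide
    obtain rfl | h1 | h1 := this
    · rw [w0 _ (by simp), zero_smul]
    · rw [h 0 a (by decide) h1]
      simp
    · rw [h 1 b (by decide) h1]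
      simp
  rw [qdet_eq_sum, ← Finset.sum_product', Finset.univ_product_univ,
    Finset.sum_eq_add (0, 1) (1, 0) (by decide)
      (by rintro ⟨a, b⟩ - ⟨h1, h2⟩; exact hzero a b (by simpa using And.intro h1 h2))
      (fun h => absurd (Finset.mem_univ _) h) (fun h => absurd (Finset.mem_univ _) h)]
  rw [hsum 0 1 (by decide), hsum 1 0 (by decide), w1, w2, w3, w4]
  simp only [mul_sub, sub_mul, smul_mul_assoc, mul_smul_comm, mul_assoc]
  module

/-- The correction term in the cross relation contains an entry of the vanishing block. So the two
diagonal blocks commute entrywise, and both factors of an invertible product of commuting elements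
are invertible. -/
theorem IsManin.isUnit_block {T : Matrix (Fin 5) (Fin 5) B} (hT : IsManin T)
    (h : ∀ i j : Fin 5, i < 2 → 2 ≤ j → T i j = 0) (hd : IsUnit (qdet (QuantumSuper.evenBlock T))) :
    IsUnit (T 0 0 * T 1 1 - qpow (-1) • (T 0 1 * T 1 0)) := by
  have hc : ∀ i j k l : Fin 5, i < 2 → j < 2 → 2 ≤ k → 2 ≤ l → Commute (T i j) (T k l) := by
    intro i j k l hi hj hk hl
    have := hT.cross i j k l (hi.trans_le hk) (hj.trans_le hl)
    rwa [h i l hi hl, mul_zero, smul_zero, add_zero] at this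
  have hc' : ∀ k l : Fin 5, 2 ≤ k → 2 ≤ l →
      Commute (T 0 0 * T 1 1 - qpow (-1) • (T 0 1 * T 1 0)) (T k l) := fun k l hk hl =>
    ((hc 0 0 k l (by decide) (by decide) hk hl).mul_left
      (hc 1 1 k l (by decide) (by decide) hk hl)).sub_left
      (((hc 0 1 k l (by decide) (by decide) hk hl).mul_left
        (hc 1 0 k l (by decide) (by decide) hk hl)).smul_left _)
  have hq := qdet_of_blockTriangular (M := QuantumSuper.evenBlock T)
    (fun i j hi hj => h _ _ (by revert i; decide) (by revert j; decide))
  rw [hq] at hd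
  refine ((Commute.isUnit_mul_iff ?_).1 hd).1
  exact ((hc' 2 2 (by decide) (by decide)).mul_right (hc' 3 3 (by decide) (by decide))).sub_right
    (((hc' 2 3 (by decide) (by decide)).mul_right (hc' 3 2 (by decide) (by decide))).smul_right _)

/-- Cramer's rule: multiplying the two equations by suitable entries and eliminating leaves the
quantum determinant times each unknown. -/
theorem IsManin.eq_zero_of_block {T : Matrix (Fin 5) (Fin 5) B} (hT : IsManin T)
    (hu : IsUnit (T 0 0 * T 1 1 - qpow (-1) • (T 0 1 * T 1 0))) {x y : B}
    (h0 : T 0 0 * x + T 0 1 * y = 0) (h1 : T 1 0 * x + T 1 1 * y = 0) : x = 0 ∧ y = 0 := by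
  have e1 := hT.col 0 1 1 (by decide)
  have e2 := hT.col 0 1 0 (by decide)
  have e3 := hT.cross 0 0 1 1 (by decide) (by decide)
  have e4 := hT.comm 0 0 1 1 (by decide) (by decide)
  have i0 : idx 0 = 0 := rfl
  have i1 : idx 1 = 0 := rfl
  have v0 : eigenvalue 0 = qpow 1 := rfl
  have v1 : eigenvalue 1 = qpow 1 := if_neg (by decide)
  rw [i1, v1, mul_zero, pow_zero, one_mul] at e1
  rw [i0, i1, v0, mul_zero, pow_zero, one_mul] at e2
  rw [i1, mul_zero, pow_zero, one_smul] at e4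
  have hq := qpow_neg_mul
  constructor
  · rw [← hu.mul_right_eq_zero]
    have a0 := congrArg (T 1 1 * ·) h0
    have a1 := congrArg (T 0 1 * ·) h1
    simp only [mul_add, mul_zero, ← mul_assoc, e1] at a0 a1
    rw [e3, e4, sub_mul, add_mul]
    simp only [smul_mul_assoc] at a0 ⊢
    have a2 := congrArg (qpow 1 • ·) a1
    simp only [smul_add, smul_zero] at a2
    linear_combination (norm := skip) a0 - a2
    module
  · rw [← hu.mul_right_eq_zero]
    have a0 := congrArg (T 1 0 * ·) h0
    have a1 := congrArg (T 0 0 * ·) h1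
    simp only [mul_add, mul_zero, ← mul_assoc, e2, e4, smul_mul_assoc] at a0 a1
    rw [sub_mul, smul_mul_assoc]
    have a2 := congrArg (qpow (-1) • ·) a0
    simp only [smul_add, smul_smul, hq, one_smul, smul_zero] at a2
    linear_combination (norm := skip) a1 - a2
    module

end BlockTriangular

/-! ### The parabolic and Poincaré ideals -/

section Ideals

variable {B : Type*} [Ring B] [Algebra Cq B] {f : OSL →ₐ[Cq] B}

/-- The first two rows of `T R = 1` reduce to a homogeneous system with the upper left `2 × 2` block
as coefficients, and that block has invertible determinant. -/
theorem map_genInv_eq_zero (h : ∀ i j : Fin 5, i < 2 → 2 ≤ j → f (a i j) = 0) {i j : Fin 5}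
    (hi : i < 2) (hj : 2 ≤ j) : f (genInv i j) = 0 := by
  have hd : IsUnit (qdet (evenBlock (genMat.map f))) := by
    have : IsUnit (f (qdet (evenBlock genMat))) :=
      (isUnit_iff_exists.2 ⟨_, qdet_mul_detInv, detInv_mul_qdet⟩ : IsUnit _).map f
    rwa [qdet_map] at this
  have hsum : ∀ i : Fin 5, i < 2 → f (a i 0) * f (genInv 0 j) + f (a i 1) * f (genInv 1 j) = 0 := by
    intro i hi
    have e := congrArg f (congrFun₂ genMat_mul_genInv i j)
    rw [Matrix.mul_apply, map_sum, Matrix.one_apply_ne (hi.trans_le hj).ne, map_zero,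
      Fin.sum_univ_five] at e
    simp only [map_mul] at e
    change f (a i 0) * _ + f (a i 1) * _ + f (a i 2) * _ + f (a i 3) * _ + f (a i 4) * _ = 0 at e
    rwa [h i 2 hi (by decide), h i 3 hi (by decide), h i 4 hi (by decide), zero_mul, zero_mul,
      zero_mul, add_zero, add_zero, add_zero] at e
  have hM := isManin_genMat.map f
  have := hM.eq_zero_of_block (hM.isUnit_block h hd) (hsum 0 (by decide)) (hsum 1 (by decide))
  obtain rfl | rfl : i = 0 ∨ i = 1 := by clear hsum; revert i; decide
  · exact this.1
  · exact this.2

theorem map_genInv_four_eq_zero (h : ∀ i j : Fin 5, i < 2 → 2 ≤ j → f (a i j) = 0)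
    (h2 : f (a 4 2) = 0) (h3 : f (a 4 3) = 0) {j : Fin 5} (hj : j = 2 ∨ j = 3) :
    f (genInv 4 j) = 0 := by
  have hj2 : 2 ≤ j := by revert j; decide
  have hj4 : (4 : Fin 5) ≠ j := by revert j; decide
  have e := congrArg f (congrFun₂ genMat_mul_genInv 4 j)
  rw [Matrix.mul_apply, map_sum, Matrix.one_apply_ne hj4, map_zero, Fin.sum_univ_five] at e
  simp only [map_mul] at e
  change f (a 4 0) * _ + f (a 4 1) * _ + f (a 4 2) * _ + f (a 4 3) * _ + f (a 4 4) * _ = 0 at e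
  rw [h2, h3, map_genInv_eq_zero h (i := 0) (by decide) hj2,
    map_genInv_eq_zero h (i := 1) (by decide) hj2, mul_zero, mul_zero, zero_mul, zero_mul,
    add_zero, add_zero, add_zero, zero_add] at e
  have hu : IsUnit (f (a 4 4)) :=
    (isUnit_iff_exists.2 ⟨_, corner_mul_a55inv, a55inv_mul_corner⟩ : IsUnit _).map f
  exact hu.mul_right_eq_zero.1 e

theorem mk_parabolic_eq_zero (i j : Fin 5) (hi : i < 2) (hj : 2 ≤ j) :
    Ideal.Quotient.mkₐ Cq parabolicIdeal (a i j) = 0 := by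
  refine Ideal.Quotient.eq_zero_iff_mem.2 ?_
  rw [TwoSidedIdeal.mem_asIdeal]
  refine TwoSidedIdeal.subset_span ?_
  obtain rfl | rfl : i = 0 ∨ i = 1 := by revert i; decide
  all_goals
    obtain rfl | rfl | rfl : j = 2 ∨ j = 3 ∨ j = 4 := by revert j; decide
    all_goals simp

theorem exists_of_mem_parabolic_generators {x : OSL}
    (hx : x ∈ ({a 0 2, a 0 3, a 1 2, a 1 3, a 0 4, a 1 4} : Set OSL)) :
    ∃ i j : Fin 5, i < 2 ∧ 2 ≤ j ∧ x = a i j := by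
  obtain rfl | rfl | rfl | rfl | rfl | rfl := hx <;>
    exact ⟨_, _, by decide, by decide, rfl⟩

variable {H : HopfSuperalgebra slGrading}

theorem map_map_comul (hH : IsStandard H) (f : OSL →ₐ[Cq] B) (i j : Fin 5)
    (h : ∀ k, f (a i k) = 0 ∨ f (a k j) = 0) :
    TensorProduct.map f.toLinearMap f.toLinearMap (H.comul (a i j)) = 0 := by
  rw [(hH i j).1, map_sum]
  refine Finset.sum_eq_zero fun k _ => ?_
  change f (a i k) ⊗ₜ[Cq] f (a k j) = 0
  obtain h | h := h k
  · rw [h, TensorProduct.zero_tmul]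
  · rw [h, TensorProduct.tmul_zero]

theorem isHopfIdeal_parabolicIdeal (hH : IsStandard H)
    (hSm : ∀ i j, ∀ x ∈ slGrading i, ∀ y ∈ slGrading j,
      H.antipode (x * y) = (-1 : ℤˣ) ^ (j * i) • (H.antipode y * H.antipode x))
    (hSa : ∀ i j, H.antipode (a i j) = genInv i j) : H.IsHopfIdeal parabolicIdeal := by
  refine HopfSuperalgebra.isHopfIdeal_span ?_ hSm ?_ ?_ ?_ <;> intro x hx <;>
    obtain ⟨i, j, hi, hj, rfl⟩ := exists_of_mem_parabolic_generators hx
  · exact ⟨_, a_mem i j⟩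
  · refine map_map_comul hH _ i j fun k => ?_
    obtain hk | hk := lt_or_ge k 2
    · exact Or.inr (mk_parabolic_eq_zero k j hk hj)
    · exact Or.inl (mk_parabolic_eq_zero i k hi hk)
  · rw [(hH i j).2, if_neg (hi.trans_le hj).ne]
  · rw [hSa]
    exact Ideal.Quotient.eq_zero_iff_mem.1 (map_genInv_eq_zero mk_parabolic_eq_zero hi hj)

end Ideals

end QuantumSuper


/-! ### The ideal of `ξ` and the conclusion -/

namespace QuantumSuper

/-- The corner `g₅₅` is invertible, so the entries of `ξ` may be replaced by `γ₅₃` and `γ₅₄`, whose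
comultiplication and antipode are known directly. -/
theorem span_range_xi : TwoSidedIdeal.span (Set.range xi) = TwoSidedIdeal.span
    (Set.range ![Ideal.Quotient.mkₐ Cq parabolicIdeal (a 4 2),
      Ideal.Quotient.mkₐ Cq parabolicIdeal (a 4 3)]) := by
  let m := Ideal.Quotient.mkₐ Cq parabolicIdeal
  have h : ∀ i, xi i = m a55inv * ![m (a 4 2), m (a 4 3)] i := by
    intro i
    fin_cases i <;> exact map_mul m _ _
  have h' : ∀ i, ![m (a 4 2), m (a 4 3)] i = m (a 4 4) * xi i := fun i => by
    have e : a 4 4 * a55inv = 1 := corner_mul_a55inv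
    rw [h, ← mul_assoc, ← map_mul, e, map_one, one_mul]
  refine le_antisymm ?_ ?_ <;> rw [TwoSidedIdeal.span_le] <;> rintro _ ⟨i, rfl⟩
  · rw [h]
    exact TwoSidedIdeal.mul_mem_left _ _ _ (TwoSidedIdeal.subset_span ⟨i, rfl⟩)
  · have := h' i
    rw [SetLike.mem_coe]
    change (![m (a 4 2), m (a 4 3)] i) ∈ _
    rw [this]
    exact TwoSidedIdeal.mul_mem_left _ _ _ (TwoSidedIdeal.subset_span ⟨i, rfl⟩)

theorem isHopfIdeal_xiIdeal {H : HopfSuperalgebra slGrading} (hH : IsStandard H)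
    (hSm : ∀ i j, ∀ x ∈ slGrading i, ∀ y ∈ slGrading j,
      H.antipode (x * y) = (-1 : ℤˣ) ^ (j * i) • (H.antipode y * H.antipode x))
    (hSa : ∀ i j, H.antipode (a i j) = genInv i j) {K : HopfSuperalgebra parabolicGrading}
    (hK : IsHopfSuperalgebraHom H K (Ideal.Quotient.mkₐ Cq parabolicIdeal)) :
    K.IsHopfIdeal xiIdeal := by
  let m := Ideal.Quotient.mkₐ Cq parabolicIdeal
  have hgen : ∀ x ∈ Set.range ![m (a 4 2), m (a 4 3)], ∃ j, (j = 2 ∨ j = 3) ∧ x = m (a 4 j) := by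
    rintro _ ⟨i, rfl⟩
    fin_cases i
    · exact ⟨2, Or.inl rfl, rfl⟩
    · exact ⟨3, Or.inr rfl, rfl⟩
  unfold xiIdeal
  rw [span_range_xi]
  change K.IsHopfIdeal (TwoSidedIdeal.span (Set.range ![m (a 4 2), m (a 4 3)])).asIdeal
  let p := Ideal.Quotient.mkₐ Cq
    (TwoSidedIdeal.span (Set.range ![m (a 4 2), m (a 4 3)])).asIdeal
  have hp : ∀ i j : Fin 5, i < 2 → 2 ≤ j → p.comp m (a i j) = 0 := fun i j hi hj => by
    rw [AlgHom.comp_apply, mk_parabolic_eq_zero i j hi hj, map_zero]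
  have hp4 : ∀ j : Fin 5, j = 2 ∨ j = 3 → p.comp m (a 4 j) = 0 := fun j hj => by
    refine Ideal.Quotient.eq_zero_iff_mem.2 ?_
    rw [TwoSidedIdeal.mem_asIdeal]
    refine TwoSidedIdeal.subset_span ?_
    obtain rfl | rfl := hj
    · exact ⟨0, rfl⟩
    · exact ⟨1, rfl⟩
  refine HopfSuperalgebra.isHopfIdeal_span ?_ (hK.antipode_mul (fun i => rfl) hSm) ?_ ?_ ?_ <;>
    intro x hx <;> obtain ⟨j, hj, rfl⟩ := hgen x hx
  · exact ⟨_, Submodule.mem_map_of_mem (a_mem 4 j)⟩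
  · rw [hK.comul, ← LinearMap.comp_apply, ← TensorProduct.map_comp]
    -- In `∑ a_4k ⊗ a_kj` the right factor vanishes for `k < 2` by the parabolic relations, the left
    -- one for `k = 2, 3`, and the right one for `k = 4`, by the relation `ξ = 0`.
    refine map_map_comul hH (p.comp m) 4 j fun k => ?_
    have hk : k < 2 ∨ (k = 2 ∨ k = 3) ∨ k = 4 := by clear hx; revert k; decide
    obtain hk | hk | rfl := hk
    · exact Or.inr (hp k j hk (by obtain rfl | rfl := hj <;> decide))
    · exact Or.inl (hp4 k hk)
    · exact Or.inr (hp4 j hj)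
  · rw [hK.counit, (hH 4 j).2, if_neg (by obtain rfl | rfl := hj <;> decide)]
  · rw [hK.antipode, hSa]
    exact Ideal.Quotient.eq_zero_iff_mem.1
      (map_genInv_four_eq_zero hp (hp4 2 (Or.inl rfl)) (hp4 3 (Or.inr rfl)) hj)

end QuantumSuper

open QuantumSuper in
theorem mainTheorem3 :
    ∃ H : HopfSuperalgebra slGrading,
      (IsStandard H ∧ ∀ H' : HopfSuperalgebra slGrading, IsStandard H' → H' = H) ∧
      H.IsHopfIdeal parabolicIdeal ∧
      ∃ HP : HopfSuperalgebra parabolicGrading,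
        (IsHopfSuperalgebraHom H HP (Ideal.Quotient.mkₐ Cq parabolicIdeal) ∧
          ∀ HP' : HopfSuperalgebra parabolicGrading,
            IsHopfSuperalgebraHom H HP' (Ideal.Quotient.mkₐ Cq parabolicIdeal) → HP' = HP) ∧
        HP.IsHopfIdeal xiIdeal ∧
        ∃ HQ : HopfSuperalgebra poincareGrading,
          IsHopfSuperalgebraHom HP HQ (Ideal.Quotient.mkₐ Cq xiIdeal) ∧
          ∀ HQ' : HopfSuperalgebra poincareGrading,
            IsHopfSuperalgebraHom HP HQ' (Ideal.Quotient.mkₐ Cq xiIdeal) → HQ' = HQ := by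
  obtain ⟨H, hH, hSm, hSa⟩ := exists_standard
  have hI := isHopfIdeal_parabolicIdeal hH hSm hSa
  obtain ⟨K, hK, hKu⟩ := hI.exists_quotient (ℬ := parabolicGrading) rfl
  have hJ := isHopfIdeal_xiIdeal hH hSm hSa hK
  obtain ⟨L, hL, hLu⟩ := hJ.exists_quotient (ℬ := poincareGrading) rfl
  refine ⟨H, ⟨hH, fun H' hH' => HopfSuperalgebra.eq_of_matrix isMatrixGenerated
    (fun i j => ?_) fun i j => ?_⟩, hI, K, ⟨hK, hKu⟩, hJ, L, hL, hLu⟩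
  · rw [(hH i j).1, (hH' i j).1]
  · rw [(hH i j).2, (hH' i j).2]
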